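/- Let $n\ge 1$, let $\Omega\subset\mathbb R^n$ be a bounded domain (non-empty, open, connected), and let $u\in C^2(\overline\Omega)$ be such that the graph of $u$ is a translator in the direction $V=E_{n+1}$, that is, its mean curvature vector $H$ (the trace of the second fundamental form) satisfies $H=V^N$ over $\Omega$, where $V^N$ is the normal part of $V$; equivalently, $$\operatorname{div}\left(\frac{Du}{\sqrt{1+|Du|^2}}\right)=\frac1{\sqrt{1+|Du|^2}}\quad\text{in }\Omega .$$ Suppose that $M=\{(x,u(x)):x\in\overline\Omega\}\subset\mathbb R^{n+1}$ is an embedded $C^1$ hypersurface with boundary $\partial M$. Let $W$ be any compact embedded $C^1$ hypersurface with boundary in $\mathbb R^{n+1}$ (not necessarily a graph, connected or orientable) such that $W\subset\overline\Omega\times\mathbb R$ and $\partial W=\partial M$. Then $$\int_M e^{x^{n+1}}\,d\mu_M\le\int_W e^{x^{n+1}}\,d\mu_W ,$$ where $d\mu_M$ and $d\mu_W$ are the volume elements induced by the Euclidean metric, and equality holds if and only if $W=M$. -/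

import Mathlib

open MeasureTheory Set

noncomputable section

/-- The last coordinate vector of `ℝ^{n+1}`, the direction of translation. -/
def vertical (n : ℕ) : EuclideanSpace ℝ (Fin (n + 1)) :=
  EuclideanSpace.single (Fin.last n) 1

/-- The graph parametrization `x ↦ (x, u x)`. -/
def graphMap {n : ℕ} (u : EuclideanSpace ℝ (Fin n) → ℝ) (x : EuclideanSpace ℝ (Fin n)) :
    EuclideanSpace ℝ (Fin (n + 1)) :=
  WithLp.toLp 2 (Fin.snoc (α := fun _ => ℝ) (fun i => x i) (u x))

/-- The solid vertical cylinder `S × ℝ` in `ℝ^{n+1}`. -/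
def verticalCylinder {n : ℕ} (S : Set (EuclideanSpace ℝ (Fin n))) :
    Set (EuclideanSpace ℝ (Fin (n + 1))) :=
  {p | WithLp.toLp 2 (fun i : Fin n => p i.castSucc) ∈ S}

/-- The tangent space of the parametrized submanifold `F` at the parameter `x`. -/
def tangentSpaceAt {n m : ℕ} (F : EuclideanSpace ℝ (Fin n) → EuclideanSpace ℝ (Fin m))
    (x : EuclideanSpace ℝ (Fin n)) : Submodule ℝ (EuclideanSpace ℝ (Fin m)) :=
  LinearMap.range (fderiv ℝ F x).toLinearMap

/-- The normal part `v^N` of a vector `v`, at the parameter `x`. -/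
def normalPart {n m : ℕ} (F : EuclideanSpace ℝ (Fin n) → EuclideanSpace ℝ (Fin m))
    (x : EuclideanSpace ℝ (Fin n)) (v : EuclideanSpace ℝ (Fin m)) : EuclideanSpace ℝ (Fin m) :=
  (tangentSpaceAt F x)ᗮ.starProjection v

/-- The induced metric `g_{ij} = ⟨∂_i F, ∂_j F⟩`. -/
def inducedMetric {n m : ℕ} (F : EuclideanSpace ℝ (Fin n) → EuclideanSpace ℝ (Fin m))
    (x : EuclideanSpace ℝ (Fin n)) : Matrix (Fin n) (Fin n) ℝ :=
  Matrix.of fun i j =>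
    inner ℝ (fderiv ℝ F x (EuclideanSpace.single i 1)) (fderiv ℝ F x (EuclideanSpace.single j 1))

/-- The second fundamental form `B_{ij} = (∂_i ∂_j F)^N`. -/
def secondFundamentalForm {n m : ℕ} (F : EuclideanSpace ℝ (Fin n) → EuclideanSpace ℝ (Fin m))
    (x : EuclideanSpace ℝ (Fin n)) (i j : Fin n) : EuclideanSpace ℝ (Fin m) :=
  normalPart F x
    (fderiv ℝ (fderiv ℝ F) x (EuclideanSpace.single i 1) (EuclideanSpace.single j 1))

/-- The mean curvature vector `H = trace B = g^{ij} B_{ij}`. -/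
def meanCurvatureVector {n m : ℕ} (F : EuclideanSpace ℝ (Fin n) → EuclideanSpace ℝ (Fin m))
    (x : EuclideanSpace ℝ (Fin n)) : EuclideanSpace ℝ (Fin m) :=
  ∑ i, ∑ j, (inducedMetric F x)⁻¹ i j • secondFundamentalForm F x i j

/-- `u` is twice continuously differentiable up to the boundary of `Ω`, and its graph is a
translator in the vertical direction: `H = V^N` over `Ω`. -/
structure IsGraphicTranslator {n : ℕ} (Ω : Set (EuclideanSpace ℝ (Fin n)))
    (u : EuclideanSpace ℝ (Fin n) → ℝ) : Prop where
  contDiffOn : ContDiffOn ℝ 2 u (closure Ω)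
  translator : ∀ x ∈ Ω,
    meanCurvatureVector (graphMap u) x = normalPart (graphMap u) x (vertical n)

/-- A local `C¹` diffeomorphism of `ℝ^d` between open sets. -/
def IsC1Diffeo {d : ℕ}
    (Φ : OpenPartialHomeomorph (EuclideanSpace ℝ (Fin d)) (EuclideanSpace ℝ (Fin d))) : Prop :=
  ContDiffOn ℝ 1 Φ Φ.source ∧ ContDiffOn ℝ 1 Φ.symm Φ.target

/-- Near `p`, the set `W` is straightened by a `C¹` diffeomorphism to the hyperplane
`{y_{n+1} = 0}` of `ℝ^{n+1}`. -/
def HasInteriorChartAt {n : ℕ} (W : Set (EuclideanSpace ℝ (Fin (n + 1))))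
    (p : EuclideanSpace ℝ (Fin (n + 1))) : Prop :=
  ∃ Φ : OpenPartialHomeomorph (EuclideanSpace ℝ (Fin (n + 1))) (EuclideanSpace ℝ (Fin (n + 1))),
    IsC1Diffeo Φ ∧ p ∈ Φ.source ∧
      Φ '' (W ∩ Φ.source) = {y | y ∈ Φ.target ∧ y (Fin.last n) = 0}

/-- Near `p`, the set `W` is straightened by a `C¹` diffeomorphism to the half-hyperplane
`{y_{n+1} = 0, y_1 ≥ 0}` of `ℝ^{n+1}`, and `p` goes to its edge `{y_{n+1} = 0, y_1 = 0}`. -/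
def HasBoundaryChartAt {n : ℕ} (W : Set (EuclideanSpace ℝ (Fin (n + 1))))
    (p : EuclideanSpace ℝ (Fin (n + 1))) : Prop :=
  ∃ Φ : OpenPartialHomeomorph (EuclideanSpace ℝ (Fin (n + 1))) (EuclideanSpace ℝ (Fin (n + 1))),
    IsC1Diffeo Φ ∧ p ∈ Φ.source ∧
      Φ '' (W ∩ Φ.source) = {y | y ∈ Φ.target ∧ y (Fin.last n) = 0 ∧ 0 ≤ y 0} ∧ Φ p 0 = 0

/-- An embedded `C¹` hypersurface with (possibly empty) boundary in `ℝ^{n+1}`, `n ≥ 1`. -/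
def IsHypersurface {n : ℕ} (W : Set (EuclideanSpace ℝ (Fin (n + 1)))) : Prop :=
  ∀ p ∈ W, HasInteriorChartAt W p ∨ HasBoundaryChartAt W p

/-- The manifold boundary `∂W` of a hypersurface `W`. -/
def hypersurfaceBoundary {n : ℕ} (W : Set (EuclideanSpace ℝ (Fin (n + 1)))) :
    Set (EuclideanSpace ℝ (Fin (n + 1))) :=
  {p | p ∈ W ∧ HasBoundaryChartAt W p}

/-- The weighted area `∫_W e^{x^{n+1}} dμ_W`, where `dμ_W` is the `n`-dimensional Euclidean area
(Hausdorff measure, normalized to agree with Lebesgue measure on `n`-planes). -/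
def weightedArea {n : ℕ} (W : Set (EuclideanSpace ℝ (Fin (n + 1)))) : ENNReal :=
  ∫⁻ p in W, ENNReal.ofReal (Real.exp (p (Fin.last n)))
    ∂(Measure.euclideanHausdorffMeasure n : Measure (EuclideanSpace ℝ (Fin (n + 1))))

end

/-!
The graph of a translator is calibrated. Let `v` be its upward unit normal, extended to the cylinder
independently of the height. By the translator equation in divergence form
(`baseDivergence_graphNormal`), the field `X = e^z v` is divergence free; its length is `e^z`, and on
the graph it is `e^z` times the unit normal. So the flux of `X` through the graph is the weighted area
of the graph, while its flux through any `W` is at most the weighted area of `W`. Only the equality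
of the two fluxes, for a competitor `W` with the same boundary, needs an argument, because `W` is
merely `C¹`, need not be orientable a priori, and touches the cylinder boundary in an arbitrary way.

The region between the graph and `W` is described by a function `F` (`IsFilling`). Locally off its
boundary, `W` has two sides, encoded by a function `σ = ±1` that changes sign across `W`
(`IsSideAt`). Such a function can be continued from `+∞` downwards along vertical columns, as long as
they do not meet the boundary, and from `-∞` upwards (`exists_isSideAt_of_columns`). The boundary
lies over the frontier of the domain (`IsGraphHypersurface.mem_boundary_iff`), so over the interior
both functions exist, and they agree there up to a global sign. If they were equal they would patch
to a side function around a boundary point, where none exists since a half-hypersurface does not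
separate (`not_eventually_isSideAt`). Hence they are opposite, and together they define `F`, which
vanishes far away and off the cylinder and jumps by one across `W` and across the graph
(`IsCompetitor.exists_filling`).

With `F`, the flux of a smooth field through `W` becomes the flux through the graph plus
`∫ F div Y`. Locally it is an integral of `σ div Y`, and the divergence theorem in coordinates in
which `W` is a graph with small gradient bounds it by the mass of the normal part of `Y` on `W`
(`IsSideAt.exists_flux_bound`). The boundary has codimension two and is removed by cutoffs
(`exists_cutoff_codim_two`), which gives the global bound `IsFilling.flux_le`. The calibrating field
is only continuous up to the frontier of the domain; it is approximated by `C¹` fields with small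
divergence, using translations in directions pointing into the domain (`IsCalibration.exists_approx`).
Such directions exist because a boundary chart of the graph is not vertical. This proves the
inequality (`IsCalibration.graphArea_le`).

If the areas are equal, the bound cannot improve anywhere, so `X` is normal to `W` off the boundary
(`IsCalibration.exists_chart_of_le`). Since `X` is never horizontal, `W` projects to an open set
there and is tangent to the vertical translates of the graph, so the difference of the height and `u`
is locally constant on `W`. A nonzero value would be attained on a compact set with open projection,
so the difference is zero and `W` lies on the graph; connectedness of the domain gives `W = M`
(`IsCalibration.eq_of_le`).
-/

open scoped Topology ContDiff

noncomputable section

local notation "𝔼[" n "]" => EuclideanSpace ℝ (Fin n)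

/-! ### Splitting off the last coordinate -/

/-- The isometric splitting `ℝ^{n+1} = ℝ^n ⊕ ℝ` into the first `n` coordinates and the height. -/
def splitIsometry (n : ℕ) : 𝔼[n + 1] ≃ₗᵢ[ℝ] WithLp 2 (𝔼[n] × ℝ) where
  toFun p := WithLp.toLp 2 (WithLp.toLp 2 (fun i : Fin n => p i.castSucc), p (Fin.last n))
  invFun q := WithLp.toLp 2 (Fin.snoc (α := fun _ => ℝ) (fun i => q.fst i) q.snd)
  map_add' p q := by rfl
  map_smul' c p := by rfl
  left_inv p := by
    ext i
    refine Fin.lastCases ?_ (fun j => ?_) i <;> simp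
  right_inv q := by
    obtain ⟨a, t⟩ := q
    simp
  norm_map' p := by
    rw [WithLp.prod_norm_eq_of_L2, EuclideanSpace.norm_eq, EuclideanSpace.norm_eq]
    congr 1
    simp only [LinearEquiv.coe_mk]
    rw [Real.sq_sqrt (by positivity), Fin.sum_univ_castSucc]
    rfl

/-- The splitting `ℝ^{n+1} ≃ ℝ^n × ℝ`, as an equivalence onto the plain product. -/
def splitEquiv (n : ℕ) : 𝔼[n + 1] ≃L[ℝ] 𝔼[n] × ℝ :=
  (splitIsometry n).toContinuousLinearEquiv.trans (WithLp.prodContinuousLinearEquiv 2 ℝ 𝔼[n] ℝ)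

/-- The projection of `ℝ^{n+1}` to its first `n` coordinates. -/
def base {n : ℕ} : 𝔼[n + 1] →L[ℝ] 𝔼[n] :=
  (ContinuousLinearMap.fst ℝ 𝔼[n] ℝ).comp (splitEquiv n : 𝔼[n + 1] →L[ℝ] 𝔼[n] × ℝ)

/-- The last coordinate on `ℝ^{n+1}`. -/
def height {n : ℕ} : 𝔼[n + 1] →L[ℝ] ℝ :=
  (ContinuousLinearMap.snd ℝ 𝔼[n] ℝ).comp (splitEquiv n : 𝔼[n + 1] →L[ℝ] 𝔼[n] × ℝ)

theorem splitEquiv_apply {n : ℕ} (p : 𝔼[n + 1]) : splitEquiv n p = (base p, height p) := rfl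

theorem base_apply {n : ℕ} (p : 𝔼[n + 1]) (i : Fin n) : base p i = p i.castSucc := rfl

theorem height_apply {n : ℕ} (p : 𝔼[n + 1]) : height p = p (Fin.last n) := rfl

/-- The point of `ℝ^{n+1}` over `x` at height `t`. -/
def lift {n : ℕ} (x : 𝔼[n]) (t : ℝ) : 𝔼[n + 1] := (splitEquiv n).symm (x, t)

@[simp] theorem base_lift {n : ℕ} (x : 𝔼[n]) (t : ℝ) : base (lift x t) = x := by
  have := (splitEquiv n).apply_symm_apply (x, t)
  rw [splitEquiv_apply] at this
  exact congrArg Prod.fst this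

@[simp] theorem height_lift {n : ℕ} (x : 𝔼[n]) (t : ℝ) : height (lift x t) = t := by
  have := (splitEquiv n).apply_symm_apply (x, t)
  rw [splitEquiv_apply] at this
  exact congrArg Prod.snd this

@[simp] theorem lift_base_height {n : ℕ} (p : 𝔼[n + 1]) : lift (base p) (height p) = p :=
  (splitEquiv n).symm_apply_apply p

theorem ext_base_height {n : ℕ} {p q : 𝔼[n + 1]} (h : base p = base q)
    (h' : height p = height q) : p = q := by
  rw [← lift_base_height p, h, h', lift_base_height]

theorem graphMap_eq_lift {n : ℕ} (u : 𝔼[n] → ℝ) (x : 𝔼[n]) : graphMap u x = lift x (u x) := rfl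

theorem vertical_eq_lift {n : ℕ} : vertical n = lift 0 1 := by
  apply ext_base_height
  · ext i
    simp [base_apply, vertical, Fin.castSucc_ne_last]
  · rw [height_lift]
    simp [height_apply, vertical]

theorem norm_sq_eq_base_height {n : ℕ} (p : 𝔼[n + 1]) :
    ‖p‖ ^ 2 = ‖base p‖ ^ 2 + height p ^ 2 := by
  rw [← (splitIsometry n).norm_map p, WithLp.prod_norm_sq_eq_of_L2]
  simp only [Real.norm_eq_abs, sq_abs]
  rfl

theorem inner_eq_base_height {n : ℕ} (p q : 𝔼[n + 1]) :
    inner ℝ p q = inner ℝ (base p) (base q) + height p * height q := by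
  rw [← (splitIsometry n).inner_map_map p q, WithLp.prod_inner_apply]
  exact congrArg₂ (· + ·) rfl (mul_comm _ _)

theorem norm_base_le {n : ℕ} (p : 𝔼[n + 1]) : ‖base p‖ ≤ ‖p‖ := by
  have := norm_sq_eq_base_height p
  exact abs_le_of_sq_le_sq' (by nlinarith [sq_nonneg (height p)]) (norm_nonneg _) |>.2

theorem abs_height_le {n : ℕ} (p : 𝔼[n + 1]) : |height p| ≤ ‖p‖ := by
  have := norm_sq_eq_base_height p
  exact abs_le_of_sq_le_sq (by nlinarith [sq_nonneg (‖base p‖)]) (norm_nonneg _)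

theorem continuous_lift {n : ℕ} : Continuous fun q : 𝔼[n] × ℝ => lift q.1 q.2 :=
  (splitEquiv n).symm.continuous

theorem contDiff_lift {n : ℕ} {k : WithTop ℕ∞} : ContDiff ℝ k fun q : 𝔼[n] × ℝ => lift q.1 q.2 :=
  (splitEquiv n).symm.contDiff

theorem measurePreserving_splitEquiv (n : ℕ) : MeasurePreserving (splitEquiv n) :=
  (WithLp.volume_preserving_ofLp 𝔼[n] ℝ).comp (splitIsometry n).measurePreserving

/-! ### Flux through a graph -/

theorem integrable_sign_mul {α : Type*} [MeasurableSpace α] {μ : Measure α} {s f : α → ℝ}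
    (hs : Measurable s) (hf : Integrable f μ) : Integrable (fun a => Real.sign (s a) * f a) μ := by
  have hm : Measurable Real.sign :=
    Measurable.ite measurableSet_Iio measurable_const
      (Measurable.ite measurableSet_Ioi measurable_const measurable_const)
  refine hf.bdd_mul (c := 1) (hm.comp hs).aestronglyMeasurable (Filter.Eventually.of_forall ?_)
  intro a
  rcases Real.sign_apply_eq (s a) with h | h | h <;> simp [h]

theorem integral_sign_mul_deriv {f : ℝ → ℝ} (hf : ContDiff ℝ 1 f) (hc : HasCompactSupport f) :
    ∫ t, Real.sign t * deriv f t = -2 * f 0 := by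
  have hd : Integrable (deriv f) :=
    (hf.continuous_deriv le_rfl).integrable_of_hasCompactSupport hc.deriv
  have hi : Integrable fun t => Real.sign t * deriv f t := integrable_sign_mul measurable_id hd
  rw [← setIntegral_univ, ← Iic_union_Ioi (a := (0 : ℝ)),
    setIntegral_union (Iic_disjoint_Ioi le_rfl) measurableSet_Ioi hi.integrableOn hi.integrableOn]
  have h1 : ∫ t in Iic (0 : ℝ), Real.sign t * deriv f t = -∫ t in Iic (0 : ℝ), deriv f t := by
    rw [← integral_neg, integral_Iic_eq_integral_Iio, integral_Iic_eq_integral_Iio]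
    exact setIntegral_congr_fun measurableSet_Iio fun t ht => by simp [Real.sign_of_neg ht]
  have h2 : ∫ t in Ioi (0 : ℝ), Real.sign t * deriv f t = ∫ t in Ioi (0 : ℝ), deriv f t :=
    setIntegral_congr_fun measurableSet_Ioi fun t ht => by simp [Real.sign_of_pos ht]
  rw [h1, h2, hc.integral_Iic_deriv_eq hf, hc.integral_Ioi_deriv_eq hf]
  ring

theorem integral_fderiv_apply_eq_zero {F : Type*} [NormedAddCommGroup F] [NormedSpace ℝ F]
    [FiniteDimensional ℝ F] [MeasurableSpace F] [BorelSpace F] {μ : Measure F} [μ.IsAddHaarMeasure]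
    {f : F → ℝ} (hf : ContDiff ℝ 1 f) (hc : HasCompactSupport f) (v : F) :
    ∫ x, fderiv ℝ f x v ∂μ = 0 := by
  have hd : Integrable (fun x => fderiv ℝ f x v) μ :=
    ((hf.continuous_fderiv one_ne_zero).clm_apply continuous_const).integrable_of_hasCompactSupport
      (hc.fderiv_apply ℝ v)
  have := integral_mul_fderiv_eq_neg_fderiv_mul_of_integrable (μ := μ) (f := fun _ : F => (1 : ℝ))
    (g := f) (v := v) (by simp) (by simpa using hd)
    (by simpa using hf.continuous.integrable_of_hasCompactSupport hc)
    (fun _ _ => by fun_prop) (fun x _ => hf.differentiable one_ne_zero x)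
  simpa using this

/-- Integration by parts across the graph of `g`, on a product `F × ℝ`. The shear
`(y, t) ↦ (y, g y + t)` flattens the graph: horizontal derivatives then integrate to zero and the
vertical one leaves the value on the graph. -/
theorem integral_sign_mul_fderiv_prod {F : Type*} [NormedAddCommGroup F] [NormedSpace ℝ F]
    [FiniteDimensional ℝ F] [MeasurableSpace F] [BorelSpace F] {μ : Measure F} [μ.IsAddHaarMeasure]
    {g : F → ℝ} (hg : ContDiff ℝ 1 g) {f : F × ℝ → ℝ} (hf : ContDiff ℝ 1 f)
    (hc : HasCompactSupport f) (v : F × ℝ) :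
    ∫ q, Real.sign (q.2 - g q.1) * fderiv ℝ f q v ∂(μ.prod volume) =
      -2 * ∫ y, f (y, g y) * (v.2 - fderiv ℝ g y v.1) ∂μ := by
  let shear : F × ℝ → F × ℝ := fun q => (q.1, g q.1 + q.2)
  have hshear : ContDiff ℝ 1 shear := by fun_prop
  have hmp : MeasurePreserving shear (μ.prod volume) (μ.prod volume) :=
    (MeasurePreserving.id μ).skew_product (g := fun y t => g y + t)
      (by have := hg.continuous.measurable; fun_prop)
      (Filter.Eventually.of_forall fun y => (measurePreserving_add_left volume (g y)).map_eq)
  let e : F × ℝ ≃ₜ F × ℝ :=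
    { toFun := shear
      invFun := fun q => (q.1, q.2 - g q.1)
      left_inv := fun q => by simp [shear]
      right_inv := fun q => by simp [shear]
      continuous_toFun := hshear.continuous
      continuous_invFun := by have := hg.continuous; fun_prop }
  let ψ : F × ℝ → ℝ := fun q => f (shear q)
  have hψ : ContDiff ℝ 1 ψ := hf.comp hshear
  have hψc : HasCompactSupport ψ := hc.comp_homeomorph e
  have hemb : MeasurableEmbedding shear := e.measurableEmbedding
  have hfd : ∀ q, fderiv ℝ f (shear q) v =
      fderiv ℝ ψ q (v.1, 0) + (v.2 - fderiv ℝ g q.1 v.1) * fderiv ℝ ψ q (0, 1) := by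
    intro q
    have h1 : HasFDerivAt shear ((ContinuousLinearMap.fst ℝ F ℝ).prod
        ((fderiv ℝ g q.1).comp (ContinuousLinearMap.fst ℝ F ℝ) + ContinuousLinearMap.snd ℝ F ℝ)) q := by
      refine HasFDerivAt.prodMk hasFDerivAt_fst (HasFDerivAt.add ?_ hasFDerivAt_snd)
      exact ((hg.differentiable one_ne_zero q.1).hasFDerivAt).comp q hasFDerivAt_fst
    have h2 : HasFDerivAt ψ _ q :=
      ((hf.differentiable one_ne_zero (shear q)).hasFDerivAt).comp q h1
    rw [h2.fderiv]
    simp only [ContinuousLinearMap.comp_apply, ContinuousLinearMap.prod_apply,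
      add_apply, ContinuousLinearMap.coe_fst', ContinuousLinearMap.coe_snd',
      map_zero, zero_add, add_zero]
    rw [← smul_eq_mul, ← map_smul, ← map_add]
    congr 1
    ext <;> simp
  rw [← hmp.integral_comp hemb]
  have hsg : ∀ q : F × ℝ, Real.sign ((shear q).2 - g (shear q).1) = Real.sign q.2 := by
    intro q; simp [shear]
  have hint : ∀ w : F × ℝ, Integrable (fun q => fderiv ℝ ψ q w) (μ.prod volume) := fun w =>
    ((hψ.continuous_fderiv one_ne_zero).clm_apply continuous_const).integrable_of_hasCompactSupport
      (hψc.fderiv_apply ℝ w)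
  have hcont : Continuous fun y => v.2 - fderiv ℝ g y v.1 :=
    continuous_const.sub ((hg.continuous_fderiv one_ne_zero).clm_apply continuous_const)
  have hint2 : Integrable (fun q : F × ℝ => (v.2 - fderiv ℝ g q.1 v.1) * fderiv ℝ ψ q (0, 1))
      (μ.prod volume) :=
    ((hcont.comp continuous_fst).mul
      ((hψ.continuous_fderiv one_ne_zero).clm_apply continuous_const)).integrable_of_hasCompactSupport
      (hψc.fderiv_apply ℝ (0, 1)).mul_left
  have hI1 := integrable_sign_mul (s := fun q : F × ℝ => q.2) measurable_snd (hint (v.1, 0))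
  have hI2 := integrable_sign_mul (s := fun q : F × ℝ => q.2) measurable_snd hint2
  simp only [hsg, hfd, mul_add]
  rw [integral_add hI1 hI2]
  have hcl : ∀ t : ℝ, Topology.IsClosedEmbedding fun y : F => (y, t) := fun t =>
    Function.LeftInverse.isClosedEmbedding (f := Prod.fst) (fun _ => rfl) continuous_fst
      (by fun_prop)
  have hA : ∫ q : F × ℝ, Real.sign q.2 * fderiv ℝ ψ q (v.1, 0) ∂(μ.prod volume) = 0 := by
    rw [integral_prod_symm _ hI1]
    refine integral_eq_zero_of_ae (Filter.Eventually.of_forall fun t => ?_)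
    simp only [Pi.zero_apply]
    rw [integral_const_mul]
    have hd : ∀ y, fderiv ℝ ψ (y, t) (v.1, 0) = fderiv ℝ (fun y => ψ (y, t)) y v.1 := by
      intro y
      have h : HasFDerivAt (fun y => ψ (y, t))
          ((fderiv ℝ ψ (y, t)).comp (ContinuousLinearMap.inl ℝ F ℝ)) y :=
        HasFDerivAt.comp (g := ψ) (f := fun y => (y, t)) y
          (hψ.differentiable one_ne_zero (y, t)).hasFDerivAt (hasFDerivAt_prodMk_left y t)
      rw [h.fderiv]
      rfl
    simp only [hd]
    rw [integral_fderiv_apply_eq_zero (f := fun y => ψ (y, t)) (by fun_prop)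
      (hψc.comp_isClosedEmbedding (hcl t)), mul_zero]
  have hB : ∫ q : F × ℝ, Real.sign q.2 * ((v.2 - fderiv ℝ g q.1 v.1) * fderiv ℝ ψ q (0, 1))
      ∂(μ.prod volume) = -2 * ∫ y, f (y, g y) * (v.2 - fderiv ℝ g y v.1) ∂μ := by
    rw [integral_prod _ hI2, ← integral_const_mul]
    congr 1
    ext y
    have hd : ∀ t, fderiv ℝ ψ (y, t) (0, 1) = deriv (fun t => ψ (y, t)) t := by
      intro t
      have h := ((hψ.differentiable one_ne_zero (y, t)).hasFDerivAt).comp_hasDerivAt t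
        ((hasDerivAt_const t y).prodMk (hasDerivAt_id t))
      exact h.deriv.symm
    have hcl' : Topology.IsClosedEmbedding fun t : ℝ => (y, t) :=
      Function.LeftInverse.isClosedEmbedding (f := Prod.snd) (fun _ => rfl) continuous_snd
        (by fun_prop)
    have hone := integral_sign_mul_deriv (f := fun t => ψ (y, t)) (by fun_prop)
      (hψc.comp_isClosedEmbedding hcl')
    simp only [hd]
    calc _ = (v.2 - fderiv ℝ g y v.1) * ∫ t, Real.sign t * deriv (fun t => ψ (y, t)) t := by
          rw [← integral_const_mul]; congr 1; ext t; ring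
      _ = _ := by rw [hone]; simp [ψ, shear]; ring
  rw [hA, hB, zero_add]

/-- The divergence of a vector field on `ℝ^m`. -/
def divergence {m : ℕ} (Y : 𝔼[m] → 𝔼[m]) (p : 𝔼[m]) : ℝ :=
  ∑ i, fderiv ℝ Y p (EuclideanSpace.single i 1) i

theorem sum_smul_single {m : ℕ} (y : 𝔼[m]) :
    ∑ i, y i • EuclideanSpace.single i (1 : ℝ) = y := by
  ext j
  simp [Pi.single_apply]

theorem continuous_divergence {m : ℕ} {Y : 𝔼[m] → 𝔼[m]} (hY : ContDiff ℝ 1 Y) :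
    Continuous (divergence Y) := by
  have := hY.continuous_fderiv one_ne_zero
  unfold divergence
  fun_prop

theorem hasCompactSupport_divergence {m : ℕ} {Y : 𝔼[m] → 𝔼[m]} (hc : HasCompactSupport Y) :
    HasCompactSupport (divergence Y) := by
  refine (hc.fderiv ℝ).mono fun p hp => ?_
  contrapose! hp
  simp only [Function.mem_support, not_not] at hp ⊢
  simp [divergence, hp]

theorem integrable_divergence {m : ℕ} {Y : 𝔼[m] → 𝔼[m]} (hY : ContDiff ℝ 1 Y)
    (hc : HasCompactSupport Y) : Integrable (divergence Y) :=
  (continuous_divergence hY).integrable_of_hasCompactSupport (hasCompactSupport_divergence hc)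

theorem fderiv_coord {m : ℕ} {F : Type*} [NormedAddCommGroup F] [NormedSpace ℝ F] {Y : F → 𝔼[m]}
    {p : F} (hY : DifferentiableAt ℝ Y p) (i : Fin m) (v : F) :
    fderiv ℝ (fun q => Y q i) p v = fderiv ℝ Y p v i := by
  have h : HasFDerivAt (fun q => Y q i) ((EuclideanSpace.proj i).comp (fderiv ℝ Y p)) p :=
    (EuclideanSpace.proj (𝕜 := ℝ) i).hasFDerivAt.comp p hY.hasFDerivAt
  rw [h.fderiv]; rfl

/-- The divergence theorem for the two sides of the graph of `g`, in coordinates given by any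
volume preserving linear map `A` to `ℝ^n × ℝ`. -/
theorem integral_sign_mul_divergence {n : ℕ} (A : 𝔼[n + 1] ≃L[ℝ] 𝔼[n] × ℝ)
    (hA : MeasurePreserving A) {g : 𝔼[n] → ℝ} (hg : ContDiff ℝ 1 g)
    {Y : 𝔼[n + 1] → 𝔼[n + 1]} (hY : ContDiff ℝ 1 Y) (hc : HasCompactSupport Y) :
    ∫ p, Real.sign ((A p).2 - g (A p).1) * divergence Y p =
      -2 * ∫ y, ((A (Y (A.symm (y, g y)))).2 - fderiv ℝ g y (A (Y (A.symm (y, g y)))).1) := by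
  have hci : ∀ i, HasCompactSupport fun p => Y p i := fun i =>
    hc.comp_left (g := fun y : 𝔼[n + 1] => y i) (by simp)
  have hYi : ∀ i, ContDiff ℝ 1 fun p => Y p i := fun i => by fun_prop
  have hi : ∀ i, Integrable fun p => fderiv ℝ (fun q => Y q i) p (EuclideanSpace.single i 1) :=
    fun i => (((hYi i).continuous_fderiv one_ne_zero).clm_apply
      continuous_const).integrable_of_hasCompactSupport ((hci i).fderiv_apply ℝ _)
  have hm : Measurable fun p => (A p).2 - g (A p).1 := by
    have := hg.continuous
    exact Continuous.measurable (by fun_prop)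
  have key : ∀ i, ∫ p, Real.sign ((A p).2 - g (A p).1) *
        fderiv ℝ (fun q => Y q i) p (EuclideanSpace.single i 1) =
      -2 * ∫ y, Y (A.symm (y, g y)) i * ((A (EuclideanSpace.single i 1)).2 -
        fderiv ℝ g y (A (EuclideanSpace.single i 1)).1) := by
    intro i
    have := integral_sign_mul_fderiv_prod (μ := (volume : Measure 𝔼[n])) hg
      (f := fun q => Y (A.symm q) i) ((hYi i).comp A.symm.contDiff)
      ((hci i).comp_homeomorph A.symm.toHomeomorph) (A (EuclideanSpace.single i 1))
    rw [← this, ← Measure.volume_eq_prod, ← hA.integral_comp A.toHomeomorph.measurableEmbedding]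
    congr 1
    ext p
    congr 1
    have h : HasFDerivAt (fun q => Y (A.symm q) i)
        ((fderiv ℝ (fun q => Y q i) p).comp (A.symm : 𝔼[n] × ℝ →L[ℝ] 𝔼[n + 1])) (A p) := by
      have h1 := ((hYi i).differentiable one_ne_zero p).hasFDerivAt
      refine HasFDerivAt.comp (g := fun p => Y p i) (f := A.symm) (A p) ?_ A.symm.hasFDerivAt
      rwa [A.symm_apply_apply]
    rw [h.fderiv]
    simp
  have hdiv : ∀ p, divergence Y p =
      ∑ i, fderiv ℝ (fun q => Y q i) p (EuclideanSpace.single i 1) := fun p =>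
    Finset.sum_congr rfl fun i _ => (fderiv_coord (hY.differentiable one_ne_zero p) i _).symm
  simp only [hdiv, Finset.mul_sum]
  rw [integral_finsetSum _ fun i _ => integrable_sign_mul hm (hi i)]
  simp only [key]
  rw [← Finset.mul_sum, ← integral_finsetSum]
  · congr 2
    ext y
    set w := Y (A.symm (y, g y))
    have hl : ∀ w : 𝔼[n + 1], (A w).2 - fderiv ℝ g y (A w).1 =
        ((ContinuousLinearMap.snd ℝ 𝔼[n] ℝ - (fderiv ℝ g y).comp
          (ContinuousLinearMap.fst ℝ 𝔼[n] ℝ)).comp (A : 𝔼[n + 1] →L[ℝ] 𝔼[n] × ℝ)) w := fun w => rfl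
    rw [hl w]
    conv_rhs => rw [← sum_smul_single w]
    rw [map_sum]
    refine Finset.sum_congr rfl fun i _ => ?_
    rw [map_smul, hl, smul_eq_mul]
  · intro i _
    have hgc := hg.continuous
    have h1 : Continuous fun y => Y (A.symm (y, g y)) i := by
      have := hY.continuous
      fun_prop
    have h2 : Continuous fun y => ((A (EuclideanSpace.single i 1)).2 -
        fderiv ℝ g y (A (EuclideanSpace.single i 1)).1) :=
      continuous_const.sub ((hg.continuous_fderiv one_ne_zero).clm_apply continuous_const)
    refine (h1.mul h2).integrable_of_hasCompactSupport (HasCompactSupport.mul_right ?_)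
    have hcl : Topology.IsClosedEmbedding fun y : 𝔼[n] => A.symm (y, g y) := by
      refine A.symm.toHomeomorph.isClosedEmbedding.comp ?_
      exact Function.LeftInverse.isClosedEmbedding (f := Prod.fst) (fun _ => rfl) continuous_fst
        (by fun_prop)
    exact (hci i).comp_isClosedEmbedding hcl

/-! ### Hausdorff measure of graphs -/

theorem LipschitzOnWith.euclideanHausdorffMeasure_image_le {X Y : Type*} [EMetricSpace X]
    [MeasurableSpace X] [BorelSpace X] [EMetricSpace Y] [MeasurableSpace Y] [BorelSpace Y]
    {K : NNReal} {f : X → Y} {s : Set X} (h : LipschitzOnWith K f s) (d : ℕ) :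
    (Measure.euclideanHausdorffMeasure d : Measure Y) (f '' s) ≤
      (K : ENNReal) ^ d * (Measure.euclideanHausdorffMeasure d : Measure X) s := by
  simp_rw [Measure.euclideanHausdorffMeasure_def, Measure.smul_apply, ENNReal.smul_def, smul_eq_mul]
  rw [mul_left_comm]
  gcongr
  simpa using h.hausdorffMeasure_image_le (d := d) (by positivity)

/-- A section of a `1`-Lipschitz map to `ℝ^n` does not decrease `n`-dimensional measure. -/
theorem setLIntegral_section_le {n : ℕ} {X : Type*} [EMetricSpace X] [MeasurableSpace X]
    [BorelSpace X] {pr : X → 𝔼[n]} (hpr : LipschitzWith 1 pr) {γ : 𝔼[n] → X} (hγ : Measurable γ)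
    {B : Set 𝔼[n]} {W : Set X} (hpγ : ∀ y ∈ B, pr (γ y) = y) (hBW : ∀ y ∈ B, γ y ∈ W)
    {f : X → ENNReal} (hf : Measurable f) :
    ∫⁻ y in B, f (γ y) ≤ ∫⁻ p in W, f p ∂(Measure.euclideanHausdorffMeasure n) := by
  rw [← lintegral_map hf hγ]
  refine lintegral_mono' ?_ le_rfl
  refine Measure.le_iff.2 fun A hA => ?_
  rw [Measure.map_apply hγ hA, Measure.restrict_apply (hγ hA), Measure.restrict_apply hA]
  calc volume (γ ⁻¹' A ∩ B) ≤ volume (pr '' (A ∩ W)) :=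
        measure_mono fun y hy => ⟨γ y, ⟨hy.1, hBW y hy.2⟩, hpγ y hy.2⟩
    _ = (Measure.euclideanHausdorffMeasure n : Measure 𝔼[n]) (pr '' (A ∩ W)) := by
        rw [EuclideanSpace.euclideanHausdorffMeasure_eq_volume]
    _ ≤ _ := by
        simpa using (hpr.lipschitzOnWith (s := A ∩ W)).euclideanHausdorffMeasure_image_le n

/-- A comparison of measures on an open set may be checked locally. -/
theorem measure_le_of_locally_le {X : Type*} [TopologicalSpace X] [SecondCountableTopology X]
    [MeasurableSpace X] [BorelSpace X] {μ ν : Measure X} {O : Set X}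
    (h : ∀ x ∈ O, ∃ U ∈ 𝓝 x, ∀ A ⊆ U, MeasurableSet A → μ A ≤ ν A) {A : Set X} (hAO : A ⊆ O)
    (hA : MeasurableSet A) : μ A ≤ ν A := by
  choose! U hU hUA using h
  obtain ⟨t, htO, htc, htU⟩ := TopologicalSpace.countable_cover_nhdsWithin
    (f := fun x => interior (U x)) (s := O)
    (fun x hx => mem_nhdsWithin_of_mem_nhds (interior_mem_nhds.2 (hU x hx)))
  rcases t.eq_empty_or_nonempty with rfl | hne
  · have : A = ∅ := by
      refine Set.eq_empty_of_subset_empty (hAO.trans (htU.trans ?_))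
      simp
    simp [this]
  obtain ⟨g, rfl⟩ := htc.exists_eq_range hne
  let V : ℕ → Set X := disjointed fun i => interior (U (g i))
  have hVm : ∀ i, MeasurableSet (V i) :=
    fun i => MeasurableSet.disjointed (fun _ => isOpen_interior.measurableSet) i
  have hd : Pairwise (Function.onFun Disjoint fun i => A ∩ V i) := fun i j hij =>
    (disjoint_disjointed _ hij).mono inter_subset_right inter_subset_right
  have hAu : A = ⋃ i, A ∩ V i := by
    rw [← inter_iUnion, iUnion_disjointed, inter_eq_left.2]
    refine hAO.trans (htU.trans ?_)
    simp
  rw [hAu, measure_iUnion hd fun i => hA.inter (hVm i),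
    measure_iUnion hd fun i => hA.inter (hVm i)]
  refine ENNReal.tsum_le_tsum fun i => hUA (g i) (htO ⟨i, rfl⟩) _ ?_ (hA.inter (hVm i))
  exact inter_subset_right.trans ((disjointed_subset _ i).trans interior_subset)

/-- The graph of a linear functional, as a linear map `v ↦ (v, p v)`. -/
def graphLinear {n : ℕ} (p : 𝔼[n] →L[ℝ] ℝ) : 𝔼[n] →L[ℝ] 𝔼[n + 1] :=
  ((splitEquiv n).symm : 𝔼[n] × ℝ →L[ℝ] 𝔼[n + 1]).comp ((ContinuousLinearMap.id ℝ 𝔼[n]).prod p)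

theorem graphLinear_apply {n : ℕ} (p : 𝔼[n] →L[ℝ] ℝ) (v : 𝔼[n]) :
    graphLinear p v = lift v (p v) := rfl

theorem sum_apply_single_sq {n : ℕ} (p : 𝔼[n] →L[ℝ] ℝ) :
    ∑ i, p (EuclideanSpace.single i 1) ^ 2 = ‖p‖ ^ 2 := by
  obtain ⟨w, rfl⟩ := (InnerProductSpace.toDual ℝ 𝔼[n]).surjective p
  rw [LinearIsometryEquiv.norm_map, EuclideanSpace.real_norm_sq_eq]
  refine Finset.sum_congr rfl fun i _ => ?_
  simp [InnerProductSpace.toDual_apply_apply, EuclideanSpace.inner_single_right]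

theorem inner_single_single {n : ℕ} (i j : Fin n) :
    inner ℝ (EuclideanSpace.single i (1 : ℝ)) (EuclideanSpace.single j (1 : ℝ)) =
      (1 : Matrix (Fin n) (Fin n) ℝ) i j := by
  simp [EuclideanSpace.inner_single_left, Matrix.one_apply]

theorem normDet_graphLinear {n : ℕ} (p : 𝔼[n] →L[ℝ] ℝ) :
    (graphLinear p).toLinearMap.normDet = Real.sqrt (1 + ‖p‖ ^ 2) := by
  have h := (graphLinear p).toLinearMap.normDet_sq_eq_det_gram (EuclideanSpace.basisFun (Fin n) ℝ)
  rw [eq_comm, Real.sqrt_eq_iff_mul_self_eq (by positivity) (LinearMap.normDet_nonneg _), ← sq]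
  simp only [RCLike.ofReal_real_eq_id, id] at h
  rw [h]
  let w : Fin n → ℝ := fun i => p (EuclideanSpace.single i 1)
  have : Matrix.gram ℝ (fun i => (graphLinear p).toLinearMap (EuclideanSpace.basisFun (Fin n) ℝ i)) =
      1 + Matrix.replicateCol Unit w * Matrix.replicateRow Unit w := by
    ext i j
    rw [Matrix.gram_apply, inner_eq_base_height]
    simp only [ContinuousLinearMap.coe_coe, graphLinear_apply, base_lift, height_lift,
      EuclideanSpace.basisFun_apply, inner_single_single, Matrix.add_apply, Matrix.mul_apply]
    simp [w]
  rw [this, Matrix.det_one_add_replicateCol_mul_replicateRow]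
  congr 1
  rw [← sum_apply_single_sq]
  simp [dotProduct, w, sq]

theorem hasStrictFDerivAt_graphMap {n : ℕ} {u : 𝔼[n] → ℝ} {x : 𝔼[n]} {p : 𝔼[n] →L[ℝ] ℝ}
    (hu : HasStrictFDerivAt u p x) : HasStrictFDerivAt (graphMap u) (graphLinear p) x :=
  ((splitEquiv n).symm.hasStrictFDerivAt).comp x ((hasStrictFDerivAt_id x).prodMk hu)

theorem norm_le_norm_graphLinear {n : ℕ} (p : 𝔼[n] →L[ℝ] ℝ) (v : 𝔼[n]) :
    ‖v‖ ≤ ‖graphLinear p v‖ := by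
  have := norm_base_le (graphLinear p v)
  rwa [graphLinear_apply, base_lift] at this

theorem euclideanHausdorffMeasure_graph_le_of_approximatesLinearOn {n : ℕ} {u : 𝔼[n] → ℝ}
    {p : 𝔼[n] →L[ℝ] ℝ} {s : Set 𝔼[n]} {c : NNReal}
    (h : ApproximatesLinearOn (graphMap u) (graphLinear p) s c) :
    (Measure.euclideanHausdorffMeasure n : Measure 𝔼[n + 1]) (graphMap u '' s) ≤
      (1 + c : NNReal) ^ n * (ENNReal.ofReal (Real.sqrt (1 + ‖p‖ ^ 2)) * volume s) := by
  have hL : LipschitzOnWith (1 + c) (fun q => graphMap u (base q)) (graphLinear p '' s) := by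
    refine LipschitzOnWith.of_dist_le_mul ?_
    rintro _ ⟨x, hx, rfl⟩ _ ⟨y, hy, rfl⟩
    have h1 := h x hx y hy
    simp only [graphLinear_apply, base_lift]
    rw [dist_eq_norm, dist_eq_norm, ← graphLinear_apply, ← graphLinear_apply, ← map_sub]
    have h2 := norm_le_norm_graphLinear p (x - y)
    have h3 := norm_le_norm_add_norm_sub' (graphMap u x - graphMap u y) (graphLinear p (x - y))
    push_cast
    nlinarith [c.coe_nonneg]
  have h1 := hL.euclideanHausdorffMeasure_image_le n
  rw [image_image] at h1
  simp only [graphLinear_apply, base_lift] at h1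
  have h2 := (graphLinear p).toLinearMap.euclideanHausdorffMeasure_image_eq_normDet_mul_volume s
  rw [finrank_euclideanSpace_fin, normDet_graphLinear] at h2
  rw [← h2]
  exact h1

/-- The area formula for graphs, as an upper bound. -/
theorem lintegral_graph_le {n : ℕ} {u : 𝔼[n] → ℝ} {O : Set 𝔼[n]} (hO : IsOpen O)
    (hu : ContDiffOn ℝ 1 u O) {f : 𝔼[n + 1] → ENNReal} (hf : Continuous f) :
    ∫⁻ p in graphMap u '' O, f p ∂(Measure.euclideanHausdorffMeasure n) ≤
      ∫⁻ x in O, f (graphMap u x) * ENNReal.ofReal (Real.sqrt (1 + ‖fderiv ℝ u x‖ ^ 2)) := by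
  have hgc : ContinuousOn (graphMap u) O :=
    continuous_lift.comp_continuousOn (continuousOn_id.prodMk hu.continuousOn)
  have hJc : ContinuousOn (fun x => Real.sqrt (1 + ‖fderiv ℝ u x‖ ^ 2)) O :=
    (continuousOn_const.add ((hu.continuousOn_fderiv_of_isOpen hO le_rfl).norm.pow 2)).sqrt
  set J : 𝔼[n] → ENNReal := fun x => ENNReal.ofReal (Real.sqrt (1 + ‖fderiv ℝ u x‖ ^ 2)) with hJ
  have hJm : AEMeasurable J (volume.restrict O) :=
    (hJc.aemeasurable hO.measurableSet).ennreal_ofReal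
  have hgm : MeasurableSet (graphMap u '' O) := by
    have hinj : InjOn (graphMap u) O := fun x _ y _ hxy => by
      have := congrArg base hxy
      simpa [graphMap_eq_lift] using this
    exact hO.measurableSet.image_of_continuousOn_injOn hgc hinj
  -- the area measure of the graph, transported to the base
  set m : Measure 𝔼[n] :=
    ((Measure.euclideanHausdorffMeasure n).restrict (graphMap u '' O)).map base with hm
  have hmA : ∀ A ⊆ O, MeasurableSet A →
      m A = (Measure.euclideanHausdorffMeasure n : Measure 𝔼[n + 1]) (graphMap u '' A) := by
    intro A hAO hA
    rw [hm, Measure.map_apply base.continuous.measurable hA,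
      Measure.restrict_apply (base.continuous.measurable hA)]
    congr 1
    ext p
    constructor
    · rintro ⟨h1, x, hx, rfl⟩
      rw [mem_preimage, graphMap_eq_lift, base_lift] at h1
      exact ⟨x, h1, rfl⟩
    · rintro ⟨x, hx, rfl⟩
      exact ⟨by rwa [mem_preimage, graphMap_eq_lift, base_lift], x, hAO hx, rfl⟩
  -- The comparison holds up to a factor `(1 + c) ^ (n + 1)` on sets where `graphMap u` is
  -- `c`-close to its linearization; the factor is removed by letting `c` tend to zero.
  have hle : ∀ A, MeasurableSet A → m A ≤ (volume.restrict O).withDensity J A := by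
    intro A hA
    have hmO : m A = m (A ∩ O) := by
      rw [hm, Measure.map_apply base.continuous.measurable hA,
        Measure.map_apply base.continuous.measurable (hA.inter hO.measurableSet),
        Measure.restrict_apply (base.continuous.measurable hA),
        Measure.restrict_apply (base.continuous.measurable (hA.inter hO.measurableSet))]
      congr 1
      ext p
      constructor
      · rintro ⟨h1, x, hx, rfl⟩
        exact ⟨⟨h1, by simpa [graphMap_eq_lift] using hx⟩, x, hx, rfl⟩
      · rintro ⟨h1, h2⟩
        exact ⟨h1.1, h2⟩
    have key : ∀ c : NNReal, 0 < c → m A ≤ (1 + c : NNReal) ^ (n + 1) *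
        (volume.restrict O).withDensity J A := by
      intro c hc
      rw [hmO]
      refine le_trans ?_ (mul_le_mul_right (measure_mono (inter_subset_left (t := O))) _)
      refine measure_le_of_locally_le (O := O) (μ := m)
        (ν := ((1 + c : NNReal) ^ (n + 1) : ENNReal) • (volume.restrict O).withDensity J)
        ?_ inter_subset_right (hA.inter hO.measurableSet)
      intro x hx
      have hux : HasStrictFDerivAt u (fderiv ℝ u x) x :=
        ((hu.contDiffAt (hO.mem_nhds hx)).hasStrictFDerivAt one_ne_zero)
      obtain ⟨s, hs, hsa⟩ := (hasStrictFDerivAt_graphMap hux).approximates_deriv_on_nhds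
        (c := c) (Or.inr hc)
      have hnear : ∀ᶠ y in 𝓝 x, Real.sqrt (1 + ‖fderiv ℝ u x‖ ^ 2) - c <
          Real.sqrt (1 + ‖fderiv ℝ u y‖ ^ 2) :=
        (hJc.continuousAt (hO.mem_nhds hx)).eventually
          (lt_mem_nhds (sub_lt_self _ (by exact_mod_cast hc)))
      refine ⟨s ∩ (O ∩ {y | Real.sqrt (1 + ‖fderiv ℝ u x‖ ^ 2) - c <
          Real.sqrt (1 + ‖fderiv ℝ u y‖ ^ 2)}),
        Filter.inter_mem hs (Filter.inter_mem (hO.mem_nhds hx) hnear), fun B hB hBm => ?_⟩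
      rw [hmA B (fun y hy => (hB hy).2.1) hBm]
      refine (euclideanHausdorffMeasure_graph_le_of_approximatesLinearOn
        (hsa.mono_set fun y hy => (hB hy).1)).trans ?_
      rw [Measure.smul_apply, smul_eq_mul, withDensity_apply _ hBm,
        Measure.restrict_restrict hBm, inter_eq_left.2 fun y hy => (hB hy).2.1,
        pow_succ ((1 + c : NNReal) : ENNReal), mul_assoc]
      refine mul_le_mul_right ?_ _
      push_cast
      rw [← setLIntegral_const, ← lintegral_const_mul' _ _ (by simp)]
      refine setLIntegral_mono' hBm fun y hy => ?_
      have h1 : 1 ≤ Real.sqrt (1 + ‖fderiv ℝ u y‖ ^ 2) :=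
        Real.one_le_sqrt.2 (by nlinarith [sq_nonneg ‖fderiv ℝ u y‖])
      have h2 : Real.sqrt (1 + ‖fderiv ℝ u x‖ ^ 2) - c < Real.sqrt (1 + ‖fderiv ℝ u y‖ ^ 2) :=
        (hB hy).2.2
      rw [hJ, show (1 + (c : ENNReal)) = ENNReal.ofReal (1 + c) by
        rw [ENNReal.ofReal_add zero_le_one c.coe_nonneg]; simp, ← ENNReal.ofReal_mul (by positivity)]
      exact ENNReal.ofReal_le_ofReal (by nlinarith [c.coe_nonneg])
    have hlim : Filter.Tendsto (fun c : NNReal => ((1 + c : NNReal) ^ (n + 1) : ENNReal) *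
        (volume.restrict O).withDensity J A) (𝓝[>] 0)
        (𝓝 (((1 + (0 : NNReal) : NNReal) ^ (n + 1) : ENNReal) *
          (volume.restrict O).withDensity J A)) := by
      refine ENNReal.Tendsto.mul_const ?_ (Or.inl (by simp))
      have : Continuous fun c : NNReal => (((1 + c : NNReal) ^ (n + 1) : NNReal) : ENNReal) := by
        fun_prop
      simpa using (this.tendsto 0).mono_left nhdsWithin_le_nhds
    have := ge_of_tendsto hlim (eventually_mem_nhdsWithin.mono fun c hc => key c hc)
    simpa using this
  have hfm : Measurable (O.indicator fun x => f (graphMap u x)) := by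
    classical
    rw [← piecewise_eq_indicator]
    exact (hf.comp_continuousOn hgc).measurable_piecewise continuousOn_const hO.measurableSet
  calc ∫⁻ p in graphMap u '' O, f p ∂(Measure.euclideanHausdorffMeasure n)
      = ∫⁻ p in graphMap u '' O, f (graphMap u (base p)) ∂(Measure.euclideanHausdorffMeasure n) := by
        refine setLIntegral_congr_fun hgm ?_
        rintro _ ⟨x, hx, rfl⟩
        simp [graphMap_eq_lift]
    _ = ∫⁻ p in graphMap u '' O, O.indicator (fun x => f (graphMap u x)) (base p)
          ∂(Measure.euclideanHausdorffMeasure n) := by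
        refine setLIntegral_congr_fun hgm ?_
        rintro _ ⟨x, hx, rfl⟩
        simp [graphMap_eq_lift, hx]
    _ = ∫⁻ x, O.indicator (fun x => f (graphMap u x)) x ∂m := by
        rw [hm, lintegral_map _ base.continuous.measurable]
        exact hfm
    _ ≤ ∫⁻ x, O.indicator (fun x => f (graphMap u x)) x ∂(volume.restrict O).withDensity J :=
        lintegral_mono' (Measure.le_iff.2 hle) le_rfl
    _ = ∫⁻ x in O, J x * O.indicator (fun x => f (graphMap u x)) x := by
        rw [lintegral_withDensity_eq_lintegral_mul₀ hJm]
        · rfl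
        · exact hfm.aemeasurable
    _ = _ := setLIntegral_congr_fun hO.measurableSet fun x hx => by simp [hx, hJ, mul_comm]

/-! ### Cutoff functions -/

theorem exists_contDiff_cutoff {F : Type*} [NormedAddCommGroup F] [NormedSpace ℝ F]
    [FiniteDimensional ℝ F] {K O : Set F} (hK : IsClosed K) (hO : IsOpen O) (hKO : K ⊆ O) :
    ∃ χ : F → ℝ, ContDiff ℝ 1 χ ∧ (∀ᶠ x in 𝓝ˢ K, χ x = 1) ∧ tsupport χ ⊆ O ∧
      ∀ x, χ x ∈ Icc (0 : ℝ) 1 := by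
  obtain ⟨f, h0, h1, hI⟩ := exists_contMDiffMap_zero_one_nhds_of_isClosed
    (modelWithCornersSelf ℝ F) (n := 1) hO.isClosed_compl hK (disjoint_compl_left_iff_subset.2 hKO)
  refine ⟨f, f.contMDiff.contDiff, h1, ?_, hI⟩
  intro x hx
  by_contra hxO
  have : ∀ᶠ y in 𝓝 x, f y = 0 := (Filter.eventually_iff.1 h0 |> mem_nhdsSet_iff_forall.1) x hxO
  exact (notMem_tsupport_iff_eventuallyEq.2 this) hx

theorem contDiff_smul_of_tsupport_subset {F G : Type*} [NormedAddCommGroup F] [NormedSpace ℝ F]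
    [NormedAddCommGroup G] [NormedSpace ℝ G] {χ : F → ℝ} {g : F → G} {O : Set F}
    (hχ : ContDiff ℝ 1 χ) (hO : IsOpen O) (hs : tsupport χ ⊆ O) (hg : ContDiffOn ℝ 1 g O) :
    ContDiff ℝ 1 fun x => χ x • g x := by
  rw [contDiff_iff_contDiffAt]
  intro x
  by_cases hx : x ∈ tsupport χ
  · exact hχ.contDiffAt.smul (hg.contDiffAt (hO.mem_nhds (hs hx)))
  · refine (contDiffAt_const (c := (0 : G))).congr_of_eventuallyEq ?_
    filter_upwards [notMem_tsupport_iff_eventuallyEq.1 hx] with y hy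
    simp [hy]

theorem exists_contDiff_eventuallyEq {F : Type*} [NormedAddCommGroup F] [NormedSpace ℝ F]
    [FiniteDimensional ℝ F] {g : F → ℝ} {x : F} (hg : ContDiffAt ℝ 1 g x) :
    ∃ g' : F → ℝ, ContDiff ℝ 1 g' ∧ g' =ᶠ[𝓝 x] g := by
  obtain ⟨U, hU, hgU⟩ := hg.contDiffOn le_rfl (by simp)
  obtain ⟨V, hVU, hVo, hxV⟩ := mem_nhds_iff.1 (by simpa using hU)
  obtain ⟨χ, hχ, h1, hs, -⟩ :=
    exists_contDiff_cutoff (isClosed_singleton (x := x)) hVo (singleton_subset_iff.2 hxV)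
  refine ⟨_, contDiff_smul_of_tsupport_subset hχ hVo hs (hgU.mono hVU), ?_⟩
  rw [nhdsSet_singleton] at h1
  filter_upwards [h1] with y hy
  simp [hy]

/-! ### Implicit functions and charts -/

theorem isInvertible_comp_inr {F : Type*} [NormedAddCommGroup F] [NormedSpace ℝ F]
    {L : F × ℝ →L[ℝ] ℝ} (h : L (0, 1) ≠ 0) :
    (L ∘L ContinuousLinearMap.inr ℝ F ℝ).IsInvertible := by
  refine ⟨ContinuousLinearEquiv.unitsEquivAut ℝ (Units.mk0 _ h), ?_⟩
  ext
  simp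

/-- The implicit function theorem for one equation that increases along the last variable: the zero
set is locally a graph, with the positive side above it. -/
theorem exists_implicit_graph {F : Type*} [NormedAddCommGroup F] [NormedSpace ℝ F]
    [FiniteDimensional ℝ F] {f : F × ℝ → ℝ} {w : F × ℝ} (hf : ContDiffAt ℝ 1 f w) (hw : f w = 0)
    (hpos : 0 < fderiv ℝ f w (0, 1)) :
    ∃ g : F → ℝ, ContDiff ℝ 1 g ∧ g w.1 = w.2 ∧
      (∀ᶠ v in 𝓝 w, Real.sign (f v) = Real.sign (v.2 - g v.1)) ∧
      ∀ v, fderiv ℝ f w (v, fderiv ℝ g w.1 v) = 0 := by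
  have hinv := isInvertible_comp_inr hpos.ne'
  set ψ := hf.implicitFunction one_ne_zero hinv with hψ
  have hψc : ContDiffAt ℝ 1 ψ w.1 := hf.contDiffAt_implicitFunction one_ne_zero hinv
  obtain ⟨g, hg, hgψ⟩ := exists_contDiff_eventuallyEq hψc
  have hgw : g w.1 = w.2 := by
    rw [hgψ.self_of_nhds]; exact hf.implicitFunction_apply_self one_ne_zero hinv
  have hzero : ∀ᶠ x in 𝓝 w.1, f (x, g x) = 0 := by
    filter_upwards [hf.eventually_apply_implicitFunction one_ne_zero hinv, hgψ] with x hx hx'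
    rw [hx', hx, hw]
  refine ⟨g, hg, hgw, ?_, fun v => ?_⟩
  · -- strict differentiability at `v` and the point `(v.1, g v.1)` of the zero set compares `f v`
    -- with `a * (v.2 - g v.1)`
    set a := fderiv ℝ f w (0, 1)
    have hst := (hf.hasStrictFDerivAt one_ne_zero).isLittleO.def (c := a / 2) (by positivity)
    have htend : Filter.Tendsto (fun v : F × ℝ => (v, ((v.1, g v.1) : F × ℝ))) (𝓝 w) (𝓝 (w, w)) := by
      have : Continuous (fun v : F × ℝ => (v, ((v.1, g v.1) : F × ℝ))) := by
        have := hg.continuous; fun_prop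
      have h2 := this.tendsto w
      rwa [hgw] at h2
    filter_upwards [htend.eventually hst, continuous_fst.continuousAt.eventually hzero] with v hv hz
    have h1 : v - (v.1, g v.1) = (v.2 - g v.1) • ((0 : F), (1 : ℝ)) := by ext <;> simp
    simp only [hz, sub_zero, h1, map_smul, smul_eq_mul, norm_smul, Prod.norm_mk, norm_zero,
      norm_one] at hv
    rw [Real.norm_eq_abs, Real.norm_eq_abs, abs_le] at hv
    rw [max_eq_right zero_le_one, mul_one] at hv
    rcases lt_trichotomy (v.2 - g v.1) 0 with h | h | h
    · rw [abs_of_neg h] at hv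
      rw [Real.sign_of_neg h, Real.sign_of_neg (by nlinarith)]
    · rw [h] at hv ⊢
      simp only [abs_zero, mul_zero, zero_mul, sub_zero, neg_zero] at hv
      rw [le_antisymm hv.2 hv.1]
    · rw [abs_of_pos h] at hv
      rw [Real.sign_of_pos h, Real.sign_of_pos (by nlinarith)]
  · have hgd : HasFDerivAt g (fderiv ℝ g w.1) w.1 :=
      (hg.differentiable one_ne_zero w.1).hasFDerivAt
    have hfd : HasFDerivAt f (fderiv ℝ f w) (w.1, g w.1) := by
      rw [hgw]; exact (hf.differentiableAt one_ne_zero).hasFDerivAt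
    have h1 := HasFDerivAt.comp (g := f) (f := fun x => (x, g x)) w.1 hfd
      ((hasFDerivAt_id w.1).prodMk hgd)
    have h2 : (f ∘ fun x => (x, g x)) =ᶠ[𝓝 w.1] fun _ => 0 := hzero
    have h3 := h1.unique ((hasFDerivAt_const (0 : ℝ) w.1).congr_of_eventuallyEq h2)
    have h4 := congrArg (fun L => L v) h3
    simpa using h4

section Charts

variable {n : ℕ} {Φ : OpenPartialHomeomorph 𝔼[n + 1] 𝔼[n + 1]} {p : 𝔼[n + 1]}

theorem IsC1Diffeo.contDiffAt {d : ℕ} {Φ : OpenPartialHomeomorph 𝔼[d] 𝔼[d]} {p : 𝔼[d]}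
    (hΦ : IsC1Diffeo Φ) (hp : p ∈ Φ.source) : ContDiffAt ℝ 1 Φ p :=
  hΦ.1.contDiffAt (Φ.open_source.mem_nhds hp)

theorem IsC1Diffeo.contDiffAt_symm {d : ℕ} {Φ : OpenPartialHomeomorph 𝔼[d] 𝔼[d]} {p : 𝔼[d]}
    (hΦ : IsC1Diffeo Φ) (hp : p ∈ Φ.source) : ContDiffAt ℝ 1 Φ.symm (Φ p) :=
  hΦ.2.contDiffAt (Φ.open_target.mem_nhds (Φ.map_source hp))

/-- The derivative of a chart is invertible. -/
theorem IsC1Diffeo.exists_equiv {d : ℕ} {Φ : OpenPartialHomeomorph 𝔼[d] 𝔼[d]} {p : 𝔼[d]}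
    (hΦ : IsC1Diffeo Φ) (hp : p ∈ Φ.source) : ∃ D : 𝔼[d] ≃L[ℝ] 𝔼[d],
      HasStrictFDerivAt Φ (D : 𝔼[d] →L[ℝ] 𝔼[d]) p ∧
      HasStrictFDerivAt Φ.symm (D.symm : 𝔼[d] →L[ℝ] 𝔼[d]) (Φ p) := by
  have h1 := (hΦ.contDiffAt hp).hasStrictFDerivAt one_ne_zero
  have h2 := (hΦ.contDiffAt_symm hp).hasStrictFDerivAt one_ne_zero
  have h2' : HasFDerivAt Φ.symm (fderiv ℝ Φ.symm (Φ p)) (Φ p) := h2.hasFDerivAt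
  have e1 := (h2'.comp p h1.hasFDerivAt).unique ((hasFDerivAt_id p).congr_of_eventuallyEq
    (Φ.eventually_left_inverse hp))
  have h1' : HasFDerivAt Φ (fderiv ℝ Φ p) (Φ.symm (Φ p)) := by
    rw [Φ.left_inv hp]; exact h1.hasFDerivAt
  have e2 := (h1'.comp (Φ p) h2').unique ((hasFDerivAt_id (Φ p)).congr_of_eventuallyEq
    (Φ.eventually_right_inverse (Φ.map_source hp)))
  refine ⟨ContinuousLinearEquiv.equivOfInverse (fderiv ℝ Φ p) (fderiv ℝ Φ.symm (Φ p))
    (fun v => ?_) (fun v => ?_), h1, h2⟩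
  · exact congrArg (fun L => L v) e1
  · exact congrArg (fun L => L v) e2

/-- The `i`-th component of a chart, with its derivative. -/
theorem hasStrictFDerivAt_coord {D : 𝔼[n + 1] →L[ℝ] 𝔼[n + 1]} {f : 𝔼[n + 1] → 𝔼[n + 1]}
    (hD : HasStrictFDerivAt f D p) (i : Fin (n + 1)) :
    HasStrictFDerivAt (fun q => f q i) ((EuclideanSpace.proj i).comp D) p :=
  (EuclideanSpace.proj (𝕜 := ℝ) i).hasStrictFDerivAt.comp p hD

theorem mem_iff_of_image_eq {X Y : Type*} [TopologicalSpace X] [TopologicalSpace Y]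
    {Φ : OpenPartialHomeomorph X Y} {A : Set X} {B : Set Y}
    (h : Φ '' (A ∩ Φ.source) = {y | y ∈ Φ.target ∧ y ∈ B}) {q : X} (hq : q ∈ Φ.source) :
    q ∈ A ↔ Φ q ∈ B := by
  constructor
  · intro hA
    have : Φ q ∈ {y | y ∈ Φ.target ∧ y ∈ B} := h ▸ ⟨q, ⟨hA, hq⟩, rfl⟩
    exact this.2
  · intro hB
    have : Φ q ∈ Φ '' (A ∩ Φ.source) := h ▸ ⟨Φ.map_source hq, hB⟩
    obtain ⟨q', ⟨hA, hq'⟩, he⟩ := this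
    rwa [← Φ.injOn hq' hq he]

theorem HasInteriorChartAt.exists_chart {W : Set 𝔼[n + 1]} (h : HasInteriorChartAt W p) :
    ∃ Φ : OpenPartialHomeomorph 𝔼[n + 1] 𝔼[n + 1], IsC1Diffeo Φ ∧ p ∈ Φ.source ∧
      ∀ q ∈ Φ.source, q ∈ W ↔ Φ q (Fin.last n) = 0 := by
  obtain ⟨Φ, hΦ, hp, h⟩ := h
  exact ⟨Φ, hΦ, hp, fun q hq => mem_iff_of_image_eq (B := {y | y (Fin.last n) = 0}) h hq⟩

theorem HasBoundaryChartAt.exists_chart {W : Set 𝔼[n + 1]} (h : HasBoundaryChartAt W p) :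
    ∃ Φ : OpenPartialHomeomorph 𝔼[n + 1] 𝔼[n + 1], IsC1Diffeo Φ ∧ p ∈ Φ.source ∧
      (∀ q ∈ Φ.source, q ∈ W ↔ Φ q (Fin.last n) = 0 ∧ 0 ≤ Φ q 0) ∧ Φ p 0 = 0 := by
  obtain ⟨Φ, hΦ, hp, h, h0⟩ := h
  exact ⟨Φ, hΦ, hp,
    fun q hq => mem_iff_of_image_eq (B := {y | y (Fin.last n) = 0 ∧ 0 ≤ y 0}) h hq, h0⟩

/-- Where the defining function of a hypersurface increases along the vertical, the hypersurface
projects onto a neighbourhood. -/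
theorem eventually_exists_lift_mem {h : 𝔼[n + 1] → ℝ} (hh : ContDiffAt ℝ 1 h p) (hp : h p = 0)
    (hv : fderiv ℝ h p (vertical n) ≠ 0) :
    ∃ ψ : 𝔼[n] → ℝ, ContDiffAt ℝ 1 ψ (base p) ∧ ψ (base p) = height p ∧
      (∀ᶠ x in 𝓝 (base p), h (lift x (ψ x)) = 0) ∧
      (∀ᶠ q in 𝓝 p, h q = 0 → ψ (base q) = height q) ∧
      ∀ v, fderiv ℝ h p (lift v (fderiv ℝ ψ (base p) v)) = 0 := by
  set f : 𝔼[n] × ℝ → ℝ := fun w => h ((splitEquiv n).symm w) with hf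
  set w : 𝔼[n] × ℝ := splitEquiv n p with hw
  have hwp : (splitEquiv n).symm w = p := (splitEquiv n).symm_apply_apply p
  have hhd : HasFDerivAt h (fderiv ℝ h p) ((splitEquiv n).symm w) := by
    rw [hwp]; exact (hh.differentiableAt one_ne_zero).hasFDerivAt
  have hfc : ContDiffAt ℝ 1 f w := by
    refine ContDiffAt.comp (g := h) w ?_ (splitEquiv n).symm.contDiff.contDiffAt
    rwa [hwp]
  have hfd : fderiv ℝ f w = (fderiv ℝ h p).comp
      ((splitEquiv n).symm : 𝔼[n] × ℝ →L[ℝ] 𝔼[n + 1]) :=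
    (HasFDerivAt.comp (g := h) w hhd (splitEquiv n).symm.hasFDerivAt).fderiv
  have hfp : f w = 0 := by rw [hf]; simp only [hwp, hp]
  have hne : fderiv ℝ f w (0, 1) ≠ 0 := by
    rw [hfd]
    simpa [vertical_eq_lift, lift] using hv
  have hinv := isInvertible_comp_inr hne
  set ψ := hfc.implicitFunction one_ne_zero hinv with hψ
  have hψw : ψ w.1 = w.2 := hfc.implicitFunction_apply_self one_ne_zero hinv
  have hψc : ContDiffAt ℝ 1 ψ w.1 := hfc.contDiffAt_implicitFunction one_ne_zero hinv
  have hz : ∀ᶠ x in 𝓝 w.1, f (x, ψ x) = 0 := by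
    filter_upwards [hfc.eventually_apply_implicitFunction one_ne_zero hinv] with x hx
    rw [hx, hfp]
  refine ⟨ψ, hψc, hψw, hz, ?_, fun v => ?_⟩
  · have h1 := hfc.eventually_apply_eq_iff_implicitFunction one_ne_zero hinv
    have h2 : ∀ᶠ q in 𝓝 p, f (splitEquiv n q) = f w ↔ ψ (splitEquiv n q).1 = (splitEquiv n q).2 :=
      (splitEquiv n).continuous.continuousAt.eventually h1
    filter_upwards [h2] with q hq hq0
    refine hq.1 ?_
    rw [hfp, hf]
    simpa using hq0
  · have hψd : HasFDerivAt ψ (fderiv ℝ ψ w.1) w.1 :=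
      (hψc.differentiableAt one_ne_zero).hasFDerivAt
    have hfd' : HasFDerivAt f (fderiv ℝ f w) (w.1, ψ w.1) := by
      rw [hψw]; exact (hfc.differentiableAt one_ne_zero).hasFDerivAt
    have h1 := HasFDerivAt.comp (g := f) (f := fun x => (x, ψ x)) w.1 hfd'
      ((hasFDerivAt_id w.1).prodMk hψd)
    have h2 : (f ∘ fun x => (x, ψ x)) =ᶠ[𝓝 w.1] fun _ => 0 := hz
    have h3 := h1.unique ((hasFDerivAt_const (0 : ℝ) w.1).congr_of_eventuallyEq h2)
    have h4 := congrArg (fun L => L v) h3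
    rw [hfd] at h4
    exact h4

/-- An open piece of a hypersurface that is nowhere vertical projects to an open set. -/
theorem image_base_mem_nhds {h : 𝔼[n + 1] → ℝ} (hh : ContDiffAt ℝ 1 h p) (hp : h p = 0)
    (hv : fderiv ℝ h p (vertical n) ≠ 0) {A : Set 𝔼[n + 1]} (hA : ∀ᶠ q in 𝓝 p, h q = 0 → q ∈ A) :
    base '' A ∈ 𝓝 (base p) := by
  obtain ⟨ψ, hψc, hψp, hz, -, -⟩ := eventually_exists_lift_mem hh hp hv
  have ht : Filter.Tendsto (fun x => lift x (ψ x)) (𝓝 (base p)) (𝓝 p) := by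
    have : ContinuousAt (fun x => lift x (ψ x)) (base p) :=
      continuous_lift.continuousAt.comp (continuousAt_id.prodMk hψc.continuousAt)
    have h2 := this.tendsto
    rwa [hψp, lift_base_height] at h2
  filter_upwards [hz, ht.eventually hA] with x hx hxA
  exact ⟨lift x (ψ x), hxA hx, base_lift _ _⟩

/-- A chart of a half-hypersurface contained in the graph of a function that is Lipschitz at the
base point is not vertical there. -/
theorem chart_apply_vertical_ne_zero (hp : p ∈ Φ.source)
    {D : 𝔼[n + 1] ≃L[ℝ] 𝔼[n + 1]}
    (hD' : HasStrictFDerivAt Φ.symm (D.symm : 𝔼[n + 1] →L[ℝ] 𝔼[n + 1]) (Φ p))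
    (hp0 : Φ p (Fin.last n) = 0) {C : Set 𝔼[n]} {u : 𝔼[n] → ℝ}
    (hu : (fun y => u y - u (base p)) =O[𝓝[C] (base p)] fun y => y - base p)
    (hup : height p = u (base p))
    (hM : ∀ᶠ q in 𝓝 p, Φ q (Fin.last n) = 0 → Φ p 0 ≤ Φ q 0 → base q ∈ C ∧ height q = u (base q)) :
    D (vertical n) (Fin.last n) ≠ 0 := by
  intro hDv
  -- The sign `s` makes the curve below start into the half-hypersurface.
  obtain ⟨s, hs, hs0⟩ : ∃ s : ℝ, s ≠ 0 ∧ 0 ≤ s * D (vertical n) 0 := by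
    rcases le_total 0 (D (vertical n) 0) with h | h
    · exact ⟨1, one_ne_zero, by simpa using h⟩
    · exact ⟨-1, by norm_num, by linarith⟩
  -- a curve in the graph leaving `p` in a vertical direction
  set c : ℝ → 𝔼[n + 1] := fun t => Φ.symm (Φ p + t • (s • D (vertical n))) with hc
  have hc0 : c 0 = p := by simp [hc, Φ.left_inv hp]
  have hcd : HasDerivAt c (s • vertical n) 0 := by
    have h1 : HasDerivAt (fun t : ℝ => Φ p + t • (s • D (vertical n))) (s • D (vertical n)) 0 := by
      simpa using ((hasDerivAt_id (0 : ℝ)).smul_const (s • D (vertical n))).const_add (Φ p)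
    have h2 : HasFDerivAt Φ.symm (D.symm : 𝔼[n + 1] →L[ℝ] 𝔼[n + 1])
        (Φ p + (0 : ℝ) • (s • D (vertical n))) := by
      rw [zero_smul, add_zero]; exact hD'.hasFDerivAt
    have h3 : HasDerivAt c (D.symm (s • D (vertical n))) 0 :=
      HasFDerivAt.comp_hasDerivAt (l := Φ.symm)
        (f := fun t : ℝ => Φ p + t • (s • D (vertical n))) (0 : ℝ) h2 h1
    have h4 : D.symm (s • D (vertical n)) = s • vertical n := by simp
    rwa [h4] at h3
  have hcc : Filter.Tendsto c (𝓝 0) (𝓝 p) := by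
    have := hcd.continuousAt.tendsto; rwa [hc0] at this
  have htgt : ∀ᶠ t in 𝓝 (0 : ℝ), Φ (c t) = Φ p + t • (s • D (vertical n)) := by
    have h1 : Filter.Tendsto (fun t : ℝ => Φ p + t • (s • D (vertical n))) (𝓝 0) (𝓝 (Φ p)) := by
      have : Continuous (fun t : ℝ => Φ p + t • (s • D (vertical n))) := by fun_prop
      simpa using this.tendsto 0
    filter_upwards [h1.eventually (Φ.open_target.mem_nhds (Φ.map_source hp))] with t ht
    exact Φ.right_inv ht
  have hgraph : ∀ᶠ t in 𝓝[>] (0 : ℝ), base (c t) ∈ C ∧ height (c t) = u (base (c t)) := by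
    filter_upwards [(hcc.eventually hM).filter_mono nhdsWithin_le_nhds,
      htgt.filter_mono nhdsWithin_le_nhds, self_mem_nhdsWithin] with t h1 h2 h3
    have h3 : 0 < t := h3
    refine h1 ?_ ?_
    · rw [h2]; simp [hp0, hDv]
    · rw [h2]
      simp only [PiLp.add_apply, PiLp.smul_apply, smul_eq_mul]
      nlinarith [mul_nonneg h3.le hs0]
  have hb : HasDerivAt (fun t => base (c t)) 0 0 := by
    have h3 : HasDerivAt (fun t => base (c t)) (base (s • vertical n)) 0 :=
      (base (n := n)).hasFDerivAt.comp_hasDerivAt (0 : ℝ) hcd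
    have h4 : base (s • vertical n) = 0 := by simp [vertical_eq_lift]
    rwa [h4] at h3
  have hh : HasDerivAt (fun t => height (c t)) s 0 := by
    have h3 : HasDerivAt (fun t => height (c t)) (height (s • vertical n)) 0 :=
      (height (n := n)).hasFDerivAt.comp_hasDerivAt (0 : ℝ) hcd
    have h4 : height (s • vertical n) = s := by simp [vertical_eq_lift]
    rwa [h4] at h3
  have hbo : (fun t => base (c t) - base p) =o[𝓝[>] 0] fun t : ℝ => t := by
    have := hb.isLittleO
    simp only [hc0, sub_zero, smul_zero] at this
    exact this.mono nhdsWithin_le_nhds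
  have hbt : Filter.Tendsto (fun t => base (c t)) (𝓝[>] 0) (𝓝[C] (base p)) := by
    refine tendsto_nhdsWithin_iff.2 ⟨?_, hgraph.mono fun t ht => ht.1⟩
    have := hb.continuousAt.tendsto
    rw [hc0] at this
    exact this.mono_left nhdsWithin_le_nhds
  have hho : (fun t => height (c t) - height p) =o[𝓝[>] 0] fun t : ℝ => t := by
    refine ((hu.comp_tendsto hbt).trans_isLittleO hbo).congr' ?_ Filter.EventuallyEq.rfl
    filter_upwards [hgraph] with t ht
    simp [ht.2, hup]
  have hho' : (fun t => height (c t) - height p - t * s) =o[𝓝[>] 0] fun t : ℝ => t := by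
    have := hh.isLittleO
    simp only [hc0, sub_zero, smul_eq_mul] at this
    exact this.mono nhdsWithin_le_nhds
  have hso : (fun t : ℝ => t * s) =o[𝓝[>] 0] fun t : ℝ => t := by
    refine (hho.sub hho').congr_left fun t => by ring
  have h1 := hso.def (c := |s| / 2) (by positivity)
  obtain ⟨t, ht, ht0⟩ := (h1.and self_mem_nhdsWithin).exists
  have ht0 : 0 < t := ht0
  rw [norm_mul, Real.norm_eq_abs, Real.norm_eq_abs, abs_of_pos ht0] at ht
  nlinarith [abs_pos.2 hs]

end Charts

/-! ### Hypersurfaces are null sets, and graphs that are hypersurfaces -/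

theorem volume_coord_eq_zero {m : ℕ} (i : Fin m) : volume {y : 𝔼[m] | y i = 0} = 0 := by
  have h : {y : 𝔼[m] | y i = 0} =
      ((LinearMap.ker (EuclideanSpace.proj i : 𝔼[m] →L[ℝ] ℝ).toLinearMap :
        Submodule ℝ 𝔼[m]) : Set 𝔼[m]) := by
    ext y; simp
  rw [h]
  refine Measure.addHaar_submodule _ _ fun htop => ?_
  have : EuclideanSpace.single i (1 : ℝ) ∈
      LinearMap.ker (EuclideanSpace.proj i : 𝔼[m] →L[ℝ] ℝ).toLinearMap := by
    rw [htop]; trivial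
  simp at this

theorem IsHypersurface.volume_eq_zero {n : ℕ} {W : Set 𝔼[n + 1]} (hW : IsHypersurface W) :
    volume W = 0 := by
  refine measure_null_of_locally_null W fun p hp => ?_
  obtain ⟨Φ, hΦ, hps, h⟩ : ∃ Φ : OpenPartialHomeomorph 𝔼[n + 1] 𝔼[n + 1], IsC1Diffeo Φ ∧
      p ∈ Φ.source ∧ ∀ q ∈ Φ.source, q ∈ W → Φ q (Fin.last n) = 0 := by
    rcases hW p hp with h | h
    · obtain ⟨Φ, hΦ, hps, h⟩ := h.exists_chart
      exact ⟨Φ, hΦ, hps, fun q hq hqW => (h q hq).1 hqW⟩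
    · obtain ⟨Φ, hΦ, hps, h, -⟩ := h.exists_chart
      exact ⟨Φ, hΦ, hps, fun q hq hqW => ((h q hq).1 hqW).1⟩
  refine ⟨W ∩ Φ.source, Filter.inter_mem self_mem_nhdsWithin
    (mem_nhdsWithin_of_mem_nhds (Φ.open_source.mem_nhds hps)), ?_⟩
  have hsub : W ∩ Φ.source ⊆ Φ.symm '' (Φ.target ∩ {y | y (Fin.last n) = 0}) := by
    rintro q ⟨hqW, hq⟩
    exact ⟨Φ q, ⟨Φ.map_source hq, h q hq hqW⟩, Φ.left_inv hq⟩
  refine measure_mono_null hsub ?_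
  refine addHaar_image_eq_zero_of_differentiableOn_of_addHaar_eq_zero volume
    ((hΦ.2.differentiableOn one_ne_zero).mono inter_subset_left) ?_
  exact measure_mono_null inter_subset_right (volume_coord_eq_zero _)

theorem dense_compl_of_volume_eq_zero {m : ℕ} {W : Set 𝔼[m]} (hW : volume W = 0) : Dense Wᶜ := by
  rw [← interior_eq_empty_iff_dense_compl]
  by_contra h
  have h1 := isOpen_interior.measure_pos volume (nonempty_iff_ne_empty.2 h)
  exact absurd (measure_mono_null interior_subset hW) h1.ne'

theorem fderiv_chart_coord {n : ℕ} {Φ : OpenPartialHomeomorph 𝔼[n + 1] 𝔼[n + 1]} {p : 𝔼[n + 1]}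
    {D : 𝔼[n + 1] ≃L[ℝ] 𝔼[n + 1]} (hD : HasStrictFDerivAt Φ (D : 𝔼[n + 1] →L[ℝ] 𝔼[n + 1]) p)
    (i : Fin (n + 1)) (v : 𝔼[n + 1]) : fderiv ℝ (fun q => Φ q i) p v = D v i := by
  rw [(hasStrictFDerivAt_coord hD i).hasFDerivAt.fderiv]
  rfl

/-- A point through which a hypersurface contains an immersed `n`-dimensional sheet is not a boundary
point: the first and last component of a boundary chart would both be critical along the sheet. -/
theorem not_hasBoundaryChartAt_of_hasFDerivAt {n : ℕ} (hn : 1 ≤ n) {W : Set 𝔼[n + 1]}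
    {p e : 𝔼[n + 1]} {γ : 𝔼[n] → 𝔼[n + 1]} {x : 𝔼[n]} {L : 𝔼[n] →L[ℝ] 𝔼[n + 1]} (hγp : γ x = p)
    (hγ : HasFDerivAt γ L x) (hW : ∀ᶠ y in 𝓝 x, γ y ∈ W)
    (he : ∀ q, ∃ v, ∃ s : ℝ, q = L v + s • e) : ¬ HasBoundaryChartAt W p := by
  intro hb
  obtain ⟨Φ, hΦ, hps, hM, hp0⟩ := hb.exists_chart
  obtain ⟨D, hD, -⟩ := hΦ.exists_equiv hps
  have hcomp : ∀ i, HasFDerivAt (fun x => Φ (γ x) i)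
      (((EuclideanSpace.proj i).comp (D : 𝔼[n + 1] →L[ℝ] 𝔼[n + 1])).comp L) x := by
    intro i
    refine HasFDerivAt.comp (g := fun q => Φ q i) x ?_ hγ
    rw [hγp]
    exact (hasStrictFDerivAt_coord hD i).hasFDerivAt
  have hnear : ∀ᶠ y in 𝓝 x, Φ (γ y) (Fin.last n) = 0 ∧ 0 ≤ Φ (γ y) 0 := by
    have h1 : ∀ᶠ y in 𝓝 x, γ y ∈ Φ.source := by
      refine hγ.continuousAt.eventually ?_
      rw [hγp]; exact Φ.open_source.mem_nhds hps
    filter_upwards [h1, hW] with y hy hyW using (hM _ hy).1 hyW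
  have hn0 : ∀ v, D (L v) (Fin.last n) = 0 := by
    have h1 : IsLocalMin (fun y => Φ (γ y) (Fin.last n)) x := by
      filter_upwards [hnear] with y hy
      rw [hy.1, hnear.self_of_nhds.1]
    intro v
    exact congrArg (fun L => L v) (h1.hasFDerivAt_eq_zero (hcomp _))
  have h00 : ∀ v, D (L v) 0 = 0 := by
    have h1 : IsLocalMin (fun y => Φ (γ y) 0) x := by
      filter_upwards [hnear] with y hy
      rw [hγp, hp0]; exact hy.2
    intro v
    exact congrArg (fun L => L v) (h1.hasFDerivAt_eq_zero (hcomp _))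
  -- both components of `D` vanish on the range of `L`, which has codimension one
  have hfac : ∀ q, ∃ s : ℝ, D q 0 = s * D e 0 ∧ D q (Fin.last n) = s * D e (Fin.last n) := by
    intro q
    obtain ⟨v, s, hq⟩ := he q
    refine ⟨s, ?_, ?_⟩ <;>
    · rw [hq, map_add, map_smul]
      simp [h00, hn0]
  have hne : (0 : Fin (n + 1)) ≠ Fin.last n := by
    rw [Ne, Fin.ext_iff]; simp; omega
  obtain ⟨s, e1, e2⟩ := hfac (D.symm (EuclideanSpace.single 0 1))
  obtain ⟨t, -, e3⟩ := hfac (D.symm (EuclideanSpace.single (Fin.last n) 1))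
  rw [D.apply_symm_apply] at e1 e2 e3
  simp [hne.symm] at e1 e2 e3
  rcases e2 with e2 | e2
  · rw [e2] at e1; simp at e1
  · rw [e2] at e3; simp at e3

/-- `M` is the graph of `u` over the compact set `C`, it is a hypersurface with boundary, and `u` is
`C¹` inside `C` and Lipschitz at each point of `C`. -/
structure IsGraphHypersurface {n : ℕ} (C : Set 𝔼[n]) (u : 𝔼[n] → ℝ) (M : Set 𝔼[n + 1]) :
    Prop where
  eq_image : M = graphMap u '' C
  compact : IsCompact C
  continuousOn : ContinuousOn u C
  isBigO : ∀ x ∈ C, (fun y => u y - u x) =O[𝓝[C] x] fun y => y - x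
  contDiffOn : ContDiffOn ℝ 1 u (interior C)
  hypersurface : IsHypersurface M

namespace IsGraphHypersurface

variable {n : ℕ} {C : Set 𝔼[n]} {u : 𝔼[n] → ℝ} {M : Set 𝔼[n + 1]}

theorem mem_iff (h : IsGraphHypersurface C u M) {p : 𝔼[n + 1]} :
    p ∈ M ↔ base p ∈ C ∧ height p = u (base p) := by
  rw [h.eq_image]
  constructor
  · rintro ⟨x, hx, rfl⟩
    simp [graphMap_eq_lift, hx]
  · rintro ⟨h1, h2⟩
    exact ⟨base p, h1, by rw [graphMap_eq_lift, ← h2, lift_base_height]⟩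

theorem continuousOn_graphMap (h : IsGraphHypersurface C u M) : ContinuousOn (graphMap u) C :=
  continuous_lift.comp_continuousOn (continuousOn_id.prodMk h.continuousOn)

theorem isCompact (h : IsGraphHypersurface C u M) : IsCompact M := by
  rw [h.eq_image]
  exact h.compact.image_of_continuousOn h.continuousOn_graphMap

/-- The point of `M` over an `x` near `base p` is near `p`. -/
theorem tendsto_lift (h : IsGraphHypersurface C u M) {p : 𝔼[n + 1]} (hp : p ∈ M) :
    Filter.Tendsto (fun x => lift x (u x)) (𝓝[C] (base p)) (𝓝 p) := by
  have hp' := h.mem_iff.1 hp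
  have := h.continuousOn_graphMap (base p) hp'.1
  unfold ContinuousWithinAt at this
  simp only [graphMap_eq_lift] at this
  rwa [← hp'.2, lift_base_height] at this

/-- Interior points of `M` lie over interior points of `C`. -/
theorem base_mem_interior_of_chart (h : IsGraphHypersurface C u M)
    {Φ : OpenPartialHomeomorph 𝔼[n + 1] 𝔼[n + 1]} (hΦ : IsC1Diffeo Φ) {p : 𝔼[n + 1]}
    (hp : p ∈ Φ.source) (hp0 : Φ p (Fin.last n) = 0)
    (hM : ∀ᶠ q in 𝓝 p, Φ q (Fin.last n) = 0 → q ∈ M) : base p ∈ interior C := by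
  obtain ⟨D, hD, hD'⟩ := hΦ.exists_equiv hp
  have hpM := h.mem_iff.1 (hM.self_of_nhds hp0)
  have hv := chart_apply_vertical_ne_zero hp hD' hp0 (h.isBigO _ hpM.1) hpM.2
    (hM.mono fun q hq h0 _ => h.mem_iff.1 (hq h0))
  have hc : ContDiffAt ℝ 1 (fun q => Φ q (Fin.last n)) p :=
    (EuclideanSpace.proj (𝕜 := ℝ) (Fin.last n)).contDiff.contDiffAt.comp p (hΦ.contDiffAt hp)
  have := image_base_mem_nhds hc hp0 (by rwa [fderiv_chart_coord hD]) hM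
  rw [mem_interior_iff_mem_nhds]
  refine Filter.mem_of_superset this ?_
  rintro _ ⟨q, hq, rfl⟩
  exact (h.mem_iff.1 hq).1

/-- Boundary points of `M` do not lie over interior points of `C`. -/
theorem not_hasBoundaryChartAt (h : IsGraphHypersurface C u M) (hn : 1 ≤ n) {p : 𝔼[n + 1]}
    (hp : p ∈ M) (hpC : base p ∈ interior C) : ¬ HasBoundaryChartAt M p := by
  have hpM := h.mem_iff.1 hp
  have hgp : graphMap u (base p) = p := by rw [graphMap_eq_lift, ← hpM.2, lift_base_height]
  have hg : HasFDerivAt (graphMap u) (graphLinear (fderiv ℝ u (base p))) (base p) :=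
    (hasStrictFDerivAt_graphMap ((h.contDiffOn.contDiffAt
      (isOpen_interior.mem_nhds hpC)).hasStrictFDerivAt one_ne_zero)).hasFDerivAt
  refine not_hasBoundaryChartAt_of_hasFDerivAt hn hgp hg ?_ (e := vertical n) fun q =>
    ⟨base q, height q - fderiv ℝ u (base p) (base q), ?_⟩
  · filter_upwards [isOpen_interior.mem_nhds hpC] with x hxC
    rw [h.eq_image]; exact ⟨x, interior_subset hxC, rfl⟩
  · apply ext_base_height <;> simp [graphLinear_apply, vertical_eq_lift]

/-- The manifold boundary of `M` is the part of `M` over the frontier of `C`. -/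
theorem mem_boundary_iff (h : IsGraphHypersurface C u M) (hn : 1 ≤ n) {p : 𝔼[n + 1]} :
    p ∈ hypersurfaceBoundary M ↔ p ∈ M ∧ base p ∉ interior C := by
  constructor
  · rintro ⟨hp, hb⟩
    exact ⟨hp, fun hi => h.not_hasBoundaryChartAt hn hp hi hb⟩
  · rintro ⟨hp, hi⟩
    refine ⟨hp, (h.hypersurface p hp).resolve_left fun hint => hi ?_⟩
    obtain ⟨Φ, hΦ, hps, hM⟩ := hint.exists_chart
    refine h.base_mem_interior_of_chart hΦ hps ((hM p hps).1 hp) ?_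
    filter_upwards [Φ.open_source.mem_nhds hps] with q hq using (hM q hq).2

theorem isClosed_boundary (h : IsGraphHypersurface C u M) (hn : 1 ≤ n) :
    IsClosed (hypersurfaceBoundary M) := by
  have : hypersurfaceBoundary M = M ∩ base ⁻¹' (interior C)ᶜ := by
    ext p; rw [h.mem_boundary_iff hn]; rfl
  rw [this]
  exact h.isCompact.isClosed.inter (isOpen_interior.isClosed_compl.preimage base.continuous)

theorem boundary_nonempty (h : IsGraphHypersurface C u M) (hn : 1 ≤ n) (hC : C.Nonempty) :
    (hypersurfaceBoundary M).Nonempty := by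
  obtain ⟨x, hx, hxi⟩ : ∃ x ∈ C, x ∉ interior C := by
    by_contra! hcon
    have hopen : IsOpen C := by
      rw [← subset_interior_iff_isOpen]; exact hcon
    have : Nontrivial 𝔼[n] := by
      have : Nonempty (Fin n) := ⟨⟨0, by omega⟩⟩
      infer_instance
    have huniv : C = univ := IsClopen.eq_univ ⟨h.compact.isClosed, hopen⟩ hC
    exact noncompact_univ 𝔼[n] (huniv ▸ h.compact)
  refine ⟨lift x (u x), (h.mem_boundary_iff hn).2 ⟨h.mem_iff.2 ?_, ?_⟩⟩ <;> simpa

/-- A boundary chart of `M` straightens `∂M` into the edge `{y_1 = y_{n+1} = 0}`. -/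
theorem exists_chart_boundary (h : IsGraphHypersurface C u M) (hn : 1 ≤ n) {p : 𝔼[n + 1]}
    (hp : p ∈ hypersurfaceBoundary M) :
    ∃ Φ : OpenPartialHomeomorph 𝔼[n + 1] 𝔼[n + 1], IsC1Diffeo Φ ∧ p ∈ Φ.source ∧
      ∀ q ∈ Φ.source, q ∈ hypersurfaceBoundary M ↔ Φ q 0 = 0 ∧ Φ q (Fin.last n) = 0 := by
  obtain ⟨Φ, hΦ, hps, himg, hp0⟩ := hp.2
  have hM : ∀ q ∈ Φ.source, q ∈ M ↔ Φ q (Fin.last n) = 0 ∧ 0 ≤ Φ q 0 := fun q hq =>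
    mem_iff_of_image_eq (B := {y | y (Fin.last n) = 0 ∧ 0 ≤ y 0}) himg hq
  refine ⟨Φ, hΦ, hps, fun q hq => ⟨fun hqS => ?_, fun h0 =>
    ⟨(hM q hq).2 ⟨h0.2, h0.1.ge⟩, Φ, hΦ, hq, himg, h0.1⟩⟩⟩
  have h1 := (hM q hq).1 hqS.1
  refine ⟨le_antisymm (not_lt.1 fun hlt => ?_) h1.2, h1.1⟩
  refine ((h.mem_boundary_iff hn).1 hqS).2 (h.base_mem_interior_of_chart hΦ hq h1.1 ?_)
  have hc : ContinuousAt (fun q => Φ q 0) q :=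
    (EuclideanSpace.proj (𝕜 := ℝ) (0 : Fin (n + 1))).continuous.continuousAt.comp
      (Φ.continuousAt hq)
  filter_upwards [Φ.open_source.mem_nhds hq, hc.eventually (lt_mem_nhds hlt)] with r hr hr0 hr1
  exact (hM r hr).2 ⟨hr1, hr0.le⟩

/-- Near a frontier point of `C` there is a direction that points into the interior of `C`. -/
theorem exists_inward (h : IsGraphHypersurface C u M) (hn : 1 ≤ n) {x₀ : 𝔼[n]} (hx₀ : x₀ ∈ C)
    (hx₀i : x₀ ∉ interior C) : ∃ e : 𝔼[n], ∃ B ∈ 𝓝 x₀, ∃ τ₀ > (0 : ℝ),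
      ∀ x ∈ C ∩ B, ∀ τ ∈ Ioo 0 τ₀, x + τ • e ∈ interior C := by
  set p : 𝔼[n + 1] := lift x₀ (u x₀) with hpdef
  have hbp : base p = x₀ := base_lift _ _
  have hp : p ∈ hypersurfaceBoundary M := by
    refine (h.mem_boundary_iff hn).2 ⟨h.mem_iff.2 ?_, ?_⟩ <;> simpa [hpdef]
  have hpM := h.mem_iff.1 hp.1
  obtain ⟨Φ, hΦ, hps, hM, hp0⟩ := hp.2.exists_chart
  obtain ⟨D, hD, hD'⟩ := hΦ.exists_equiv hps
  have hpn : Φ p (Fin.last n) = 0 := ((hM p hps).1 hp.1).1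
  have hv : D (vertical n) (Fin.last n) ≠ 0 := by
    refine chart_apply_vertical_ne_zero hps hD' hpn (h.isBigO _ hpM.1) hpM.2 ?_
    filter_upwards [Φ.open_source.mem_nhds hps] with q hq h0 h1
    exact h.mem_iff.1 ((hM q hq).2 ⟨h0, by rwa [hp0] at h1⟩)
  have hc : ∀ i, ContDiffAt ℝ 1 (fun q => Φ q i) p := fun i =>
    (EuclideanSpace.proj (𝕜 := ℝ) i).contDiff.contDiffAt.comp p (hΦ.contDiffAt hps)
  obtain ⟨ψ, hψc, hψp, hz, hzu, hψd⟩ := eventually_exists_lift_mem (hc (Fin.last n)) hpn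
    (by rwa [fderiv_chart_coord hD])
  rw [hbp] at hψc hψp hz hψd
  have hlψ : ContDiffAt ℝ 1 (fun x => lift x (ψ x)) x₀ :=
    (contDiff_lift (n := n) (k := 1)).contDiffAt.comp x₀ (contDiffAt_id.prodMk hψc)
  have hlp : lift x₀ (ψ x₀) = p := by rw [hψp]; simp [hpdef]
  -- the first chart component, as a function on the base
  set β : 𝔼[n] → ℝ := fun x => Φ (lift x (ψ x)) 0 with hβ
  have hβc : ContDiffAt ℝ 1 β x₀ := by
    refine ContDiffAt.comp (g := fun q => Φ q 0) x₀ ?_ hlψ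
    rw [hlp]; exact hc 0
  set w := D.symm (EuclideanSpace.single 0 1) with hw
  have hne : (0 : Fin (n + 1)) ≠ Fin.last n := by
    rw [Ne, Fin.ext_iff]; simp; omega
  have hβd : fderiv ℝ β x₀ (base w) = 1 := by
    have h1 : HasFDerivAt (fun x => lift x (ψ x)) (graphLinear (fderiv ℝ ψ x₀)) x₀ :=
      (hasStrictFDerivAt_graphMap (hψc.hasStrictFDerivAt one_ne_zero)).hasFDerivAt
    have h2 : HasFDerivAt (fun q => Φ q 0) ((EuclideanSpace.proj 0).comp
        (D : 𝔼[n + 1] →L[ℝ] 𝔼[n + 1])) (lift x₀ (ψ x₀)) := by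
      rw [hlp]; exact (hasStrictFDerivAt_coord hD 0).hasFDerivAt
    have h3 := HasFDerivAt.comp (g := fun q => Φ q 0) x₀ h2 h1
    have h4 : graphLinear (fderiv ℝ ψ x₀) (base w) = w := by
      have h5 := hψd (base w)
      rw [fderiv_chart_coord hD] at h5
      have h6 : D w (Fin.last n) = 0 := by
        rw [hw, D.apply_symm_apply]; simp [hne.symm]
      have h7 : w = graphLinear (fderiv ℝ ψ x₀) (base w) +
          (height w - fderiv ℝ ψ x₀ (base w)) • vertical n := by
        apply ext_base_height <;> simp [graphLinear_apply, vertical_eq_lift]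
      rw [h7, map_add, map_smul] at h6
      simp only [graphLinear_apply, PiLp.add_apply, PiLp.smul_apply, smul_eq_mul, h5, zero_add,
        mul_eq_zero, hv, or_false] at h6
      rw [h6, zero_smul, add_zero] at h7
      exact h7.symm
    rw [show fderiv ℝ β x₀ = _ from h3.fderiv]
    have h8 : D w 0 = 1 := by rw [hw, D.apply_symm_apply]; simp
    change D (graphLinear (fderiv ℝ ψ x₀) (base w)) 0 = 1
    rw [h4, h8]
  have hlt : Filter.Tendsto (fun x => lift x (ψ x)) (𝓝 x₀) (𝓝 p) := by
    have := hlψ.continuousAt.tendsto; rwa [hlp] at this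
  -- `C` lies in `{β ≥ 0}`, and `{β > 0}` lies in the interior of `C`
  have hCβ : ∀ᶠ x in 𝓝[C] x₀, 0 ≤ β x := by
    have ht := h.tendsto_lift hp.1
    rw [hbp] at ht
    filter_upwards [ht.eventually hzu, ht.eventually (Φ.open_source.mem_nhds hps),
      self_mem_nhdsWithin] with x h1 h2 h3
    have h4 := (hM _ h2).1 (h.mem_iff.2 (by simpa using h3))
    have h5 := h1 h4.1
    simp only [base_lift, height_lift] at h5
    simp only [hβ, h5]
    exact h4.2
  have hβC : ∀ᶠ x in 𝓝 x₀, 0 < β x → x ∈ interior C := by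
    filter_upwards [hz.eventually_nhds, (hlt.eventually (Φ.open_source.mem_nhds hps)).eventually_nhds,
      (hβc.eventually (by simp)).mono fun x hx => hx.continuousAt] with x h1 h2 h3 h4
    rw [mem_interior_iff_mem_nhds]
    filter_upwards [h1, h2, h3.eventually (lt_mem_nhds h4)] with y k1 k2 k3
    have := (h.mem_iff.1 ((hM _ k2).2 ⟨k1, le_of_lt k3⟩)).1
    rwa [base_lift] at this
  -- `β` increases in the direction `e` with speed one at `x₀`, so `β (x + τ • e) > 0` for `x ∈ C`
  -- near `x₀` by strict differentiability.
  set e := base w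
  have hst := (hβc.hasStrictFDerivAt one_ne_zero).isLittleO.def
    (c := 1 / (2 * (‖e‖ + 1))) (by positivity)
  have htend : Filter.Tendsto (fun xt : 𝔼[n] × ℝ => (xt.1 + xt.2 • e, xt.1)) (𝓝 (x₀, 0))
      (𝓝 (x₀, x₀)) := by
    have : Continuous (fun xt : 𝔼[n] × ℝ => (xt.1 + xt.2 • e, xt.1)) := by fun_prop
    simpa using this.tendsto (x₀, 0)
  have htend' : Filter.Tendsto (fun xt : 𝔼[n] × ℝ => xt.1 + xt.2 • e) (𝓝 (x₀, 0)) (𝓝 x₀) :=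
    (continuous_fst.tendsto _).comp htend
  have hall := (htend.eventually hst).and (htend'.eventually hβC)
  rw [nhds_prod_eq] at hall
  obtain ⟨B, hB, T, hT, hBT⟩ := Filter.eventually_prod_iff.1 hall
  obtain ⟨τ₀, hτ₀, hTτ⟩ := Metric.eventually_nhds_iff.1 hT
  obtain ⟨B', hB', hBβ⟩ := (eventually_nhdsWithin_iff.1 hCβ).exists_mem
  refine ⟨e, {x | B x} ∩ B', Filter.inter_mem hB hB', τ₀, hτ₀, fun x hx τ hτ => ?_⟩
  obtain ⟨k1, k2⟩ := hBT hx.2.1 (hTτ (y := τ) (by simpa [abs_of_pos hτ.1] using hτ.2))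
  refine k2 ?_
  have k3 : 0 ≤ β x := hBβ x hx.2.2 hx.1
  simp only [add_sub_cancel_left, map_smul, e, hβd, smul_eq_mul, mul_one] at k1
  rw [norm_smul, Real.norm_eq_abs, Real.norm_eq_abs, abs_of_pos hτ.1] at k1
  have k4 := (abs_le.1 k1).1
  have k5 : 1 / (2 * (‖base w‖ + 1)) * (τ * ‖base w‖) ≤ τ / 2 := by
    rw [div_mul_eq_mul_div, one_mul, div_le_iff₀ (by positivity)]
    nlinarith [hτ.1, norm_nonneg (base w)]
  have : 0 < τ := hτ.1
  simp only [e]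
  linarith

end IsGraphHypersurface

/-! ### The two sides of a hypersurface -/

/-- The function `σ` is locally constant with values `±1` off `W` near `q`, and it changes sign
across `W` if `q` lies on `W`. Its values on `W` itself are irrelevant. -/
def IsSideAt {n : ℕ} (W : Set 𝔼[n + 1]) (σ : 𝔼[n + 1] → ℝ) (q : 𝔼[n + 1]) : Prop :=
  (q ∉ W ∧ ∃ c : ℝ, (c = 1 ∨ c = -1) ∧ ∀ᶠ y in 𝓝 q, y ∉ W → σ y = c) ∨
  (q ∈ W ∧ ∃ (Φ : OpenPartialHomeomorph 𝔼[n + 1] 𝔼[n + 1]) (c : ℝ), IsC1Diffeo Φ ∧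
    q ∈ Φ.source ∧ (∀ y ∈ Φ.source, y ∈ W ↔ Φ y (Fin.last n) = 0) ∧ (c = 1 ∨ c = -1) ∧
    ∀ᶠ y in 𝓝 q, y ∉ W → σ y = c * Real.sign (Φ y (Fin.last n)))

section Sides

variable {n : ℕ} {W : Set 𝔼[n + 1]} {σ σ' : 𝔼[n + 1] → ℝ} {q : 𝔼[n + 1]}

theorem IsSideAt.congr (h : IsSideAt W σ q) (he : ∀ᶠ y in 𝓝 q, y ∉ W → σ' y = σ y) :
    IsSideAt W σ' q := by
  rcases h with ⟨hq, c, hc, h⟩ | ⟨hq, Φ, c, hΦ, hqs, hW, hc, h⟩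
  · refine Or.inl ⟨hq, c, hc, ?_⟩
    filter_upwards [h, he] with y h1 h2 h3
    rw [h2 h3, h1 h3]
  · refine Or.inr ⟨hq, Φ, c, hΦ, hqs, hW, hc, ?_⟩
    filter_upwards [h, he] with y h1 h2 h3
    rw [h2 h3, h1 h3]

theorem IsSideAt.const_mul (h : IsSideAt W σ q) {a : ℝ} (ha : a = 1 ∨ a = -1) :
    IsSideAt W (fun y => a * σ y) q := by
  have hmul : ∀ {c : ℝ}, (c = 1 ∨ c = -1) → (a * c = 1 ∨ a * c = -1) := by
    rintro c (rfl | rfl) <;> rcases ha with rfl | rfl <;> norm_num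
  rcases h with ⟨hq, c, hc, h⟩ | ⟨hq, Φ, c, hΦ, hqs, hW, hc, h⟩
  · refine Or.inl ⟨hq, a * c, hmul hc, ?_⟩
    filter_upwards [h] with y h1 h3
    rw [h1 h3]
  · refine Or.inr ⟨hq, Φ, a * c, hΦ, hqs, hW, hmul hc, ?_⟩
    filter_upwards [h] with y h1 h3
    rw [h1 h3, mul_assoc]

theorem isSideAt_one (hq : q ∉ W) : IsSideAt W (fun _ => 1) q :=
  Or.inl ⟨hq, 1, Or.inl rfl, Filter.Eventually.of_forall fun _ _ => rfl⟩

theorem continuousAt_coord {m : ℕ} {Φ : OpenPartialHomeomorph 𝔼[m] 𝔼[m]} {q : 𝔼[m]}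
    (hq : q ∈ Φ.source) (i : Fin m) : ContinuousAt (fun y => Φ y i) q :=
  (EuclideanSpace.proj (𝕜 := ℝ) i).continuous.continuousAt.comp (Φ.continuousAt hq)

theorem IsSideAt.eventually (hWc : IsClosed W) (h : IsSideAt W σ q) :
    ∀ᶠ y in 𝓝 q, IsSideAt W σ y := by
  rcases h with ⟨hq, c, hc, h⟩ | ⟨hq, Φ, c, hΦ, hqs, hW, hc, h⟩
  · filter_upwards [h.eventually_nhds, hWc.isOpen_compl.mem_nhds hq] with y hy hyW
    exact Or.inl ⟨hyW, c, hc, hy⟩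
  · filter_upwards [h.eventually_nhds, Φ.open_source.mem_nhds hqs] with y hy hys
    by_cases hyW : y ∈ W
    · exact Or.inr ⟨hyW, Φ, c, hΦ, hys, hW, hc, hy⟩
    · have hne : Φ y (Fin.last n) ≠ 0 := fun h0 => hyW ((hW y hys).2 h0)
      refine Or.inl ⟨hyW, c * Real.sign (Φ y (Fin.last n)), ?_, ?_⟩
      · rcases Real.sign_apply_eq_of_ne_zero _ hne with h1 | h1 <;> rcases hc with rfl | rfl <;>
          rw [h1] <;> norm_num
      · have hs : ∀ᶠ z in 𝓝 y, Real.sign (Φ z (Fin.last n)) = Real.sign (Φ y (Fin.last n)) := by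
          rcases lt_or_gt_of_ne hne with h1 | h1
          · filter_upwards [(continuousAt_coord hys (Fin.last n)).eventually (gt_mem_nhds h1)]
              with z hz
            rw [Real.sign_of_neg hz, Real.sign_of_neg h1]
          · filter_upwards [(continuousAt_coord hys (Fin.last n)).eventually (lt_mem_nhds h1)]
              with z hz
            rw [Real.sign_of_pos hz, Real.sign_of_pos h1]
        filter_upwards [hy, hs] with z h1 h2 h3
        rw [h1 h3, h2]

theorem IsSideAt.eventually_eq_or (h : IsSideAt W σ q) :
    ∀ᶠ y in 𝓝 q, y ∉ W → σ y = 1 ∨ σ y = -1 := by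
  rcases h with ⟨hq, c, hc, h⟩ | ⟨hq, Φ, c, hΦ, hqs, hW, hc, h⟩
  · filter_upwards [h] with y h1 h2
    rw [h1 h2]; exact hc
  · filter_upwards [h, Φ.open_source.mem_nhds hqs] with y h1 hys h2
    have hne : Φ y (Fin.last n) ≠ 0 := fun h0 => h2 ((hW y hys).2 h0)
    rw [h1 h2]
    rcases Real.sign_apply_eq_of_ne_zero _ hne with h3 | h3 <;> rcases hc with rfl | rfl <;>
      rw [h3] <;> norm_num

theorem exists_isSideAt (h : q ∉ W ∨ HasInteriorChartAt W q) : ∃ σ, IsSideAt W σ q := by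
  by_cases hq : q ∈ W
  · obtain ⟨Φ, hΦ, hqs, hW⟩ := (h.resolve_left (not_not.2 hq)).exists_chart
    exact ⟨fun y => Real.sign (Φ y (Fin.last n)), Or.inr ⟨hq, Φ, 1, hΦ, hqs, hW, Or.inl rfl,
      Filter.Eventually.of_forall fun y _ => (one_mul _).symm⟩⟩
  · exact ⟨_, isSideAt_one hq⟩

theorem IsPreconnected.pos_or_neg {X : Type*} [TopologicalSpace X] {s : Set X} {f : X → ℝ}
    (hs : IsPreconnected s) (hf : ContinuousOn f s) (h0 : ∀ x ∈ s, f x ≠ 0) :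
    (∀ x ∈ s, 0 < f x) ∨ (∀ x ∈ s, f x < 0) := by
  by_contra! h
  obtain ⟨⟨x, hx, hx0⟩, y, hy, hy0⟩ := h
  obtain ⟨z, hz, hz0⟩ := hs.intermediate_value hx hy hf ⟨hx0, hy0⟩
  exact h0 z hz hz0

theorem eventually_exists_ball_symm {Φ : OpenPartialHomeomorph 𝔼[n + 1] 𝔼[n + 1]}
    (hq : q ∈ Φ.source) {P : 𝔼[n + 1] → Prop} (hP : ∀ᶠ y in 𝓝 q, P y) :
    ∃ r > 0, Metric.ball (Φ q) r ⊆ Φ.target ∧ ∀ w ∈ Metric.ball (Φ q) r, P (Φ.symm w) := by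
  have h1 : ∀ᶠ w in 𝓝 (Φ q), w ∈ Φ.target ∧ P (Φ.symm w) := by
    have h2 : Filter.Tendsto Φ.symm (𝓝 (Φ q)) (𝓝 q) := by
      have := (Φ.continuousAt_symm (Φ.map_source hq)).tendsto
      rwa [Φ.left_inv hq] at this
    filter_upwards [Φ.open_target.mem_nhds (Φ.map_source hq), h2.eventually hP] with w h3 h4
    exact ⟨h3, h4⟩
  obtain ⟨r, hr, h⟩ := Metric.eventually_nhds_iff_ball.1 h1
  exact ⟨r, hr, fun w hw => (h w hw).1, fun w hw => (h w hw).2⟩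

theorem convex_ball_inter_coord_pos (w : 𝔼[n + 1]) (r : ℝ) (i : Fin (n + 1)) :
    Convex ℝ (Metric.ball w r ∩ {y | 0 < y i}) ∧ Convex ℝ (Metric.ball w r ∩ {y | y i < 0}) :=
  ⟨(convex_ball w r).inter (convex_halfSpace_gt
    (EuclideanSpace.proj i : 𝔼[n + 1] →L[ℝ] ℝ).isLinear 0),
   (convex_ball w r).inter (convex_halfSpace_lt
    (EuclideanSpace.proj i : 𝔼[n + 1] →L[ℝ] ℝ).isLinear 0)⟩

/-- Two side functions agree near each point up to a sign: another defining function keeps its sign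
on each half of a chart ball, and not the same sign on both, since it is not critical. -/
theorem IsSideAt.eventually_eq_mul (h : IsSideAt W σ q) (h' : IsSideAt W σ' q) :
    ∃ c : ℝ, (c = 1 ∨ c = -1) ∧ ∀ᶠ y in 𝓝 q, y ∉ W → σ' y = c * σ y := by
  rcases h with ⟨hq, c, hc, h⟩ | ⟨hq, Φ, c, hΦ, hqs, hW, hc, h⟩
  · rcases h' with ⟨-, c', hc', h'⟩ | ⟨hq', -⟩
    · refine ⟨c' * c, ?_, ?_⟩
      · rcases hc with rfl | rfl <;> rcases hc' with rfl | rfl <;> norm_num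
      · filter_upwards [h, h'] with y h1 h2 h3
        rw [h1 h3, h2 h3]
        rcases hc with rfl | rfl <;> ring
    · exact absurd hq' hq
  rcases h' with ⟨hq', -⟩ | ⟨-, Φ', c', hΦ', hqs', hW', hc', h'⟩
  · exact absurd hq hq'
  suffices hs : ∃ a : ℝ, (a = 1 ∨ a = -1) ∧ ∀ᶠ y in 𝓝 q, y ∉ W →
      Real.sign (Φ' y (Fin.last n)) = a * Real.sign (Φ y (Fin.last n)) by
    obtain ⟨a, ha, hs⟩ := hs
    refine ⟨c' * a * c, ?_, ?_⟩
    · rcases hc with rfl | rfl <;> rcases hc' with rfl | rfl <;> rcases ha with rfl | rfl <;>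
        norm_num
    · filter_upwards [h, h', hs] with y h1 h2 h3 h4
      rw [h1 h4, h2 h4, h3 h4]
      rcases hc with rfl | rfl <;> ring
  obtain ⟨r, hr, hrt, hrs⟩ := eventually_exists_ball_symm hqs
    (Φ'.open_source.mem_nhds hqs' : ∀ᶠ y in 𝓝 q, y ∈ Φ'.source)
  -- the second defining function of `W`, in the chart of the first
  set f : 𝔼[n + 1] → ℝ := fun w => Φ' (Φ.symm w) (Fin.last n) with hf
  have hfc : ContinuousOn f (Metric.ball (Φ q) r) := fun w hw =>
    (ContinuousAt.comp (g := fun y => Φ' y (Fin.last n)) (continuousAt_coord (hrs w hw) _)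
      (Φ.continuousAt_symm (hrt hw))).continuousWithinAt
  have hf0 : ∀ w ∈ Metric.ball (Φ q) r, (f w = 0 ↔ w (Fin.last n) = 0) := fun w hw => by
    rw [hf, ← hW' _ (hrs w hw), hW _ (Φ.map_target (hrt hw)), Φ.right_inv (hrt hw)]
  have hup := (convex_ball_inter_coord_pos (Φ q) r (Fin.last n)).1.isPreconnected.pos_or_neg
    (hfc.mono inter_subset_left) fun w hw h0 => hw.2.ne' ((hf0 w hw.1).1 h0)
  have hdn := (convex_ball_inter_coord_pos (Φ q) r (Fin.last n)).2.isPreconnected.pos_or_neg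
    (hfc.mono inter_subset_left) fun w hw h0 => hw.2.ne ((hf0 w hw.1).1 h0)
  have hball : ∀ᶠ y in 𝓝 q, y ∈ Φ.source ∧ Φ y ∈ Metric.ball (Φ q) r := by
    filter_upwards [Φ.open_source.mem_nhds hqs,
      (Φ.continuousAt hqs).eventually (Metric.ball_mem_nhds _ hr)] with y h1 h2
    exact ⟨h1, h2⟩
  have hΦ'q : Φ' q (Fin.last n) = 0 := (hW' q hqs').1 hq
  obtain ⟨D, hD, -⟩ := hΦ'.exists_equiv hqs'
  have hcrit : ¬ IsLocalExtr (fun y => Φ' y (Fin.last n)) q := fun hex => by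
    have h1 := hex.hasFDerivAt_eq_zero (hasStrictFDerivAt_coord hD (Fin.last n)).hasFDerivAt
    have h2 := congrArg (fun L => L (D.symm (EuclideanSpace.single (Fin.last n) 1))) h1
    simp at h2
  have hcase : ∀ᶠ y in 𝓝 q, (y ∈ W ∧ Φ' y (Fin.last n) = 0) ∨ (0 < Φ y (Fin.last n) ∧
      Φ y ∈ Metric.ball (Φ q) r ∩ {y | 0 < y (Fin.last n)} ∧ f (Φ y) = Φ' y (Fin.last n)) ∨
      (Φ y (Fin.last n) < 0 ∧ Φ y ∈ Metric.ball (Φ q) r ∩ {y | y (Fin.last n) < 0} ∧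
        f (Φ y) = Φ' y (Fin.last n)) := by
    filter_upwards [hball, Φ'.open_source.mem_nhds hqs'] with y ⟨h1, h2⟩ h3
    have hfe : f (Φ y) = Φ' y (Fin.last n) := by simp only [hf, Φ.left_inv h1]
    rcases lt_trichotomy (Φ y (Fin.last n)) 0 with h4 | h4 | h4
    · exact Or.inr (Or.inr ⟨h4, ⟨h2, h4⟩, hfe⟩)
    · exact Or.inl ⟨(hW y h1).2 h4, (hW' y h3).1 ((hW y h1).2 h4)⟩
    · exact Or.inr (Or.inl ⟨h4, ⟨h2, h4⟩, hfe⟩)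
  -- If `f` has the same sign on both half balls, `q` is an extremum of the second defining function.
  rcases hup with hup | hup <;> rcases hdn with hdn | hdn
  · refine absurd (Or.inl ?_) hcrit
    filter_upwards [hcase] with y hy
    rw [hΦ'q]
    rcases hy with hy | ⟨-, hy, he⟩ | ⟨-, hy, he⟩
    · exact hy.2.ge
    · rw [← he]; exact (hup _ hy).le
    · rw [← he]; exact (hdn _ hy).le
  · refine ⟨1, Or.inl rfl, ?_⟩
    filter_upwards [hcase] with y hy hyW
    rcases hy with hy | ⟨h1, hy, he⟩ | ⟨h1, hy, he⟩
    · exact absurd hy.1 hyW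
    · rw [← he, Real.sign_of_pos h1, Real.sign_of_pos (hup _ hy), one_mul]
    · rw [← he, Real.sign_of_neg h1, Real.sign_of_neg (hdn _ hy), one_mul]
  · refine ⟨-1, Or.inr rfl, ?_⟩
    filter_upwards [hcase] with y hy hyW
    rcases hy with hy | ⟨h1, hy, he⟩ | ⟨h1, hy, he⟩
    · exact absurd hy.1 hyW
    · rw [← he, Real.sign_of_pos h1, Real.sign_of_neg (hup _ hy)]; norm_num
    · rw [← he, Real.sign_of_neg h1, Real.sign_of_pos (hdn _ hy)]; norm_num
  · refine absurd (Or.inr ?_) hcrit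
    filter_upwards [hcase] with y hy
    rw [hΦ'q]
    rcases hy with hy | ⟨-, hy, he⟩ | ⟨-, hy, he⟩
    · exact hy.2.le
    · rw [← he]; exact (hup _ hy).le
    · rw [← he]; exact (hdn _ hy).le

/-- Side functions on a connected set agree up to one global sign. -/
theorem exists_eq_mul_of_isSideAt (hWd : Dense Wᶜ) {U : Set 𝔼[n + 1]}
    (hUc : IsPreconnected U) (h : ∀ q ∈ U, IsSideAt W σ q)
    (h' : ∀ q ∈ U, IsSideAt W σ' q) :
    ∃ c : ℝ, (c = 1 ∨ c = -1) ∧ ∀ y ∈ U, y ∉ W → σ' y = c * σ y := by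
  let A : ℝ → Set 𝔼[n + 1] := fun c => {y | ∀ᶠ z in 𝓝 y, z ∉ W → σ' z = c * σ z}
  have hAo : ∀ c, IsOpen (A c) := fun c => isOpen_iff_mem_nhds.2 fun y hy => hy.eventually_nhds
  have hcov : U ⊆ A 1 ∪ A (-1) := fun y hy => by
    obtain ⟨c, rfl | rfl, hc⟩ := (h y hy).eventually_eq_mul (h' y hy)
    · exact Or.inl hc
    · exact Or.inr hc
  have hdisj : U ∩ (A 1 ∩ A (-1)) = ∅ := by
    rw [eq_empty_iff_forall_notMem]
    rintro y ⟨hyU, h1, h2⟩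
    obtain ⟨z, ⟨k1, k2, k3⟩, hzW⟩ := hWd.inter_nhds_nonempty
      (Filter.inter_mem h1 (Filter.inter_mem h2 (h y hyU).eventually_eq_or)) |>.imp
        fun z hz => And.intro hz.2 hz.1
    have e1 := k1 hzW
    have e2 := k2 hzW
    rcases k3 hzW with e3 | e3 <;> rw [e3] at e1 e2 <;> linarith
  by_cases h1 : (U ∩ A 1).Nonempty
  · refine ⟨1, Or.inl rfl, fun y hy => ?_⟩
    rcases hcov hy with hy1 | hy1
    · exact hy1.self_of_nhds
    · obtain ⟨z, hz⟩ := hUc _ _ (hAo 1) (hAo (-1)) hcov h1 ⟨y, hy, hy1⟩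
      exact absurd hz (by rw [hdisj]; exact notMem_empty z)
  · refine ⟨-1, Or.inr rfl, fun y hy => ?_⟩
    rcases hcov hy with hy1 | hy1
    · exact absurd ⟨y, hy, hy1⟩ h1
    · exact hy1.self_of_nhds

/-- A side function is not constant near a point of `W`. -/
theorem IsSideAt.not_eventually_eq (h : IsSideAt W σ q) (hq : q ∈ W) (c : ℝ) :
    ¬ ∀ᶠ y in 𝓝 q, y ∉ W → σ y = c := by
  intro hcon
  rcases h with ⟨hq', -⟩ | ⟨-, Φ, a, hΦ, hqs, hW, ha, h⟩
  · exact hq' hq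
  have hq0 : Φ q (Fin.last n) = 0 := (hW q hqs).1 hq
  -- The line through `Φ q` across the hyperplane meets both sides of `W`.
  have hpath : ∀ t : ℝ, (Φ q + t • EuclideanSpace.single (Fin.last n) (1 : ℝ)) (Fin.last n) = t :=
    fun t => by simp [hq0]
  have htend : Filter.Tendsto
      (fun t : ℝ => Φ q + t • EuclideanSpace.single (Fin.last n) (1 : ℝ)) (𝓝 0) (𝓝 (Φ q)) := by
    have : Continuous (fun t : ℝ => Φ q + t • EuclideanSpace.single (Fin.last n) (1 : ℝ)) := by
      fun_prop
    simpa using this.tendsto 0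
  have hsymm : Filter.Tendsto Φ.symm (𝓝 (Φ q)) (𝓝 q) := by
    have := (Φ.continuousAt_symm (Φ.map_source hqs)).tendsto
    rwa [Φ.left_inv hqs] at this
  have hev : ∀ᶠ t in 𝓝 (0 : ℝ), t ≠ 0 → a * Real.sign t = c := by
    filter_upwards [(hsymm.comp htend).eventually (hcon.and h),
      htend.eventually (Φ.open_target.mem_nhds (Φ.map_source hqs))] with t ⟨h1, h2⟩ h3 h4
    simp only [Function.comp_apply] at h1 h2
    have h5 : Φ (Φ.symm (Φ q + t • EuclideanSpace.single (Fin.last n) (1 : ℝ))) (Fin.last n) = t := by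
      rw [Φ.right_inv h3, hpath]
    have h6 : Φ.symm (Φ q + t • EuclideanSpace.single (Fin.last n) (1 : ℝ)) ∉ W := fun hmem => by
      rw [hW _ (Φ.map_target h3), h5] at hmem
      exact h4 hmem
    rw [← h1 h6, h2 h6, h5]
  obtain ⟨ε, hε, hball⟩ := Metric.eventually_nhds_iff.1 hev
  have e1 := hball (y := ε / 2) (by simp [abs_of_pos hε]; linarith) (by positivity)
  have e2 := hball (y := -(ε / 2)) (by simp [abs_of_pos hε]; linarith) (by linarith [hε])
  rw [Real.sign_of_pos (by positivity)] at e1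
  rw [Real.sign_of_neg (by linarith)] at e2
  rcases ha with rfl | rfl <;> linarith

/-- No side function exists around a boundary point: near the boundary, the complement of a
half-hypersurface is connected, so that a side function would be constant. -/
theorem not_eventually_isSideAt (hn : 1 ≤ n) (hWd : Dense Wᶜ)
    {p : 𝔼[n + 1]} (hp : p ∈ hypersurfaceBoundary W) :
    ¬ ∀ᶠ q in 𝓝 p, q ∉ hypersurfaceBoundary W → IsSideAt W σ q := by
  intro hcon
  obtain ⟨Φ, hΦ, hps, hW, hp0⟩ := hp.2.exists_chart
  have hpn : Φ p (Fin.last n) = 0 := ((hW p hps).1 hp.1).1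
  obtain ⟨r, hr, hrt, hrs⟩ := eventually_exists_ball_symm hps hcon
  have hne : Fin.last n ≠ (0 : Fin (n + 1)) := by
    rw [Ne, Fin.ext_iff]; simp; omega
  -- A ball minus the closed half-hyperplane is star-shaped about a point of the hyperplane on the
  -- other side of the edge.
  let S : Set 𝔼[n + 1] := Metric.ball (Φ p) r ∩ {y | ¬ (y (Fin.last n) = 0 ∧ 0 ≤ y 0)}
  have hSb : ∀ t : ℝ, |t| < r → Φ p + t • EuclideanSpace.single 0 (1 : ℝ) ∈ Metric.ball (Φ p) r := by
    intro t ht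
    simpa [norm_smul] using ht
  have hS0 : Φ p + (-(r / 2)) • EuclideanSpace.single 0 (1 : ℝ) ∈ S := by
    refine ⟨hSb _ (by rw [abs_neg, abs_of_pos (half_pos hr)]; linarith), fun h => ?_⟩
    have := h.2
    simp [hp0] at this
    linarith
  have hSs : StarConvex ℝ (Φ p + (-(r / 2)) • EuclideanSpace.single 0 (1 : ℝ)) S := by
    rw [starConvex_iff_forall_pos hS0]
    intro y hy a b ha hb hab
    refine ⟨convex_ball _ _ hS0.1 hy.1 ha.le hb.le hab, fun h => hy.2 ?_⟩
    obtain ⟨h1, h2⟩ := h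
    simp [hpn, hp0, hne, hb.ne'] at h1 h2
    refine ⟨h1, ?_⟩
    by_contra hlt
    nlinarith [mul_pos ha hr, mul_neg_of_pos_of_neg hb (not_le.1 hlt)]
  have hUc : IsPreconnected (Φ.symm '' S) :=
    (hSs.isPathConnected hS0).isConnected.isPreconnected.image _
      (Φ.continuousOn_symm.mono fun y hy => hrt hy.1)
  have hUW : ∀ q ∈ Φ.symm '' S, q ∉ W := by
    rintro _ ⟨y, hy, rfl⟩ hyW
    rw [hW _ (Φ.map_target (hrt hy.1)), Φ.right_inv (hrt hy.1)] at hyW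
    exact hy.2 hyW
  obtain ⟨c, hc, hσ⟩ := exists_eq_mul_of_isSideAt (σ := σ) (σ' := fun _ => 1) hWd hUc
    (by
      rintro q hq
      obtain ⟨y, hy, rfl⟩ := id hq
      exact hrs y hy.1 fun hb => hUW _ hq hb.1)
    (fun q hq => isSideAt_one (hUW q hq))
  -- a point of `W` off the boundary
  set w := Φ p + (r / 2) • EuclideanSpace.single 0 (1 : ℝ) with hw
  have hwb : w ∈ Metric.ball (Φ p) r := hSb _ (by rw [abs_of_pos (half_pos hr)]; linarith)
  have hwn : w (Fin.last n) = 0 := by simp [hw, hpn, hne]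
  have hw0 : 0 < w 0 := by simp [hw, hp0, hr]
  have hq1s : Φ.symm w ∈ Φ.source := Φ.map_target (hrt hwb)
  have hΦq1 : Φ (Φ.symm w) = w := Φ.right_inv (hrt hwb)
  have hq1 : Φ.symm w ∈ W := (hW _ hq1s).2 (by rw [hΦq1]; exact ⟨hwn, hw0.le⟩)
  have hq1b : Φ.symm w ∉ hypersurfaceBoundary W := by
    rintro ⟨-, hb⟩
    obtain ⟨D, hD, hD'⟩ := hΦ.exists_equiv hq1s
    rw [hΦq1] at hD'
    -- the sheet of `W` through this point, parametrized by the inverse chart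
    let J : 𝔼[n] →L[ℝ] 𝔼[n + 1] := graphLinear 0
    have hJ : ∀ y, J y (Fin.last n) = 0 := fun y => by
      rw [← height_apply]; simp [J, graphLinear_apply]
    have hγ : HasFDerivAt (fun y => Φ.symm (w + J y))
        ((D.symm : 𝔼[n + 1] →L[ℝ] 𝔼[n + 1]).comp J) 0 := by
      refine HasFDerivAt.comp (g := Φ.symm) (f := fun y => w + J y) 0 ?_
        (J.hasFDerivAt.const_add w)
      rw [map_zero, add_zero]; exact hD'.hasFDerivAt
    refine not_hasBoundaryChartAt_of_hasFDerivAt hn (γ := fun y => Φ.symm (w + J y)) (x := 0)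
      (by simp) hγ ?_ (e := D.symm (vertical n)) (fun q => ⟨base (D q), height (D q), ?_⟩) hb
    · have hcont : Continuous fun y => w + J y := by fun_prop
      have h1 : ∀ᶠ y in 𝓝 (0 : 𝔼[n]), w + J y ∈ Metric.ball (Φ p) r :=
        hcont.continuousAt.eventually (Metric.isOpen_ball.mem_nhds (by simpa using hwb))
      have h2 : ∀ᶠ y in 𝓝 (0 : 𝔼[n]), 0 < (w + J y) 0 :=
        ((EuclideanSpace.proj (𝕜 := ℝ) (0 : Fin (n + 1))).continuous.comp
          hcont).continuousAt.eventually (lt_mem_nhds (by simpa using hw0))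
      filter_upwards [h1, h2] with y h1 h2
      rw [hW _ (Φ.map_target (hrt h1)), Φ.right_inv (hrt h1)]
      exact ⟨by simp [hwn, hJ], h2.le⟩
    · apply D.injective
      rw [map_add, map_smul]
      simp only [ContinuousLinearMap.comp_apply, ContinuousLinearEquiv.coe_coe,
        D.apply_symm_apply]
      apply ext_base_height <;> simp [J, graphLinear_apply, vertical_eq_lift]
  refine (hrs w hwb hq1b).not_eventually_eq hq1 c ?_
  filter_upwards [Φ.open_source.mem_nhds hq1s, (Φ.continuousAt hq1s).eventually
    (Metric.isOpen_ball.mem_nhds (by rwa [hΦq1]))] with y hys hyb hyW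
  have hyS : y ∈ Φ.symm '' S := ⟨Φ y, ⟨hyb, fun h => hyW ((hW y hys).2 h)⟩, Φ.left_inv hys⟩
  have := hσ y hyS hyW
  rcases hc with rfl | rfl <;> linarith

end Sides

/-! ### A side function propagated along vertical columns -/

section Columns

variable {n : ℕ} {W S : Set 𝔼[n + 1]} {C : Set 𝔼[n]} {s R : ℝ}

/-- The half-infinite vertical column over the ball of radius `ε` around `x`, consisting of the
points with `t < s * height`; it points upwards for `s = 1` and downwards for `s = -1`. -/
def column (s : ℝ) (x : 𝔼[n]) (ε t : ℝ) : Set 𝔼[n + 1] :=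
  {p | dist (base p) x < ε ∧ t < s * height p}

theorem isOpen_column (x : 𝔼[n]) (ε t : ℝ) : IsOpen (column s x ε t) :=
  (isOpen_lt (f := fun p : 𝔼[n + 1] => dist (base p) x) (by fun_prop) continuous_const).inter
    (isOpen_lt (g := fun p : 𝔼[n + 1] => s * height p) continuous_const (by fun_prop))

theorem convex_column (x : 𝔼[n]) (ε t : ℝ) : Convex ℝ (column s x ε t) := by
  have h1 : Convex ℝ (base ⁻¹' Metric.ball x ε : Set 𝔼[n + 1]) :=
    (convex_ball x ε).is_linear_preimage base.isLinear
  have h2 : Convex ℝ {p : 𝔼[n + 1] | t < (s • height (n := n)) p} :=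
    convex_halfSpace_gt (s • height (n := n)).isLinear t
  exact h1.inter h2

/-- `σ` is a side function of `W` on a column, equal to `1` far out on it. -/
def IsColumnSide (W : Set 𝔼[n + 1]) (s R : ℝ) (x : 𝔼[n]) (ε t : ℝ) (σ : 𝔼[n + 1] → ℝ) : Prop :=
  ∀ q ∈ column s x ε t, IsSideAt W σ q ∧ (R < s * height q → σ q = 1)

/-- Side functions on two columns agree on the intersection, because they agree far out. -/
theorem IsColumnSide.eq_of_mem (hs : s = 1 ∨ s = -1) (hWd : Dense Wᶜ)
    (hR : ∀ p ∈ W, |height p| < R) {x x' : 𝔼[n]} {ε ε' t t' : ℝ} {σ σ' : 𝔼[n + 1] → ℝ}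
    (h : IsColumnSide W s R x ε t σ) (h' : IsColumnSide W s R x' ε' t' σ') {q : 𝔼[n + 1]}
    (hq : q ∈ column s x ε t) (hq' : q ∈ column s x' ε' t') (hqW : q ∉ W) : σ' q = σ q := by
  have hss : s * s = 1 := by rcases hs with rfl | rfl <;> norm_num
  obtain ⟨c, -, hcσ⟩ := exists_eq_mul_of_isSideAt hWd
    ((convex_column (s := s) x ε t).inter (convex_column x' ε' t')).isPreconnected
    (fun y hy => (h y hy.1).1) (fun y hy => (h' y hy.2).1)
  -- a point of both columns above `q` and above all of `W`
  set m := max (s * height q) R + 1 with hm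
  have hm1 : s * height q < m := by rw [hm]; linarith [le_max_left (s * height q) R]
  have hm2 : R < m := by rw [hm]; linarith [le_max_right (s * height q) R]
  have hh : s * height (lift (base q) (s * m)) = m := by
    rw [height_lift, ← mul_assoc, hss, one_mul]
  have hp : lift (base q) (s * m) ∈ column s x ε t :=
    ⟨by rw [base_lift]; exact hq.1, by rw [hh]; exact hq.2.trans hm1⟩
  have hp' : lift (base q) (s * m) ∈ column s x' ε' t' :=
    ⟨by rw [base_lift]; exact hq'.1, by rw [hh]; exact hq'.2.trans hm1⟩
  have hpW : lift (base q) (s * m) ∉ W := fun hmem => by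
    have h1 := hR _ hmem
    have h2 : s * height (lift (base q) (s * m)) ≤ |height (lift (base q) (s * m))| := by
      rcases hs with rfl | rfl
      · rw [one_mul]; exact le_abs_self _
      · rw [neg_one_mul]; exact neg_le_abs _
    rw [hh] at h2
    linarith
  have e := hcσ _ ⟨hp, hp'⟩ hpW
  rw [(h _ hp).2 (by rwa [hh]), (h' _ hp').2 (by rwa [hh])] at e
  rw [hcσ q ⟨hq, hq'⟩ hqW, ← mul_one c, ← e]; ring

/-- A side function can be continued along a column as long as it does not meet the boundary. -/
theorem exists_isColumnSide (hs : s = 1 ∨ s = -1) (hWc : IsClosed W) (hWd : Dense Wᶜ)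
    (hR : ∀ p ∈ W, |height p| < R) (hS : ∀ p ∈ W, p ∉ S → HasInteriorChartAt W p)
    (x : 𝔼[n]) (t₀ : ℝ) (hx : ∀ p ∈ S, base p = x → s * height p < t₀) :
    ∃ ε > 0, ∃ t < t₀, ∃ σ, IsColumnSide W s R x ε t σ := by
  have hss : s * s = 1 := by rcases hs with rfl | rfl <;> norm_num
  have hsabs : ∀ a : ℝ, s * a ≤ |a| := fun a => by
    rcases hs with rfl | rfl
    · rw [one_mul]; exact le_abs_self _
    · rw [neg_one_mul]; exact neg_le_abs _
  -- the levels down to which a column around `x` carries a side function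
  let T : Set ℝ := {t | t ≤ R ∧ ∃ ε > 0, ∃ σ, IsColumnSide W s R x ε t σ}
  have hRT : R ∈ T := ⟨le_rfl, 1, one_pos, fun _ => 1, fun q hq =>
    ⟨isSideAt_one fun hmem => by linarith [hR q hmem, hsabs (height q), hq.2], fun _ => rfl⟩⟩
  by_contra! hcon
  have hlb : ∀ t ∈ T, t₀ ≤ t := by
    rintro t ⟨-, ε, hε, σ, h⟩
    by_contra! hlt
    exact hcon ε hε t hlt σ h
  have hbdd : BddBelow T := ⟨t₀, hlb⟩
  set t₁ := sInf T with ht₁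
  have h01 : t₀ ≤ t₁ := le_csInf ⟨R, hRT⟩ hlb
  have h1R : t₁ ≤ R := csInf_le hbdd hRT
  have hh1 : s * height (lift x (s * t₁)) = t₁ := by
    rw [height_lift, ← mul_assoc, hss, one_mul]
  have hqS : lift x (s * t₁) ∉ S := fun h => by
    have := hx _ h (base_lift _ _)
    rw [hh1] at this
    linarith
  obtain ⟨τ, hτ⟩ : ∃ τ, IsSideAt W τ (lift x (s * t₁)) := by
    apply exists_isSideAt
    by_cases h : lift x (s * t₁) ∈ W
    · exact Or.inr (hS _ h hqS)
    · exact Or.inl h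
  obtain ⟨δ, hδ, hbox⟩ : ∃ δ > 0, ∀ q : 𝔼[n + 1], dist (base q) x < δ → |s * height q - t₁| < δ →
      IsSideAt W τ q := by
    obtain ⟨r, hr, hball⟩ := Metric.eventually_nhds_iff.1 (hτ.eventually hWc)
    refine ⟨r / 2, half_pos hr, fun q h1 h2 => hball ?_⟩
    have h3 := norm_sq_eq_base_height (q - lift x (s * t₁))
    rw [map_sub, map_sub, base_lift, height_lift, ← dist_eq_norm, ← dist_eq_norm] at h3
    have h4 : (height q - s * t₁) ^ 2 = (s * height q - t₁) ^ 2 := by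
      rcases hs with rfl | rfl <;> ring
    have h5 : (s * height q - t₁) ^ 2 < (r / 2) ^ 2 := by
      rw [← sq_abs]; exact pow_lt_pow_left₀ h2 (abs_nonneg _) two_ne_zero
    have h6 : dist (base q) x ^ 2 < (r / 2) ^ 2 :=
      pow_lt_pow_left₀ h1 dist_nonneg two_ne_zero
    rw [h4] at h3
    nlinarith [dist_nonneg (x := q) (y := lift x (s * t₁))]
  obtain ⟨t, ⟨htR, ε, hε, σ, hσ⟩, ht⟩ : ∃ t ∈ T, t < t₁ + δ :=
    exists_lt_of_csInf_lt ⟨R, hRT⟩ (by linarith)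
  have htt : t₁ ≤ t := csInf_le hbdd ⟨htR, ε, hε, σ, hσ⟩
  set m := min ε δ with hmdef
  have hm : 0 < m := lt_min hε hδ
  -- the overlap of the column with the box
  let O : Set 𝔼[n + 1] := column s x m t ∩ {p | s * height p < t₁ + δ}
  have hOconv : Convex ℝ O := (convex_column x m t).inter
    (convex_halfSpace_lt (s • height (n := n)).isLinear (t₁ + δ))
  have hOσ : ∀ y ∈ O, IsSideAt W σ y := fun y hy =>
    (hσ y ⟨hy.1.1.trans_le (min_le_left _ _), hy.1.2⟩).1
  have hOτ : ∀ y ∈ O, IsSideAt W τ y := fun y hy => by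
    have hy2 : s * height y < t₁ + δ := hy.2
    refine hbox y (hy.1.1.trans_le (min_le_right _ _)) (abs_lt.2 ⟨?_, by linarith⟩)
    linarith [hy.1.2]
  obtain ⟨c, hc, hcσ⟩ := exists_eq_mul_of_isSideAt hWd hOconv.isPreconnected hOτ hOσ
  have hnew : IsColumnSide W s R x m (t₁ - δ)
      (fun p => if t < s * height p then σ p else c * τ p) := by
    intro q hq
    rcases lt_or_ge t (s * height q) with hlt | hge
    · have hmem : q ∈ column s x ε t := ⟨hq.1.trans_le (min_le_left _ _), hlt⟩
      refine ⟨(hσ q hmem).1.congr ?_, fun h => (if_pos hlt).trans ((hσ q hmem).2 h)⟩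
      filter_upwards [(isOpen_column x ε t).mem_nhds hmem] with y hy _
      rw [if_pos hy.2]
    · refine ⟨?_, fun h => absurd h (by linarith)⟩
      refine ((hbox q (hq.1.trans_le (min_le_right _ _))
        (abs_lt.2 ⟨by linarith [hq.2], by linarith⟩)).const_mul hc).congr ?_
      have hev : ∀ᶠ y in 𝓝 q, s * height y < t₁ + δ :=
        (by fun_prop : Continuous fun y : 𝔼[n + 1] => s * height y).continuousAt.eventually
          (gt_mem_nhds (by linarith))
      filter_upwards [(isOpen_column x m (t₁ - δ)).mem_nhds hq, hev] with y hy1 hy2 hyW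
      split_ifs with h
      · exact hcσ y ⟨⟨hy1.1, h⟩, hy2⟩ hyW
      · rfl
  have := csInf_le hbdd (show t₁ - δ ∈ T from ⟨by linarith, m, hm, _, hnew⟩)
  linarith

/-- The side functions of all columns patch together: there is a side function of `W` on all
points from which the boundary is not visible in the direction `s`. -/
theorem exists_isSideAt_of_columns (hs : s = 1 ∨ s = -1) (hWc : IsClosed W) (hWd : Dense Wᶜ)
    (hR : ∀ p ∈ W, |height p| < R) (hS : ∀ p ∈ W, p ∉ S → HasInteriorChartAt W p)
    (hC : IsClosed C) (hWC : ∀ p ∈ W, base p ∈ C) :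
    ∃ σ : 𝔼[n + 1] → ℝ, (∀ q, σ q = 1 ∨ σ q = -1) ∧
      (∀ q, (∀ p ∈ S, base p = base q → s * height p < s * height q) → IsSideAt W σ q) ∧
      (∀ q, R < s * height q → σ q = 1) ∧ ∀ q, base q ∉ C → σ q = 1 := by
  classical
  have hsabs : ∀ a : ℝ, s * a ≤ |a| := fun a => by
    rcases hs with rfl | rfl
    · rw [one_mul]; exact le_abs_self _
    · rw [neg_one_mul]; exact neg_le_abs _
  -- The value at `q` is read off from any column through `q`; off `W` the choice does not matter.
  let σ₀ : 𝔼[n + 1] → ℝ := fun q =>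
    if ∃ x ε t σ, IsColumnSide W s R x ε t σ ∧ q ∈ column s x ε t ∧ σ q = 1 then 1 else -1
  have hone : ∀ {q x ε t σ}, IsColumnSide W s R x ε t σ → q ∈ column s x ε t → σ q = 1 →
      σ₀ q = 1 := fun h1 h2 h3 => if_pos ⟨_, _, _, _, h1, h2, h3⟩
  have hpatch : ∀ {q x ε t σ}, IsColumnSide W s R x ε t σ → q ∈ column s x ε t → q ∉ W →
      σ₀ q = σ q := by
    intro q x ε t σ h1 h2 h3
    rcases (h1 q h2).1.eventually_eq_or.self_of_nhds h3 with h4 | h4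
    · rw [hone h1 h2 h4, h4]
    · rw [h4]
      refine if_neg ?_
      rintro ⟨x', ε', t', σ', k1, k2, k3⟩
      rw [h1.eq_of_mem hs hWd hR k1 h2 k2 h3, h4] at k3
      norm_num at k3
  refine ⟨σ₀, fun q => ?_, fun q hq => ?_, fun q hq => ?_, fun q hq => ?_⟩
  · simp only [σ₀]; split_ifs
    · exact Or.inl rfl
    · exact Or.inr rfl
  · obtain ⟨ε, hε, t, ht, σ, hσ⟩ := exists_isColumnSide hs hWc hWd hR hS (base q) _ hq
    have hmem : q ∈ column s (base q) ε t := ⟨by rwa [dist_self], ht⟩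
    refine (hσ q hmem).1.congr ?_
    filter_upwards [(isOpen_column _ _ _).mem_nhds hmem] with y hy hyW
    exact hpatch hσ hy hyW
  · refine hone (x := base q) (ε := 1) (t := R) (σ := fun _ => 1) (fun y hy => ?_)
      ⟨by rw [dist_self]; exact one_pos, hq⟩ rfl
    exact ⟨isSideAt_one fun hmem => by linarith [hR y hmem, hsabs (height y), hy.2], fun _ => rfl⟩
  · obtain ⟨ε, hε, hball⟩ := Metric.isOpen_iff.1 hC.isOpen_compl (base q) hq
    refine hone (x := base q) (ε := ε) (t := s * height q - 1) (σ := fun _ => 1) (fun y hy => ?_)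
      ⟨by rwa [dist_self], by linarith⟩ rfl
    exact ⟨isSideAt_one fun hmem => hball hy.1 (hWC y hmem), fun _ => rfl⟩

end Columns

/-! ### The region between a graph and a competitor -/

/-- `W` is a compact hypersurface in the closed cylinder over `C` with the same boundary as the
graph `M` of `u` over `C`. -/
structure IsCompetitor {n : ℕ} (C : Set 𝔼[n]) (u : 𝔼[n] → ℝ) (M W : Set 𝔼[n + 1]) : Prop extends
    IsGraphHypersurface C u M where
  one_le : 1 ≤ n
  nonempty : C.Nonempty
  isPreconnected : IsPreconnected (interior C)
  fderiv_le : ∃ L, ∀ x ∈ interior C, ‖fderiv ℝ u x‖ ≤ L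
  compact_competitor : IsCompact W
  hypersurface_competitor : IsHypersurface W
  base_mem : ∀ p ∈ W, base p ∈ C
  boundary_eq : hypersurfaceBoundary M = hypersurfaceBoundary W

/-- `F` counts, with sign, how often the region between the graph `M` and the competitor `W` covers
a point: it vanishes far away and off the cylinder, it jumps by one across `W`, and it jumps by one
upwards across the part of `M` over the interior of `C`. -/
structure IsFilling {n : ℕ} (C : Set 𝔼[n]) (u : 𝔼[n] → ℝ) (M W : Set 𝔼[n + 1]) (R : ℝ)
    (F : 𝔼[n + 1] → ℝ) : Prop where
  abs_le_one : ∀ q, |F q| ≤ 1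
  eq_zero_of_base : ∀ q, base q ∉ C → F q = 0
  eq_zero_of_height : ∀ q, R < |height q| → F q = 0
  eventually_of_mem : ∀ q, base q ∈ interior C → ∃ σ, IsSideAt W σ q ∧ ∀ᶠ y in 𝓝 q, y ∉ W →
    y ∉ M → F y = (Real.sign (height y - u (base y)) - σ y) / 2
  eventually_of_notMem : ∀ q, q ∉ hypersurfaceBoundary M → base q ∉ interior C →
    ∃ σ a b, IsSideAt W σ q ∧ |b| = 1 / 2 ∧ ∀ᶠ y in 𝓝 q, y ∉ W → F y = a + b * σ y

namespace IsGraphHypersurface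

variable {n : ℕ} {C : Set 𝔼[n]} {u : 𝔼[n] → ℝ} {M : Set 𝔼[n + 1]}

theorem eventually_lt_height (h : IsGraphHypersurface C u M) {q : 𝔼[n + 1]} (hq : base q ∈ C)
    (hlt : u (base q) < height q) : ∀ᶠ y in 𝓝 q, base y ∈ C → u (base y) < height y := by
  have h1 : Filter.Tendsto (fun y => height y - u (base y)) (𝓝[base ⁻¹' C] q)
      (𝓝 (height q - u (base q))) :=
    (height.continuous.tendsto q).mono_left nhdsWithin_le_nhds |>.sub
      ((h.continuousOn (base q) hq).tendsto.comp
        ((base.continuous.continuousWithinAt).tendsto_nhdsWithin fun y hy => hy))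
  have h2 := h1.eventually (lt_mem_nhds (sub_pos.2 hlt))
  rw [eventually_nhdsWithin_iff] at h2
  filter_upwards [h2] with y h3 h4
  exact sub_pos.1 (h3 h4)

theorem eventually_height_lt (h : IsGraphHypersurface C u M) {q : 𝔼[n + 1]} (hq : base q ∈ C)
    (hlt : height q < u (base q)) : ∀ᶠ y in 𝓝 q, base y ∈ C → height y < u (base y) := by
  have h1 : Filter.Tendsto (fun y => u (base y) - height y) (𝓝[base ⁻¹' C] q)
      (𝓝 (u (base q) - height q)) :=
    ((h.continuousOn (base q) hq).tendsto.comp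
        ((base.continuous.continuousWithinAt).tendsto_nhdsWithin fun y hy => hy)).sub
      ((height.continuous.tendsto q).mono_left nhdsWithin_le_nhds)
  have h2 := h1.eventually (lt_mem_nhds (sub_pos.2 hlt))
  rw [eventually_nhdsWithin_iff] at h2
  filter_upwards [h2] with y h3 h4
  exact sub_pos.1 (h3 h4)

theorem lt_or_gt_of_notMem (h : IsGraphHypersurface C u M) {q : 𝔼[n + 1]}
    (hq : q ∉ M) (hqC : base q ∈ C) : u (base q) < height q ∨ height q < u (base q) := by
  rcases lt_trichotomy (u (base q)) (height q) with h1 | h1 | h1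
  · exact Or.inl h1
  · exact absurd (h.mem_iff.2 ⟨hqC, h1.symm⟩) hq
  · exact Or.inr h1

end IsGraphHypersurface

namespace IsCompetitor

variable {n : ℕ} {C : Set 𝔼[n]} {u : 𝔼[n] → ℝ} {M W : Set 𝔼[n + 1]}

theorem isClosed_competitor (h : IsCompetitor C u M W) : IsClosed W :=
  h.compact_competitor.isClosed

theorem dense_compl (h : IsCompetitor C u M W) : Dense Wᶜ :=
  dense_compl_of_volume_eq_zero h.hypersurface_competitor.volume_eq_zero

theorem hasInteriorChartAt (h : IsCompetitor C u M W) {p : 𝔼[n + 1]} (hp : p ∈ W)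
    (hpS : p ∉ hypersurfaceBoundary M) : HasInteriorChartAt W p :=
  (h.hypersurface_competitor p hp).resolve_right fun hb => hpS (by
    rw [h.boundary_eq]; exact ⟨hp, hb⟩)

/-- The side functions of `W` continued from above and from below. They are opposite over the
interior of `C`, since otherwise they would patch to a side function around the boundary. -/
theorem exists_sides (h : IsCompetitor C u M W) {R : ℝ} (hR : ∀ p ∈ W, |height p| < R) :
    ∃ σ₁ σ₂ : 𝔼[n + 1] → ℝ, (∀ q, σ₁ q = 1 ∨ σ₁ q = -1) ∧ (∀ q, σ₂ q = 1 ∨ σ₂ q = -1) ∧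
      (∀ q, (base q ∈ C → base q ∉ interior C → u (base q) < height q) → IsSideAt W σ₁ q) ∧
      (∀ q, (base q ∈ C → base q ∉ interior C → height q < u (base q)) → IsSideAt W σ₂ q) ∧
      (∀ q, R < height q → σ₁ q = 1) ∧ (∀ q, R < -height q → σ₂ q = 1) ∧
      (∀ q, base q ∉ C → σ₁ q = 1 ∧ σ₂ q = 1) ∧
      ∀ q, base q ∈ interior C → q ∉ W → σ₂ q = -σ₁ q := by
  have hcC : IsClosed C := h.compact.isClosed
  have hSint : ∀ p ∈ W, p ∉ hypersurfaceBoundary M → HasInteriorChartAt W p := fun p =>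
    h.hasInteriorChartAt
  obtain ⟨σ₁, hval₁, hside₁, hfar₁, hoff₁⟩ := exists_isSideAt_of_columns (Or.inl rfl)
    h.isClosed_competitor h.dense_compl hR hSint hcC h.base_mem
  obtain ⟨σ₂, hval₂, hside₂, hfar₂, hoff₂⟩ := exists_isSideAt_of_columns (Or.inr rfl)
    h.isClosed_competitor h.dense_compl hR hSint hcC h.base_mem
  have hs₁ : ∀ q, (base q ∈ C → base q ∉ interior C → u (base q) < height q) →
      IsSideAt W σ₁ q := fun q hq => hside₁ q fun p hp hpq => by
    obtain ⟨h1, h2⟩ := (h.mem_boundary_iff h.one_le).1 hp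
    have h3 := h.mem_iff.1 h1
    rw [one_mul, one_mul, h3.2, hpq]
    rw [hpq] at h3 h2
    exact hq h3.1 h2
  have hs₂ : ∀ q, (base q ∈ C → base q ∉ interior C → height q < u (base q)) →
      IsSideAt W σ₂ q := fun q hq => hside₂ q fun p hp hpq => by
    obtain ⟨h1, h2⟩ := (h.mem_boundary_iff h.one_le).1 hp
    have h3 := h.mem_iff.1 h1
    rw [neg_one_mul, neg_one_mul, h3.2, hpq]
    rw [hpq] at h3 h2
    exact neg_lt_neg (hq h3.1 h2)
  refine ⟨σ₁, σ₂, hval₁, hval₂, hs₁, hs₂, fun q hq => hfar₁ q (by rwa [one_mul]),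
    fun q hq => hfar₂ q (by rwa [neg_one_mul]), fun q hq => ⟨hoff₁ q hq, hoff₂ q hq⟩, ?_⟩
  have hpre : IsPreconnected (base ⁻¹' interior C : Set 𝔼[n + 1]) := by
    have h1 : (base ⁻¹' interior C : Set 𝔼[n + 1]) =
        (fun y : 𝔼[n] × ℝ => lift y.1 y.2) '' (interior C ×ˢ univ) := by
      ext p
      constructor
      · exact fun hp => ⟨(base p, height p), ⟨hp, mem_univ _⟩, lift_base_height p⟩
      · rintro ⟨y, hy, rfl⟩
        change base (lift y.1 y.2) ∈ interior C
        rw [base_lift]; exact hy.1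
    rw [h1]
    exact (h.isPreconnected.prod isPreconnected_univ).image _ continuous_lift.continuousOn
  obtain ⟨c, rfl | rfl, hc⟩ := exists_eq_mul_of_isSideAt h.dense_compl hpre
    (fun q hq => hs₁ q fun _ hni => absurd hq hni)
    (fun q hq => hs₂ q fun _ hni => absurd hq hni)
  swap
  · intro q hq hqW
    rw [hc q hq hqW, neg_one_mul]
  exfalso
  classical
  obtain ⟨p, hp⟩ := h.boundary_nonempty h.one_le h.nonempty
  rw [h.boundary_eq] at hp
  -- If the two functions agree over the interior, use the one from below only under the boundary.
  refine not_eventually_isSideAt (σ := fun q => if base q ∈ C ∧ base q ∉ interior C ∧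
    height q < u (base q) then σ₂ q else σ₁ q) h.one_le h.dense_compl hp
    (Filter.Eventually.of_forall fun q hqS => ?_)
  rw [← h.boundary_eq] at hqS
  by_cases hqC : base q ∈ C
  swap
  · refine (hs₁ q fun h1 => absurd h1 hqC).congr ?_
    filter_upwards [(hcC.isOpen_compl.preimage base.continuous).mem_nhds hqC] with y hy _
    exact if_neg fun hcon => hy hcon.1
  by_cases hqi : base q ∈ interior C
  · refine (hs₁ q fun _ h1 => absurd hqi h1).congr ?_
    filter_upwards [(isOpen_interior.preimage base.continuous).mem_nhds hqi] with y hy _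
    exact if_neg fun hcon => hcon.2.1 hy
  have hqM : q ∉ M := fun hqM => hqS ((h.mem_boundary_iff h.one_le).2 ⟨hqM, hqi⟩)
  rcases h.lt_or_gt_of_notMem hqM hqC with hlt | hlt
  · refine (hs₁ q fun _ _ => hlt).congr ?_
    filter_upwards [h.eventually_lt_height hqC hlt] with y hy _
    exact if_neg fun hcon => hcon.2.2.not_gt (hy hcon.1)
  · refine (hs₂ q fun _ _ => hlt).congr ?_
    filter_upwards [h.eventually_height_lt hqC hlt] with y hy hyW
    split_ifs with hcon
    · rfl
    · by_cases hyC : base y ∈ C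
      · have hyi : base y ∈ interior C := by
          by_contra hyi
          exact hcon ⟨hyC, hyi, hy hyC⟩
        rw [hc y hyi hyW, one_mul]
      · rw [hoff₁ y hyC, hoff₂ y hyC]

/-- The filling is `(1 - σ₁) / 2` above the graph and `(σ₂ - 1) / 2` below it, where `σ₁` and `σ₂` are
the side functions continued from above and from below. -/
theorem exists_filling (h : IsCompetitor C u M W) {R : ℝ} (hR : ∀ p ∈ W, |height p| < R)
    (hRM : ∀ p ∈ M, |height p| < R) : ∃ F, IsFilling C u M W R F := by
  classical
  have hcC : IsClosed C := h.compact.isClosed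
  obtain ⟨σ₁, σ₂, hv₁, hv₂, hs₁, hs₂, hf₁, hf₂, hoff, hopp⟩ := h.exists_sides hR
  have hoff' : ∀ q, base q ∉ C → (if u (base q) < height q then (1 - σ₁ q) / 2
      else (σ₂ q - 1) / 2) = 0 := fun q hq => by
    rw [(hoff q hq).1, (hoff q hq).2]; simp
  refine ⟨fun q => if u (base q) < height q then (1 - σ₁ q) / 2 else (σ₂ q - 1) / 2,
    fun q => ?_, hoff', fun q hq => ?_, fun q hq => ⟨σ₁, hs₁ q fun _ hni => absurd hq hni, ?_⟩,
    fun q hqS hqi => ?_⟩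
  · rcases hv₁ q with h1 | h1 <;> rcases hv₂ q with h2 | h2 <;> rw [h1, h2] <;> split_ifs <;>
      norm_num
  · by_cases hqC : base q ∈ C
    swap
    · exact hoff' q hqC
    have hu := hRM (lift (base q) (u (base q))) (h.mem_iff.2 (by simpa using hqC))
    rw [height_lift] at hu
    have hu' := abs_lt.1 hu
    split_ifs with hlt
    · have : R < height q := by
        rcases lt_abs.1 hq with h1 | h1
        · exact h1
        · linarith
      rw [hf₁ q this]; norm_num
    · have : R < -height q := by
        rcases lt_abs.1 hq with h1 | h1
        · linarith
        · exact h1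
      rw [hf₂ q this]; norm_num
  · filter_upwards [(isOpen_interior.preimage base.continuous).mem_nhds hq] with y hy hyW hyM
    rcases h.lt_or_gt_of_notMem hyM (interior_subset hy) with hlt | hlt
    · rw [if_pos hlt, Real.sign_of_pos (sub_pos.2 hlt)]
    · rw [if_neg hlt.not_gt, Real.sign_of_neg (sub_neg.2 hlt), hopp y hy hyW]; ring
  · by_cases hqC : base q ∈ C
    swap
    · refine ⟨σ₁, 1 / 2, -1 / 2, hs₁ q fun h1 => absurd h1 hqC, by norm_num, ?_⟩
      filter_upwards [(hcC.isOpen_compl.preimage base.continuous).mem_nhds hqC] with y hy _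
      rw [hoff' y hy, (hoff y hy).1]; norm_num
    have hqM : q ∉ M := fun hqM => hqS ((h.mem_boundary_iff h.one_le).2 ⟨hqM, hqi⟩)
    rcases h.lt_or_gt_of_notMem hqM hqC with hlt | hlt
    · refine ⟨σ₁, 1 / 2, -1 / 2, hs₁ q fun _ _ => hlt, by norm_num [abs_div], ?_⟩
      filter_upwards [h.eventually_lt_height hqC hlt] with y hy _
      by_cases hyC : base y ∈ C
      · rw [if_pos (hy hyC)]; ring
      · rw [hoff' y hyC, (hoff y hyC).1]; norm_num
    · refine ⟨σ₂, -1 / 2, 1 / 2, hs₂ q fun _ _ => hlt, by norm_num, ?_⟩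
      filter_upwards [h.eventually_height_lt hqC hlt] with y hy _
      by_cases hyC : base y ∈ C
      · rw [if_neg (hy hyC).not_gt]; ring
      · rw [hoff' y hyC, (hoff y hyC).2]; norm_num

end IsCompetitor

/-! ### The flux through the two hypersurfaces -/

theorem divergence_eq_zero {m : ℕ} {Y : 𝔼[m] → 𝔼[m]} {p : 𝔼[m]} (hp : p ∉ tsupport Y) :
    divergence Y p = 0 := by
  have h : fderiv ℝ Y p = 0 := by
    by_contra hne
    exact hp (support_fderiv_subset ℝ hne)
  simp [divergence, h]

/-- A hyperplane direction is the horizontal one after an isometry. -/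
theorem exists_isometry_last_eq_inner {n : ℕ} {ν : 𝔼[n + 1]} (hν : ‖ν‖ = 1) :
    ∃ T : 𝔼[n + 1] ≃ₗᵢ[ℝ] 𝔼[n + 1], ∀ v, height (T v) = inner ℝ ν v := by
  have ho : Orthonormal ℝ (({Fin.last n} : Set (Fin (n + 1))).domRestrict fun _ => ν) := by
    refine ⟨fun _ => hν, fun i j hij => absurd (Subsingleton.elim i j) hij⟩
  obtain ⟨b, hb⟩ := ho.exists_orthonormalBasis_extension_of_card_eq (by simp)
  refine ⟨b.repr, fun v => ?_⟩
  rw [height_apply, b.repr_apply_apply, hb _ (mem_singleton _)]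

/-- The flux of a field through `W` near `q ∈ W`, expressed by a side function, is controlled by the
normal component of the field: in coordinates whose last axis is the normal of `W` at `q`, the
hypersurface is a graph with small gradient. -/
theorem IsSideAt.exists_flux_bound {n : ℕ} {W : Set 𝔼[n + 1]} {σ : 𝔼[n + 1] → ℝ} {q : 𝔼[n + 1]}
    (h : IsSideAt W σ q) (hq : q ∈ W) (hW0 : volume W = 0) :
    ∃ (Φ : OpenPartialHomeomorph 𝔼[n + 1] 𝔼[n + 1]) (ν : 𝔼[n + 1]), IsC1Diffeo Φ ∧
      q ∈ Φ.source ∧ (∀ y ∈ Φ.source, y ∈ W ↔ Φ y (Fin.last n) = 0) ∧ ‖ν‖ = 1 ∧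
      (∀ v, fderiv ℝ (fun y => Φ y (Fin.last n)) q v = 0 ↔ inner ℝ ν v = 0) ∧
      ∀ ε > 0, ∃ U ∈ 𝓝 q, ∀ Y : 𝔼[n + 1] → 𝔼[n + 1], ContDiff ℝ 1 Y → HasCompactSupport Y →
        tsupport Y ⊆ U → ENNReal.ofReal |∫ p, σ p * divergence Y p| ≤
          2 * ∫⁻ p in W, ENNReal.ofReal (|inner ℝ ν (Y p)| + ε * ‖Y p‖)
            ∂(Measure.euclideanHausdorffMeasure n) := by
  rcases h with ⟨hq', -⟩ | ⟨-, Φ, c, hΦ, hqs, hW, hc, hσ⟩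
  · exact absurd hq hq'
  obtain ⟨D, hD, -⟩ := hΦ.exists_equiv hqs
  set ℓ : 𝔼[n + 1] →L[ℝ] ℝ := fderiv ℝ (fun y => Φ y (Fin.last n)) q with hℓ
  set N : 𝔼[n + 1] := (InnerProductSpace.toDual ℝ 𝔼[n + 1]).symm ℓ with hN
  have hNℓ : ∀ v, ℓ v = inner ℝ N v := fun v => by
    rw [hN, InnerProductSpace.toDual_symm_apply]
  have hN0 : 0 < ‖N‖ := norm_pos_iff.2 fun h0 => by
    have h1 := hNℓ (D.symm (EuclideanSpace.single (Fin.last n) 1))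
    rw [h0, inner_zero_left, hℓ, fderiv_chart_coord hD, D.apply_symm_apply] at h1
    simp at h1
  set ν : 𝔼[n + 1] := ‖N‖⁻¹ • N with hν
  have hν1 : ‖ν‖ = 1 := by
    rw [hν, norm_smul, norm_inv, norm_norm, inv_mul_cancel₀ hN0.ne']
  have hℓν : ∀ v, ℓ v = ‖N‖ * inner ℝ ν v := fun v => by
    rw [hNℓ, hν, real_inner_smul_left, ← mul_assoc, mul_inv_cancel₀ hN0.ne', one_mul]
  refine ⟨Φ, ν, hΦ, hqs, hW, hν1, fun v => by rw [hℓν]; simp [hN0.ne'], fun ε hε => ?_⟩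
  obtain ⟨T, hT⟩ := exists_isometry_last_eq_inner hν1
  set A : 𝔼[n + 1] ≃L[ℝ] 𝔼[n] × ℝ := T.toContinuousLinearEquiv.trans (splitEquiv n) with hA
  have hA2 : ∀ v, (A v).2 = inner ℝ ν v := hT
  have hA1 : ∀ v, ‖(A v).1‖ ≤ ‖v‖ := fun v => (norm_base_le (T v)).trans (T.norm_map v).le
  have hAm : MeasurePreserving A := (measurePreserving_splitEquiv n).comp T.measurePreserving
  -- `W` is the graph of `g` in the coordinates `A`
  have hf : ContDiffAt ℝ 1 (fun w => Φ (A.symm w) (Fin.last n)) (A q) := by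
    refine ContDiffAt.comp (g := fun y => Φ y (Fin.last n)) (A q) ?_ A.symm.contDiff.contDiffAt
    rw [A.symm_apply_apply]
    exact (EuclideanSpace.proj (𝕜 := ℝ) (Fin.last n)).contDiff.contDiffAt.comp q
      (hΦ.contDiffAt hqs)
  have hfd : ∀ v, fderiv ℝ (fun w => Φ (A.symm w) (Fin.last n)) (A q) v = ‖N‖ * v.2 := fun v => by
    have h1 : HasFDerivAt (fun y => Φ y (Fin.last n)) ℓ (A.symm (A q)) := by
      rw [A.symm_apply_apply]
      exact (hasStrictFDerivAt_coord hD (Fin.last n)).hasFDerivAt.differentiableAt.hasFDerivAt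
    have h2 := HasFDerivAt.comp (g := fun y => Φ y (Fin.last n)) (f := A.symm) (A q) h1
      A.symm.hasFDerivAt
    have h3 : fderiv ℝ (fun w => Φ (A.symm w) (Fin.last n)) (A q) = _ := h2.fderiv
    rw [h3]
    change ℓ (A.symm v) = _
    rw [hℓν, ← hA2, A.apply_symm_apply]
  obtain ⟨g, hg, -, hsign, hgd⟩ := exists_implicit_graph hf
    (by rw [A.symm_apply_apply]; exact (hW q hqs).1 hq) (by rw [hfd]; simpa using hN0)
  have hg0 : fderiv ℝ g (A q).1 = 0 := by
    ext v
    have := hgd v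
    rw [hfd] at this
    simpa [hN0.ne'] using this
  have hgs : ∀ᶠ p in 𝓝 q, ‖fderiv ℝ g (A p).1‖ ≤ ε := by
    have h1 : Continuous fun p => ‖fderiv ℝ g (A p).1‖ := by
      have := hg.continuous_fderiv one_ne_zero
      fun_prop
    have h2 : ‖fderiv ℝ g (A q).1‖ < ε := by simpa [hg0] using hε
    exact ((h1.tendsto q).eventually (gt_mem_nhds h2)).mono fun p hp => le_of_lt hp
  have hsign' : ∀ᶠ p in 𝓝 q, Real.sign (Φ p (Fin.last n)) =
      Real.sign ((A p).2 - g (A p).1) := by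
    filter_upwards [A.continuous.continuousAt.eventually hsign] with p hp
    rw [← hp, A.symm_apply_apply]
  obtain ⟨U, hU, hUo, hqU⟩ := eventually_nhds_iff.1
    (hgs.and (hsign'.and (hσ.and (Φ.open_source.mem_nhds hqs))))
  refine ⟨U, hUo.mem_nhds hqU, fun Y hY hYc hYU => ?_⟩
  have h1 : ∫ p, σ p * divergence Y p =
      c * ∫ p, Real.sign ((A p).2 - g (A p).1) * divergence Y p := by
    rw [← integral_const_mul]
    refine integral_congr_ae ?_
    filter_upwards [measure_eq_zero_iff_ae_notMem.1 hW0] with p hp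
    by_cases hpY : p ∈ tsupport Y
    · obtain ⟨-, h2, h3, -⟩ := hU p (hYU hpY)
      rw [h3 hp, h2, mul_assoc]
    · simp [divergence_eq_zero hpY]
  set γ : 𝔼[n] → 𝔼[n + 1] := fun y => A.symm (y, g y) with hγ
  have hγc : Continuous γ := by
    have := hg.continuous
    fun_prop
  have hAγ : ∀ y, A (γ y) = (y, g y) := fun y => A.apply_symm_apply _
  rw [h1, integral_sign_mul_divergence A hAm hg hY hYc]
  have h2 : |c * (-2 * ∫ y, ((A (Y (γ y))).2 - fderiv ℝ g y (A (Y (γ y))).1))| =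
      2 * ‖∫ y, ((A (Y (γ y))).2 - fderiv ℝ g y (A (Y (γ y))).1)‖ := by
    rw [abs_mul, abs_mul, Real.norm_eq_abs]
    rcases hc with rfl | rfl <;> norm_num
  rw [h2, ENNReal.ofReal_mul zero_le_two, ENNReal.ofReal_ofNat]
  gcongr
  rw [← setIntegral_eq_integral_of_forall_compl_eq_zero (s := γ ⁻¹' U) (fun y hy => by
    have : Y (γ y) = 0 := by
      by_contra hne
      exact hy (hYU (subset_tsupport _ hne))
    simp [this])]
  rw [ofReal_norm]
  refine (enorm_integral_le_lintegral_enorm _).trans ?_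
  refine le_trans ?_ (setLIntegral_section_le (pr := fun p => (A p).1) (B := γ ⁻¹' U)
    (LipschitzWith.of_dist_le_mul fun p p' => ?_) hγc.measurable (fun y _ => by rw [hAγ])
    (fun y hy => ?_) ?_)
  · refine setLIntegral_mono_ae' (hUo.preimage hγc).measurableSet (ae_of_all _ fun y hy => ?_)
    rw [← ofReal_norm]
    refine ENNReal.ofReal_le_ofReal ((norm_sub_le _ _).trans ?_)
    rw [hA2, Real.norm_eq_abs]
    refine add_le_add_right ?_ _
    refine (ContinuousLinearMap.le_opNorm _ _).trans ?_
    have h3 := (hU (γ y) hy).1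
    rw [hAγ] at h3
    exact mul_le_mul h3 (hA1 _) (norm_nonneg _) hε.le
  · rw [NNReal.coe_one, one_mul, dist_eq_norm, dist_eq_norm, ← Prod.fst_sub, ← map_sub]
    exact hA1 _
  · obtain ⟨-, h2, -, h4⟩ := hU (γ y) hy
    refine (hW _ h4).2 ?_
    rw [hAγ, sub_self, Real.sign_zero, Real.sign_eq_zero_iff] at h2
    exact h2
  · have := hY.continuous
    exact (ENNReal.continuous_ofReal.comp (by fun_prop)).measurable

theorem integral_const_mul_divergence {n : ℕ} (a : ℝ) {Y : 𝔼[n + 1] → 𝔼[n + 1]}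
    (hY : ContDiff ℝ 1 Y) (hc : HasCompactSupport Y) : ∫ p, a * divergence Y p = 0 := by
  have hi : ∀ i : Fin (n + 1), ∫ p, fderiv ℝ (fun q => Y q i) p (EuclideanSpace.single i 1) = 0 :=
    fun i => integral_fderiv_apply_eq_zero (by fun_prop) (hc.comp_left
      (g := fun y : 𝔼[n + 1] => y i) (by simp)) _
  have hdiv : ∀ p, divergence Y p =
      ∑ i, fderiv ℝ (fun q => Y q i) p (EuclideanSpace.single i 1) := fun p =>
    Finset.sum_congr rfl fun i _ => (fderiv_coord (hY.differentiable one_ne_zero p) i _).symm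
  rw [integral_const_mul]
  simp only [hdiv]
  rw [integral_finsetSum, Finset.sum_eq_zero fun i _ => hi i, mul_zero]
  intro i _
  have hYi : ContDiff ℝ 1 fun q => Y q i := by fun_prop
  exact ((hYi.continuous_fderiv one_ne_zero).clm_apply
    continuous_const).integrable_of_hasCompactSupport ((hc.comp_left
      (g := fun y : 𝔼[n + 1] => y i) (by simp)).fderiv_apply ℝ _)

/-- The flux of `Y` through the graph of `u` over the interior of `C`, plus the integral of its
divergence against `F`. If `F` is the filling between the graph and a competitor, this is the flux
through the competitor, written without an integral over the competitor. -/
def flux {n : ℕ} (F : 𝔼[n + 1] → ℝ) (C : Set 𝔼[n]) (u : 𝔼[n] → ℝ) (Y : 𝔼[n + 1] → 𝔼[n + 1]) : ℝ :=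
  (∫ p, F p * divergence Y p) + ∫ x in interior C,
    (height (Y (graphMap u x)) - fderiv ℝ u x (base (Y (graphMap u x))))

section Flux

variable {n : ℕ} {C : Set 𝔼[n]} {u : 𝔼[n] → ℝ} {M W : Set 𝔼[n + 1]} {R : ℝ} {F : 𝔼[n + 1] → ℝ}
  {Y Z : 𝔼[n + 1] → 𝔼[n + 1]}

theorem IsGraphHypersurface.volume_eq_zero (h : IsGraphHypersurface C u M) : volume M = 0 :=
  h.hypersurface.volume_eq_zero

theorem IsSideAt.eventually_eq_of_notMem {σ : 𝔼[n + 1] → ℝ} {q : 𝔼[n + 1]} (h : IsSideAt W σ q)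
    (hq : q ∉ W) : ∃ c : ℝ, (c = 1 ∨ c = -1) ∧ ∀ᶠ y in 𝓝 q, y ∉ W → σ y = c := by
  rcases h with ⟨-, h⟩ | ⟨hq', -⟩
  · exact h
  · exact absurd hq' hq

theorem IsFilling.aestronglyMeasurable (hF : IsFilling C u M W R F) (h : IsCompetitor C u M W) :
    AEStronglyMeasurable F := by
  have hcl : IsClosed (W ∪ M) := h.isClosed_competitor.union h.isCompact.isClosed
  have h0 : volume (W ∪ M) = 0 :=
    measure_union_null h.hypersurface_competitor.volume_eq_zero h.volume_eq_zero
  have hc : ContinuousOn F (W ∪ M)ᶜ := by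
    intro q hq
    have hqW : q ∉ W := fun h' => hq (Or.inl h')
    have hqM : q ∉ M := fun h' => hq (Or.inr h')
    have hnear : ∀ᶠ y in 𝓝 q, y ∉ W ∧ y ∉ M := by
      filter_upwards [hcl.isOpen_compl.mem_nhds hq] with y hy
      exact ⟨fun h' => hy (Or.inl h'), fun h' => hy (Or.inr h')⟩
    suffices hs : ∃ k : ℝ, ∀ᶠ y in 𝓝 q, F y = k by
      obtain ⟨k, hk⟩ := hs
      exact (continuousAt_const.congr (hk.mono fun y hy => hy.symm)).continuousWithinAt
    by_cases hqi : base q ∈ interior C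
    · obtain ⟨σ, hσ, hev⟩ := hF.eventually_of_mem q hqi
      obtain ⟨c, -, hc⟩ := hσ.eventually_eq_of_notMem hqW
      have hbase := (isOpen_interior.preimage base.continuous).mem_nhds hqi
      rcases h.lt_or_gt_of_notMem hqM (interior_subset hqi) with hlt | hlt
      · refine ⟨(1 - c) / 2, ?_⟩
        filter_upwards [hnear, hev, hc, hbase,
          h.eventually_lt_height (interior_subset hqi) hlt] with y h1 h2 h3 h4 h5
        rw [h2 h1.1 h1.2, h3 h1.1, Real.sign_of_pos (sub_pos.2 (h5 (interior_subset h4)))]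
      · refine ⟨(-1 - c) / 2, ?_⟩
        filter_upwards [hnear, hev, hc, hbase,
          h.eventually_height_lt (interior_subset hqi) hlt] with y h1 h2 h3 h4 h5
        rw [h2 h1.1 h1.2, h3 h1.1, Real.sign_of_neg (sub_neg.2 (h5 (interior_subset h4)))]
    · obtain ⟨σ, a, b, hσ, -, hev⟩ := hF.eventually_of_notMem q (fun h' => hqM h'.1) hqi
      obtain ⟨c, -, hc⟩ := hσ.eventually_eq_of_notMem hqW
      refine ⟨a + b * c, ?_⟩
      filter_upwards [hnear, hev, hc] with y h1 h2 h3
      rw [h2 h1.1, h3 h1.1]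
  have h1 := hc.aestronglyMeasurable (μ := volume) hcl.isOpen_compl.measurableSet
  have h2 : ∀ᵐ p, p ∈ (W ∪ M)ᶜ := measure_eq_zero_iff_ae_notMem.1 h0
  rwa [Measure.restrict_eq_self_of_ae_mem h2] at h1

theorem IsFilling.integrable_mul (hF : IsFilling C u M W R F) (h : IsCompetitor C u M W)
    {f : 𝔼[n + 1] → ℝ} (hf : Integrable f) : Integrable fun p => F p * f p :=
  hf.bdd_mul (hF.aestronglyMeasurable h) (Filter.Eventually.of_forall fun p => by
    rw [Real.norm_eq_abs]; exact hF.abs_le_one p)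

theorem IsCompetitor.integrableOn_graph_flux (h : IsCompetitor C u M W) (hY : Continuous Y)
    (hc : HasCompactSupport Y) : IntegrableOn
      (fun x => height (Y (graphMap u x)) - fderiv ℝ u x (base (Y (graphMap u x))))
      (interior C) := by
  obtain ⟨B, hB⟩ := hY.bounded_above_of_compact_support hc
  obtain ⟨L, hL⟩ := h.fderiv_le
  have hYg : ContinuousOn (fun x => Y (graphMap u x)) (interior C) :=
    hY.comp_continuousOn (h.continuousOn_graphMap.mono interior_subset)
  have hcont : ContinuousOn
      (fun x => height (Y (graphMap u x)) - fderiv ℝ u x (base (Y (graphMap u x))))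
      (interior C) :=
    (height.continuous.comp_continuousOn hYg).sub
      ((h.contDiffOn.continuousOn_fderiv_of_isOpen isOpen_interior le_rfl).clm_apply
        (base.continuous.comp_continuousOn hYg))
  have hfin : volume (interior C) < ⊤ :=
    (measure_mono interior_subset).trans_lt h.compact.measure_lt_top
  have : IsFiniteMeasure (volume.restrict (interior C)) := ⟨by simpa using hfin⟩
  refine Integrable.of_bound (hcont.aestronglyMeasurable isOpen_interior.measurableSet)
    (B + L * B) ?_
  refine (ae_restrict_mem isOpen_interior.measurableSet).mono fun x hx => ?_
  have h1 := hB (graphMap u x)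
  refine (norm_sub_le _ _).trans (add_le_add ((abs_height_le _).trans h1) ?_)
  exact (ContinuousLinearMap.le_opNorm _ _).trans (mul_le_mul (hL x hx)
    ((norm_base_le _).trans h1) (norm_nonneg _) ((norm_nonneg _).trans (hL x hx)))

theorem divergence_add (hY : ContDiff ℝ 1 Y) (hZ : ContDiff ℝ 1 Z) (p : 𝔼[n + 1]) :
    divergence (fun p => Y p + Z p) p = divergence Y p + divergence Z p := by
  unfold divergence
  rw [← Finset.sum_add_distrib]
  refine Finset.sum_congr rfl fun i _ => ?_
  rw [fderiv_fun_add (hY.differentiable one_ne_zero p) (hZ.differentiable one_ne_zero p)]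
  rfl

theorem IsFilling.flux_add (hF : IsFilling C u M W R F) (h : IsCompetitor C u M W)
    (hY : ContDiff ℝ 1 Y) (hYc : HasCompactSupport Y) (hZ : ContDiff ℝ 1 Z)
    (hZc : HasCompactSupport Z) :
    flux F C u (fun p => Y p + Z p) = flux F C u Y + flux F C u Z := by
  unfold flux
  have e1 : ∀ p, F p * divergence (fun p => Y p + Z p) p =
      F p * divergence Y p + F p * divergence Z p := fun p => by
    rw [divergence_add hY hZ, mul_add]
  have e2 : ∀ x, height (Y (graphMap u x) + Z (graphMap u x)) -
      fderiv ℝ u x (base (Y (graphMap u x) + Z (graphMap u x))) =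
      (height (Y (graphMap u x)) - fderiv ℝ u x (base (Y (graphMap u x)))) +
      (height (Z (graphMap u x)) - fderiv ℝ u x (base (Z (graphMap u x)))) := fun x => by
    rw [map_add, map_add, map_add]; ring
  simp only [e1, e2]
  rw [integral_add (hF.integrable_mul h (integrable_divergence hY hYc))
    (hF.integrable_mul h (integrable_divergence hZ hZc)),
    integral_add (h.integrableOn_graph_flux hY.continuous hYc)
      (h.integrableOn_graph_flux hZ.continuous hZc)]
  ring

/-- Away from the boundary, the flux is locally given by a side function of `W`: the jump of the
filling across the graph cancels the integral over the graph. -/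
theorem IsFilling.exists_flux_eq (hF : IsFilling C u M W R F) (h : IsCompetitor C u M W)
    {q : 𝔼[n + 1]} (hq : q ∉ hypersurfaceBoundary M) : ∃ σ b, IsSideAt W σ q ∧ |b| = 1 / 2 ∧
      ∃ U ∈ 𝓝 q, ∀ Y : 𝔼[n + 1] → 𝔼[n + 1], ContDiff ℝ 1 Y → HasCompactSupport Y →
        tsupport Y ⊆ U → flux F C u Y = b * ∫ p, σ p * divergence Y p := by
  have hW0 := measure_eq_zero_iff_ae_notMem.1 h.hypersurface_competitor.volume_eq_zero
  have hM0 := measure_eq_zero_iff_ae_notMem.1 h.volume_eq_zero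
  by_cases hqi : base q ∈ interior C
  · obtain ⟨σ, hσ, hev⟩ := hF.eventually_of_mem q hqi
    refine ⟨σ, -1 / 2, hσ, by norm_num [abs_div], ?_⟩
    obtain ⟨g, hg, hgu⟩ := exists_contDiff_eventuallyEq
      (h.contDiffOn.contDiffAt (isOpen_interior.mem_nhds hqi))
    have hgood : ∀ᶠ x in 𝓝 (base q), g =ᶠ[𝓝 x] u ∧ x ∈ interior C := by
      filter_upwards [hgu.eventually_nhds, isOpen_interior.mem_nhds hqi] with x h1 h2
      exact ⟨h1, h2⟩
    refine ⟨_, hev.and (base.continuous.continuousAt.eventually hgood), fun Y hY hYc hYU => ?_⟩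
    have hsm : Measurable fun p : 𝔼[n + 1] => height p - g (base p) := by
      have := hg.continuous
      exact Continuous.measurable (by fun_prop)
    have hi1 := integrable_sign_mul hsm (integrable_divergence hY hYc)
    have hi2 := hF.integrable_mul h (integrable_divergence hY hYc)
    have e1 : ∫ p, σ p * divergence Y p = ∫ p, (Real.sign (height p - g (base p)) *
        divergence Y p - 2 * (F p * divergence Y p)) := by
      refine integral_congr_ae ?_
      filter_upwards [hW0, hM0] with p hpW hpM
      by_cases hpY : p ∈ tsupport Y
      · have h1 := hYU hpY
        have h2 : g (base p) = u (base p) := h1.2.1.self_of_nhds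
        rw [h1.1 hpW hpM, h2]; ring
      · simp [divergence_eq_zero hpY]
    have e2 : ∫ x in interior C, (height (Y (graphMap u x)) -
        fderiv ℝ u x (base (Y (graphMap u x)))) =
        ∫ x, (height (Y (lift x (g x))) - fderiv ℝ g x (base (Y (lift x (g x))))) := by
      rw [← integral_indicator isOpen_interior.measurableSet]
      -- off the domain where `g` agrees with `u`, the field vanishes on the whole vertical line
      refine integral_congr_ae (ae_of_all _ fun x => ?_)
      by_cases hx : g =ᶠ[𝓝 x] u ∧ x ∈ interior C
      · dsimp only
        rw [indicator_of_mem hx.2, hx.1.fderiv_eq, hx.1.self_of_nhds, graphMap_eq_lift]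
      · have h0 : ∀ t, Y (lift x t) = 0 := fun t => by
          by_contra hne
          have h1 := (hYU (subset_tsupport _ hne)).2
          rw [base_lift] at h1
          exact hx h1
        simp [h0, graphMap_eq_lift, indicator]
    have e3 := integral_sign_mul_divergence (splitEquiv n) (measurePreserving_splitEquiv n) hg hY hYc
    unfold flux
    rw [e1, integral_sub hi1 (hi2.const_mul 2), integral_const_mul, e2]
    simp only [splitEquiv_apply] at e3
    rw [e3]
    change _ + ∫ x, (height (Y (lift x (g x))) - fderiv ℝ g x (base (Y (lift x (g x))))) =
      -1 / 2 * (-2 * (∫ x, (height (Y (lift x (g x))) - fderiv ℝ g x (base (Y (lift x (g x)))))) -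
        2 * _)
    ring
  · obtain ⟨σ, a, b, hσ, hb, hev⟩ := hF.eventually_of_notMem q hq hqi
    have hqM : q ∉ M := fun hqM => hq ((h.mem_boundary_iff h.one_le).2 ⟨hqM, hqi⟩)
    refine ⟨σ, b, hσ, hb, _, hev.and (h.isCompact.isClosed.isOpen_compl.mem_nhds hqM),
      fun Y hY hYc hYU => ?_⟩
    have e1 : b * ∫ p, σ p * divergence Y p =
        ∫ p, (F p * divergence Y p - a * divergence Y p) := by
      rw [← integral_const_mul]
      refine integral_congr_ae ?_
      filter_upwards [hW0] with p hpW
      by_cases hpY : p ∈ tsupport Y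
      · rw [(hYU hpY).1 hpW]; ring
      · simp [divergence_eq_zero hpY]
    have e2 : ∫ x in interior C, (height (Y (graphMap u x)) -
        fderiv ℝ u x (base (Y (graphMap u x)))) = 0 := by
      refine setIntegral_eq_zero_of_forall_eq_zero fun x hx => ?_
      have h0 : Y (graphMap u x) = 0 := by
        by_contra hne
        refine (hYU (subset_tsupport _ hne)).2 ?_
        rw [h.eq_image]; exact ⟨x, interior_subset hx, rfl⟩
      simp [h0]
    unfold flux
    rw [e2, e1, integral_sub (hF.integrable_mul h (integrable_divergence hY hYc))
      ((integrable_divergence hY hYc).const_mul a), integral_const_mul_divergence a hY hYc]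
    ring

/-- The local flux bound with the normal component at a point of `W` off the boundary. -/
theorem IsFilling.exists_flux_le_normal (hF : IsFilling C u M W R F) (h : IsCompetitor C u M W)
    {q : 𝔼[n + 1]} (hq : q ∉ hypersurfaceBoundary M) (hqW : q ∈ W) :
    ∃ (Φ : OpenPartialHomeomorph 𝔼[n + 1] 𝔼[n + 1]) (ν : 𝔼[n + 1]), IsC1Diffeo Φ ∧
      q ∈ Φ.source ∧ (∀ y ∈ Φ.source, y ∈ W ↔ Φ y (Fin.last n) = 0) ∧ ‖ν‖ = 1 ∧
      (∀ v, fderiv ℝ (fun y => Φ y (Fin.last n)) q v = 0 ↔ inner ℝ ν v = 0) ∧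
      ∀ ε > 0, ∃ U ∈ 𝓝 q, ∀ Y : 𝔼[n + 1] → 𝔼[n + 1], ContDiff ℝ 1 Y → HasCompactSupport Y →
        tsupport Y ⊆ U → ENNReal.ofReal |flux F C u Y| ≤
          ∫⁻ p in W, ENNReal.ofReal (|inner ℝ ν (Y p)| + ε * ‖Y p‖)
            ∂(Measure.euclideanHausdorffMeasure n) := by
  obtain ⟨σ, b, hσ, hb, U, hU, hUY⟩ := hF.exists_flux_eq h hq
  obtain ⟨Φ, ν, h1, h2, h3, h4, h5, h6⟩ := hσ.exists_flux_bound hqW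
    h.hypersurface_competitor.volume_eq_zero
  refine ⟨Φ, ν, h1, h2, h3, h4, h5, fun ε hε => ?_⟩
  obtain ⟨V, hV, hVY⟩ := h6 ε hε
  refine ⟨U ∩ V, Filter.inter_mem hU hV, fun Y hY hYc hYU => ?_⟩
  rw [hUY Y hY hYc (hYU.trans inter_subset_left), abs_mul, hb, ENNReal.ofReal_mul (by norm_num)]
  refine (mul_le_mul_right (hVY Y hY hYc (hYU.trans inter_subset_right)) _).trans ?_
  have e : ENNReal.ofReal (1 / 2) * 2 = 1 := by
    rw [← ENNReal.ofReal_ofNat 2, ← ENNReal.ofReal_mul (by norm_num)]; norm_num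
  rw [← mul_assoc, e, one_mul]

theorem IsFilling.exists_flux_le (hF : IsFilling C u M W R F) (h : IsCompetitor C u M W)
    {q : 𝔼[n + 1]} (hq : q ∉ hypersurfaceBoundary M) {ε : ℝ} (hε : 0 < ε) :
    ∃ U ∈ 𝓝 q, ∀ Y : 𝔼[n + 1] → 𝔼[n + 1], ContDiff ℝ 1 Y → HasCompactSupport Y →
      tsupport Y ⊆ U → ENNReal.ofReal |flux F C u Y| ≤ ENNReal.ofReal (1 + ε) *
        ∫⁻ p in W, ENNReal.ofReal ‖Y p‖ ∂(Measure.euclideanHausdorffMeasure n) := by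
  by_cases hqW : q ∈ W
  · obtain ⟨Φ, ν, -, -, -, hν, -, h6⟩ := hF.exists_flux_le_normal h hq hqW
    obtain ⟨U, hU, hUY⟩ := h6 ε hε
    refine ⟨U, hU, fun Y hY hYc hYU => (hUY Y hY hYc hYU).trans ?_⟩
    rw [← lintegral_const_mul' _ _ ENNReal.ofReal_ne_top]
    refine lintegral_mono fun p => ?_
    rw [← ENNReal.ofReal_mul (by positivity)]
    refine ENNReal.ofReal_le_ofReal ?_
    have := abs_real_inner_le_norm ν (Y p)
    rw [hν, one_mul] at this
    linarith
  · obtain ⟨σ, b, hσ, hb, U, hU, hUY⟩ := hF.exists_flux_eq h hq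
    obtain ⟨c, -, hc⟩ := hσ.eventually_eq_of_notMem hqW
    refine ⟨U ∩ {y | y ∉ W → σ y = c}, Filter.inter_mem hU hc, fun Y hY hYc hYU => ?_⟩
    have e1 : ∫ p, σ p * divergence Y p = ∫ p, c * divergence Y p := by
      refine integral_congr_ae ?_
      filter_upwards [measure_eq_zero_iff_ae_notMem.1
        h.hypersurface_competitor.volume_eq_zero] with p hpW
      by_cases hpY : p ∈ tsupport Y
      · have h2 : p ∉ W → σ p = c := (hYU hpY).2
        rw [h2 hpW]
      · simp [divergence_eq_zero hpY]
    rw [hUY Y hY hYc (hYU.trans inter_subset_left), e1, integral_const_mul_divergence c hY hYc]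
    simp

end Flux

/-! ### Subsets of codimension two -/

section CodimensionTwo

variable {n : ℕ}

theorem volume_slab_le (hn : 1 ≤ n) {w : 𝔼[n + 1]} (h0 : w 0 = 0) (hl : w (Fin.last n) = 0)
    {r a : ℝ} (hr : 0 ≤ r) (ha : 0 ≤ a) :
    volume {y ∈ Metric.ball w r | |y 0| ≤ a ∧ |y (Fin.last n)| ≤ a} ≤
      ENNReal.ofReal (4 * (2 * r) ^ (n - 1) * a ^ 2) := by
  classical
  have hne : (0 : Fin (n + 1)) ≠ Fin.last n := by
    rw [Ne, Fin.ext_iff]; simp; omega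
  let l : Fin (n + 1) → ℝ := fun i => if i = 0 ∨ i = Fin.last n then a else r
  have hsub : {y ∈ Metric.ball w r | |y 0| ≤ a ∧ |y (Fin.last n)| ≤ a} ⊆
      (WithLp.ofLp : 𝔼[n + 1] → _) ⁻¹' Set.pi univ fun i => Icc (w i - l i) (w i + l i) := by
    rintro y ⟨hy, hy0, hyl⟩ i -
    have h1 : |y i - w i| ≤ l i := by
      simp only [l]
      split_ifs with h
      · rcases h with rfl | rfl
        · rwa [h0, sub_zero]
        · rwa [hl, sub_zero]
      · rw [mem_ball_iff_norm] at hy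
        exact ((PiLp.norm_apply_le (y - w) i).trans hy.le)
    rw [abs_le] at h1
    exact ⟨by linarith [h1.1], by linarith [h1.2]⟩
  have hcard : (Finset.univ.filter fun i : Fin (n + 1) => i = 0 ∨ i = Fin.last n).card = 2 := by
    rw [show (Finset.univ.filter fun i : Fin (n + 1) => i = 0 ∨ i = Fin.last n) =
      {0, Fin.last n} by ext i; simp]
    exact Finset.card_pair hne
  have hcard' : (Finset.univ.filter fun i : Fin (n + 1) => ¬(i = 0 ∨ i = Fin.last n)).card =
      n - 1 := by
    have := Finset.card_filter_add_card_filter_not (s := (Finset.univ : Finset (Fin (n + 1))))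
      (fun i => i = 0 ∨ i = Fin.last n)
    rw [hcard, Finset.card_univ, Fintype.card_fin] at this
    omega
  refine (measure_mono hsub).trans ?_
  rw [(PiLp.volume_preserving_ofLp (Fin (n + 1))).measure_preimage
    (MeasurableSet.univ_pi fun i => measurableSet_Icc).nullMeasurableSet, volume_pi_pi]
  simp only [Real.volume_Icc]
  rw [← ENNReal.ofReal_prod_of_nonneg fun i _ => by
    simp only [l]; split_ifs <;> linarith]
  refine ENNReal.ofReal_le_ofReal (le_of_eq ?_)
  have : ∀ i, w i + l i - (w i - l i) = if i = 0 ∨ i = Fin.last n then 2 * a else 2 * r :=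
    fun i => by simp only [l]; split_ifs <;> ring
  simp only [this]
  rw [Finset.prod_ite, Finset.prod_const, Finset.prod_const, hcard, hcard']
  ring

/-- Near a point where two coordinates of a chart vanish, the set where they are at most `a` has
volume `O(a ^ 2)`, and the coordinates have bounded gradients. -/
theorem exists_volume_slab_le (hn : 1 ≤ n) {Φ : OpenPartialHomeomorph 𝔼[n + 1] 𝔼[n + 1]}
    (hΦ : IsC1Diffeo Φ) {q : 𝔼[n + 1]} (hq : q ∈ Φ.source) (h0 : Φ q 0 = 0)
    (hl : Φ q (Fin.last n) = 0) : ∃ U ∈ 𝓝 q, U ⊆ Φ.source ∧ ∃ V L : ℝ, 0 ≤ V ∧ 0 ≤ L ∧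
      (∀ a : ℝ, 0 ≤ a → volume {p ∈ U | |Φ p 0| ≤ a ∧ |Φ p (Fin.last n)| ≤ a} ≤
        ENNReal.ofReal (V * a ^ 2)) ∧
      ∀ p ∈ U, ∀ i, ‖fderiv ℝ (fun y => Φ y i) p‖ ≤ L := by
  obtain ⟨K, t, ht, hK⟩ := (hΦ.contDiffAt_symm hq).exists_lipschitzOnWith
  obtain ⟨r, hr, hball⟩ := Metric.mem_nhds_iff.1 ht
  have hci : ∀ i, ContDiffAt ℝ 1 (fun y => Φ y i) q := fun i =>
    (EuclideanSpace.proj (𝕜 := ℝ) i).contDiff.contDiffAt.comp q (hΦ.contDiffAt hq)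
  have hgrad : ∀ i, ∀ᶠ p in 𝓝 q, ‖fderiv ℝ (fun y => Φ y i) p‖ ≤
      ∑ j, (‖fderiv ℝ (fun y => Φ y j) q‖ + 1) := fun i => by
    have h1 : ContinuousAt (fun p => ‖fderiv ℝ (fun y => Φ y i) p‖) q :=
      ((hci i).continuousAt_fderiv one_ne_zero).norm
    filter_upwards [h1.eventually (gt_mem_nhds (lt_add_one _))] with p hp
    refine hp.le.trans (Finset.single_le_sum
      (f := fun j => ‖fderiv ℝ (fun y => Φ y j) q‖ + 1) (fun j _ => by positivity)
      (Finset.mem_univ i))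
  refine ⟨Φ.source ∩ Φ ⁻¹' Metric.ball (Φ q) r ∩
    {p | ∀ i, ‖fderiv ℝ (fun y => Φ y i) p‖ ≤ ∑ j, (‖fderiv ℝ (fun y => Φ y j) q‖ + 1)},
    Filter.inter_mem (Filter.inter_mem (Φ.open_source.mem_nhds hq)
      ((Φ.continuousAt hq).preimage_mem_nhds (Metric.ball_mem_nhds _ hr)))
      (Filter.eventually_all.2 hgrad), fun p hp => hp.1.1,
    (K : ℝ) ^ (n + 1) * (4 * (2 * r) ^ (n - 1)), _, by positivity,
    Finset.sum_nonneg fun j _ => by positivity, fun a ha => ?_, fun p hp => hp.2⟩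
  have hsub : {p ∈ Φ.source ∩ Φ ⁻¹' Metric.ball (Φ q) r ∩ {p | ∀ i, ‖fderiv ℝ (fun y => Φ y i) p‖ ≤
      ∑ j, (‖fderiv ℝ (fun y => Φ y j) q‖ + 1)} | |Φ p 0| ≤ a ∧ |Φ p (Fin.last n)| ≤ a} ⊆
      Φ.symm '' {y ∈ Metric.ball (Φ q) r | |y 0| ≤ a ∧ |y (Fin.last n)| ≤ a} := by
    rintro p ⟨hp, hpa⟩
    exact ⟨Φ p, ⟨hp.1.2, hpa⟩, Φ.left_inv hp.1.1⟩
  refine (measure_mono hsub).trans ?_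
  have h1 := (hK.mono (s := {y ∈ Metric.ball (Φ q) r | |y 0| ≤ a ∧ |y (Fin.last n)| ≤ a})
    fun y hy => hball hy.1).euclideanHausdorffMeasure_image_le (n + 1)
  rw [EuclideanSpace.euclideanHausdorffMeasure_eq_volume] at h1
  refine h1.trans ((mul_le_mul_right (volume_slab_le hn h0 hl hr.le ha) _).trans (le_of_eq ?_))
  rw [← ENNReal.ofReal_coe_nnreal, ← ENNReal.ofReal_pow (by positivity),
    ← ENNReal.ofReal_mul (by positivity), ← mul_assoc]

/-- A set that lies in the common zero set of two coordinates of a `C¹` chart near each of its points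
has no `n`-dimensional measure. -/
theorem euclideanHausdorffMeasure_eq_zero_of_codim_two (hn : 1 ≤ n) {S : Set 𝔼[n + 1]}
    (hS : ∀ p ∈ S, ∃ Φ : OpenPartialHomeomorph 𝔼[n + 1] 𝔼[n + 1], IsC1Diffeo Φ ∧ p ∈ Φ.source ∧
      ∀ q ∈ Φ.source, q ∈ S → Φ q 0 = 0 ∧ Φ q (Fin.last n) = 0) :
    (Measure.euclideanHausdorffMeasure n : Measure 𝔼[n + 1]) S = 0 := by
  refine measure_null_of_locally_null S fun p hp => ?_
  obtain ⟨Φ, hΦ, hps, h⟩ := hS p hp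
  obtain ⟨K, t, ht, hK⟩ := (hΦ.contDiffAt_symm hps).exists_lipschitzOnWith
  refine ⟨S ∩ (Φ.source ∩ Φ ⁻¹' t), Filter.inter_mem self_mem_nhdsWithin
    (mem_nhdsWithin_of_mem_nhds (Filter.inter_mem (Φ.open_source.mem_nhds hps)
      ((Φ.continuousAt hps).preimage_mem_nhds ht))), ?_⟩
  have hsub : S ∩ (Φ.source ∩ Φ ⁻¹' t) ⊆
      Φ.symm '' (t ∩ {y | y 0 = 0 ∧ y (Fin.last n) = 0}) := by
    rintro q ⟨hqS, hqs, hqt⟩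
    exact ⟨Φ q, ⟨hqt, h q hqs hqS⟩, Φ.left_inv hqs⟩
  -- the codimension two plane is an isometric image of a hyperplane of `ℝ^n`
  have hplane : (Measure.euclideanHausdorffMeasure n : Measure 𝔼[n + 1])
      {y | y 0 = 0 ∧ y (Fin.last n) = 0} = 0 := by
    have h1 : {y : 𝔼[n + 1] | y 0 = 0 ∧ y (Fin.last n) = 0} ⊆
        (fun x => lift x 0) '' {x : 𝔼[n] | x ⟨0, hn⟩ = 0} := by
      rintro y ⟨hy0, hyl⟩
      refine ⟨base y, ?_, ext_base_height (base_lift _ _) ?_⟩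
      · change base y ⟨0, hn⟩ = 0
        rw [base_apply]; exact hy0
      · rw [height_lift, height_apply, hyl]
    have h2 : LipschitzWith 1 fun x : 𝔼[n] => lift x 0 := by
      refine LipschitzWith.of_dist_le_mul fun x y => le_of_eq ?_
      rw [NNReal.coe_one, one_mul, dist_eq_norm, dist_eq_norm]
      have h3 := norm_sq_eq_base_height (lift x 0 - lift y 0)
      rw [map_sub, map_sub, base_lift, base_lift, height_lift, height_lift] at h3
      rw [← abs_norm, ← abs_norm (x - y), ← sq_eq_sq_iff_abs_eq_abs, h3]; ring
    have h3 := (h2.lipschitzOnWith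
      (s := {x : 𝔼[n] | x ⟨0, hn⟩ = 0})).euclideanHausdorffMeasure_image_le n
    rw [EuclideanSpace.euclideanHausdorffMeasure_eq_volume, volume_coord_eq_zero, mul_zero] at h3
    exact measure_mono_null h1 (le_antisymm h3 zero_le)
  refine measure_mono_null hsub (le_antisymm ?_ zero_le)
  refine ((hK.mono inter_subset_left).euclideanHausdorffMeasure_image_le n).trans ?_
  rw [measure_mono_null inter_subset_right hplane, mul_zero]

end CodimensionTwo

section Cutoff

variable {n : ℕ}

theorem norm_divergence_le {m : ℕ} (Y : 𝔼[m] → 𝔼[m]) (p : 𝔼[m]) :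
    ‖divergence Y p‖ ≤ m * ‖fderiv ℝ Y p‖ := by
  unfold divergence
  refine (norm_sum_le _ _).trans ?_
  calc ∑ i, ‖fderiv ℝ Y p (EuclideanSpace.single i 1) i‖ ≤ ∑ _i : Fin m, ‖fderiv ℝ Y p‖ := by
        refine Finset.sum_le_sum fun i _ => (PiLp.norm_apply_le _ i).trans ?_
        refine (ContinuousLinearMap.le_opNorm _ _).trans (le_of_eq ?_)
        simp
    _ = m * ‖fderiv ℝ Y p‖ := by simp

/-- A set of codimension two can be cut out of a vector field at arbitrarily small cost: the cutoff
functions have gradient `O(m)` on a set of volume `O(m ^ (-2))`. -/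
theorem exists_cutoff_codim_two (hn : 1 ≤ n) {Φ : OpenPartialHomeomorph 𝔼[n + 1] 𝔼[n + 1]}
    (hΦ : IsC1Diffeo Φ) {q : 𝔼[n + 1]} (hq : q ∈ Φ.source) (h0 : Φ q 0 = 0)
    (hl : Φ q (Fin.last n) = 0) : ∃ U ∈ 𝓝 q, U ⊆ Φ.source ∧ ∀ Z : 𝔼[n + 1] → 𝔼[n + 1],
      ContDiff ℝ 1 Z → HasCompactSupport Z → tsupport Z ⊆ U →
      ∃ η : ℕ → 𝔼[n + 1] → ℝ, (∀ k p, η k p ∈ Icc (0 : ℝ) 1) ∧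
        (∀ k, ContDiff ℝ 1 fun p => η k p • Z p) ∧
        (∀ k, ∀ p ∈ Φ.source, Φ p 0 = 0 → Φ p (Fin.last n) = 0 → ∀ᶠ y in 𝓝 p, η k y = 0) ∧
        (∀ p, ¬(Φ p 0 = 0 ∧ Φ p (Fin.last n) = 0) → ∀ᶠ k in Filter.atTop, η k p = 1) ∧
        Filter.Tendsto (fun k => ∫ p, ‖divergence (fun p => (1 - η k p) • Z p) p‖)
          Filter.atTop (𝓝 0) := by
  obtain ⟨U, hU, hUs, V, L, hV, hL, hvol, hgrad⟩ := exists_volume_slab_le hn hΦ hq h0 hl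
  refine ⟨U, hU, hUs, fun Z hZ hZc hZU => ?_⟩
  let G : ℝ → ℝ := fun s => Real.smoothTransition (s - 1)
  have hG : ContDiff ℝ 1 G := Real.smoothTransition.contDiff.comp (contDiff_id.sub contDiff_const)
  have hG0 : ∀ s < 1, G s = 0 := fun s hs =>
    Real.smoothTransition.zero_of_nonpos (by linarith)
  have hG1 : ∀ s, 2 ≤ s → G s = 1 := fun s hs =>
    Real.smoothTransition.one_of_one_le (by linarith)
  obtain ⟨K, hK⟩ := (isCompact_Icc (a := (0 : ℝ)) (b := 2)).exists_bound_of_continuousOn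
    (hG.continuous_deriv le_rfl).continuousOn
  have hK0 : 0 ≤ K := (norm_nonneg _).trans (hK 0 (by norm_num))
  obtain ⟨B₀, hB₀⟩ := hZ.continuous.bounded_above_of_compact_support hZc
  obtain ⟨B₁, hB₁⟩ := (hZ.continuous_fderiv one_ne_zero).bounded_above_of_compact_support
    (hZc.fderiv ℝ)
  have hB₀0 : 0 ≤ B₀ := (norm_nonneg _).trans (hB₀ 0)
  have hB₁0 : 0 ≤ B₁ := (norm_nonneg _).trans (hB₁ 0)
  let ρ : 𝔼[n + 1] → ℝ := fun p => Φ p 0 ^ 2 + Φ p (Fin.last n) ^ 2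
  have hρ0 : ∀ p, 0 ≤ ρ p := fun p => by positivity
  have hci : ∀ p ∈ Φ.source, ∀ i, ContDiffAt ℝ 1 (fun y => Φ y i) p := fun p hp i =>
    (EuclideanSpace.proj (𝕜 := ℝ) i).contDiff.contDiffAt.comp p (hΦ.contDiffAt hp)
  have hρc : ∀ p ∈ Φ.source, ContDiffAt ℝ 1 ρ p := fun p hp =>
    ((hci p hp 0).pow 2).add ((hci p hp (Fin.last n)).pow 2)
  have hρd : ∀ p ∈ U, ‖fderiv ℝ ρ p‖ ≤ 2 * (|Φ p 0| + |Φ p (Fin.last n)|) * L := by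
    intro p hp
    have h1 : ∀ i, HasFDerivAt (fun y => Φ y i ^ 2)
        ((2 * Φ p i) • fderiv ℝ (fun y => Φ y i) p) p := fun i => by
      have h2 := (((hci p (hUs hp) i).differentiableAt one_ne_zero).hasFDerivAt).pow 2
      simpa using h2
    have h3 : fderiv ℝ ρ p = _ := ((h1 0).add (h1 (Fin.last n))).fderiv
    rw [h3]
    refine (norm_add_le _ _).trans ?_
    rw [norm_smul, norm_smul, Real.norm_eq_abs, Real.norm_eq_abs, abs_mul, abs_mul, abs_two]
    nlinarith [mul_le_mul_of_nonneg_left (hgrad p hp 0) (abs_nonneg (Φ p 0)),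
      mul_le_mul_of_nonneg_left (hgrad p hp (Fin.last n)) (abs_nonneg (Φ p (Fin.last n)))]
  -- The cutoff changes where the distance to the set is comparable to `1 / (k + 1)`.
  let η : ℕ → 𝔼[n + 1] → ℝ := fun k p => G (ρ p * ((k : ℝ) + 1) ^ 2)
  have hηc : ∀ k, ∀ p ∈ Φ.source, ContDiffAt ℝ 1 (η k) p := fun k p hp =>
    hG.contDiffAt.comp p ((hρc p hp).mul contDiffAt_const)
  have hη01 : ∀ k p, η k p ∈ Icc (0 : ℝ) 1 := fun k p =>
    ⟨Real.smoothTransition.nonneg _, Real.smoothTransition.le_one _⟩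
  have hnear : ∀ {p}, p ∉ tsupport Z → Z =ᶠ[𝓝 p] 0 := fun hp =>
    notMem_tsupport_iff_eventuallyEq.1 hp
  refine ⟨η, hη01, fun k => contDiff_iff_contDiffAt.2 fun p => ?_, fun k p hp hp0 hpl => ?_,
    fun p hp => ?_, ?_⟩
  · by_cases hpZ : p ∈ tsupport Z
    · exact (hηc k p (hUs (hZU hpZ))).smul hZ.contDiffAt
    · refine (contDiffAt_const (c := (0 : 𝔼[n + 1]))).congr_of_eventuallyEq ?_
      filter_upwards [hnear hpZ] with y hy
      rw [hy]; simp
  · have h1 : ContinuousAt (fun y => ρ y * ((k : ℝ) + 1) ^ 2) p :=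
      (hρc p hp).continuousAt.mul continuousAt_const
    have h2 : ρ p * ((k : ℝ) + 1) ^ 2 < 1 := by simp [ρ, hp0, hpl]
    filter_upwards [h1.eventually (gt_mem_nhds h2)] with y hy
    exact hG0 _ hy
  · have hpos : 0 < ρ p := by
      refine lt_of_le_of_ne (hρ0 p) fun h => hp ?_
      have h1 : Φ p 0 ^ 2 + Φ p (Fin.last n) ^ 2 = 0 := h.symm
      exact ⟨by nlinarith [sq_nonneg (Φ p 0), sq_nonneg (Φ p (Fin.last n))],
        by nlinarith [sq_nonneg (Φ p 0), sq_nonneg (Φ p (Fin.last n))]⟩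
    obtain ⟨N, hN⟩ := exists_nat_gt (2 / ρ p)
    filter_upwards [Filter.eventually_ge_atTop N] with k hk
    refine hG1 _ ?_
    rw [div_lt_iff₀ hpos] at hN
    have h2 : (N : ℝ) ≤ k := by exact_mod_cast hk
    have h3 : (k : ℝ) ≤ ((k : ℝ) + 1) ^ 2 := by nlinarith [(Nat.cast_nonneg k : (0 : ℝ) ≤ k)]
    nlinarith [mul_le_mul_of_nonneg_right (h2.trans h3) hpos.le]
  · have hbound : ∀ k, ∫ p, ‖divergence (fun p => (1 - η k p) • Z p) p‖ ≤
        ((n + 1 : ℕ) * (B₁ + 8 * K * L * B₀) * (V * 4)) * (1 / ((k : ℝ) + 1)) := by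
      intro k
      set m : ℝ := (k : ℝ) + 1 with hm
      have hm1 : 1 ≤ m := by rw [hm]; linarith [(Nat.cast_nonneg k : (0 : ℝ) ≤ k)]
      have hm0 : 0 < m := by linarith
      set A : Set 𝔼[n + 1] := {p ∈ U | |Φ p 0| ≤ 2 / m ∧ |Φ p (Fin.last n)| ≤ 2 / m} with hA
      have hvA := hvol (2 / m) (by positivity)
      rw [← hA] at hvA
      have hmem : ∀ p ∈ tsupport Z, ρ p * m ^ 2 ≤ 2 → p ∈ A := by
        intro p hp h
        have h1 : ρ p ≤ (2 / m) ^ 2 := by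
          rw [div_pow, le_div_iff₀ (by positivity)]; linarith
        have h2 : Φ p 0 ^ 2 + Φ p (Fin.last n) ^ 2 ≤ (2 / m) ^ 2 := h1
        refine ⟨hZU hp, abs_le_of_sq_le_sq (by nlinarith [sq_nonneg (Φ p (Fin.last n))])
          (by positivity), abs_le_of_sq_le_sq (by nlinarith [sq_nonneg (Φ p 0)]) (by positivity)⟩
      have hzero : ∀ p ∉ A, divergence (fun p => (1 - η k p) • Z p) p = 0 := by
        intro p hp
        refine divergence_eq_zero (notMem_tsupport_iff_eventuallyEq.2 ?_)
        by_cases hpZ : p ∈ tsupport Z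
        · have h1 : 2 < ρ p * m ^ 2 := not_le.1 fun h => hp (hmem p hpZ h)
          have h2 : ContinuousAt (fun y => ρ y * m ^ 2) p :=
            (hρc p (hUs (hZU hpZ))).continuousAt.mul continuousAt_const
          filter_upwards [h2.eventually (lt_mem_nhds h1)] with y hy
          have h3 : η k y = 1 := hG1 _ (le_of_lt hy)
          simp [h3]
        · filter_upwards [hnear hpZ] with y hy
          rw [hy]; simp
      have hle : ∀ p ∈ A, ‖divergence (fun p => (1 - η k p) • Z p) p‖ ≤
          (n + 1 : ℕ) * (B₁ + 8 * K * L * B₀) * m := by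
        intro p hp
        have hps := hUs hp.1
        have hηd := ((hηc k p hps).differentiableAt one_ne_zero).hasFDerivAt
        have hfd : HasFDerivAt (fun p => (1 - η k p) • Z p) _ p :=
          (hηd.const_sub 1).smul (hZ.differentiable one_ne_zero p).hasFDerivAt
        have hηn : ‖fderiv ℝ (η k) p‖ * ‖Z p‖ ≤ 8 * K * L * m * B₀ := by
          by_cases hpZ : ρ p * m ^ 2 ≤ 2
          · have h1 : HasFDerivAt (η k) (deriv G (ρ p * m ^ 2) • (m ^ 2 • fderiv ℝ ρ p)) p := by
              refine HasDerivAt.comp_hasFDerivAt (h₂ := G) (f := fun y => ρ y * m ^ 2) p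
                (hG.differentiable one_ne_zero _).hasDerivAt ?_
              exact ((hρc p hps).differentiableAt one_ne_zero).hasFDerivAt.mul_const _
            rw [h1.fderiv, norm_smul, norm_smul, Real.norm_of_nonneg (sq_nonneg m)]
            have h2 := hK (ρ p * m ^ 2) ⟨mul_nonneg (hρ0 p) (sq_nonneg m), hpZ⟩
            have h3 := hρd p hp.1
            have h4 : 2 * (|Φ p 0| + |Φ p (Fin.last n)|) * L ≤ 2 * (2 / m + 2 / m) * L := by
              gcongr
              · exact hp.2.1
              · exact hp.2.2
            calc ‖deriv G (ρ p * m ^ 2)‖ * (m ^ 2 * ‖fderiv ℝ ρ p‖) * ‖Z p‖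
                ≤ K * (m ^ 2 * (2 * (2 / m + 2 / m) * L)) * B₀ := by
                  gcongr
                  · exact h3.trans h4
                  · exact hB₀ p
              _ = 8 * K * L * m * B₀ := by field_simp; ring
          · have h1 : fderiv ℝ (η k) p = 0 := by
              have h2 : ContinuousAt (fun y => ρ y * m ^ 2) p :=
                (hρc p hps).continuousAt.mul continuousAt_const
              have h3 : η k =ᶠ[𝓝 p] fun _ => 1 := by
                filter_upwards [h2.eventually (lt_mem_nhds (not_le.1 hpZ))] with y hy
                exact hG1 _ (le_of_lt hy)
              rw [h3.fderiv_eq]; simp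
            rw [h1, norm_zero, zero_mul]; positivity
        refine (norm_divergence_le _ p).trans ?_
        rw [hfd.fderiv, mul_assoc]
        refine mul_le_mul_of_nonneg_left ?_ (Nat.cast_nonneg _)
        refine (norm_add_le _ _).trans ?_
        have h5 : ‖(1 - η k p) • fderiv ℝ Z p‖ ≤ B₁ := by
          rw [norm_smul, Real.norm_of_nonneg (by linarith [(hη01 k p).2])]
          exact (mul_le_of_le_one_left (norm_nonneg _) (by linarith [(hη01 k p).1])).trans (hB₁ p)
        have h6 : ‖(-fderiv ℝ (η k) p).smulRight (Z p)‖ ≤ 8 * K * L * m * B₀ := by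
          rw [ContinuousLinearMap.norm_smulRight_apply, norm_neg]; exact hηn
        nlinarith [mul_nonneg hB₁0 (sub_nonneg.2 hm1)]
      rw [← setIntegral_eq_integral_of_forall_compl_eq_zero (s := A) (fun p hp => by
        rw [hzero p hp, norm_zero])]
      have h7 := norm_setIntegral_le_of_norm_le_const (μ := volume)
        (f := fun p => ‖divergence (fun p => (1 - η k p) • Z p) p‖)
        (hvA.trans_lt ENNReal.ofReal_lt_top) (fun p hp => by rw [norm_norm]; exact hle p hp)
      refine (Real.le_norm_self _).trans (h7.trans ?_)
      have h8 : volume.real A ≤ V * (2 / m) ^ 2 :=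
        ENNReal.toReal_le_of_le_ofReal (by positivity) hvA
      calc _ ≤ (n + 1 : ℕ) * (B₁ + 8 * K * L * B₀) * m * (V * (2 / m) ^ 2) := by gcongr
        _ = _ := by field_simp; ring
    have hlim := (tendsto_one_div_add_atTop_nhds_zero_nat (𝕜 := ℝ)).const_mul
      ((n + 1 : ℕ) * (B₁ + 8 * K * L * B₀) * (V * 4))
    rw [mul_zero] at hlim
    exact squeeze_zero (fun k => integral_nonneg fun p => norm_nonneg _) hbound hlim

end Cutoff

/-! ### The flux is at most the mass on the competitor -/

section FluxBound

variable {n : ℕ} {C : Set 𝔼[n]} {u : 𝔼[n] → ℝ} {M W : Set 𝔼[n + 1]} {R : ℝ} {F : 𝔼[n + 1] → ℝ}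
  {Y : 𝔼[n + 1] → 𝔼[n + 1]}

theorem support_fun_smul_subset (χ : 𝔼[n + 1] → ℝ) (Y : 𝔼[n + 1] → 𝔼[n + 1]) :
    (Function.support fun p => χ p • Y p) ⊆ Function.support χ ∩ Function.support Y := by
  intro p hp
  rw [Function.mem_support, smul_ne_zero_iff] at hp
  exact hp

theorem hasCompactSupport_fun_smul (χ : 𝔼[n + 1] → ℝ) (hYc : HasCompactSupport Y) :
    HasCompactSupport fun p => χ p • Y p :=
  hYc.mono ((support_fun_smul_subset χ Y).trans inter_subset_right)

theorem tsupport_fun_smul_subset_left (χ : 𝔼[n + 1] → ℝ) (Y : 𝔼[n + 1] → 𝔼[n + 1]) :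
    (tsupport fun p => χ p • Y p) ⊆ tsupport χ :=
  closure_mono ((support_fun_smul_subset χ Y).trans inter_subset_left)

theorem tsupport_fun_smul_subset_right (χ : 𝔼[n + 1] → ℝ) (Y : 𝔼[n + 1] → 𝔼[n + 1]) :
    (tsupport fun p => χ p • Y p) ⊆ tsupport Y :=
  closure_mono ((support_fun_smul_subset χ Y).trans inter_subset_right)

theorem contDiff_fun_smul {χ : 𝔼[n + 1] → ℝ} (hχ : ContDiff ℝ 1 χ) (hY : ContDiff ℝ 1 Y) :
    ContDiff ℝ 1 fun p => χ p • Y p :=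
  hχ.smul hY

theorem IsFilling.flux_eq_smul_add (hF : IsFilling C u M W R F) (h : IsCompetitor C u M W)
    {χ : 𝔼[n + 1] → ℝ} (hYc : HasCompactSupport Y) (h1 : ContDiff ℝ 1 fun p => χ p • Y p)
    (h2 : ContDiff ℝ 1 fun p => (1 - χ p) • Y p) :
    flux F C u Y = flux F C u (fun p => χ p • Y p) + flux F C u (fun p => (1 - χ p) • Y p) := by
  rw [← hF.flux_add h h1 (hasCompactSupport_fun_smul χ hYc) h2
    (hasCompactSupport_fun_smul (fun p => 1 - χ p) hYc)]
  congr 1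
  ext1 p
  rw [← add_smul, add_sub_cancel, one_smul]

/-- The part `χ • Y` of a field is controlled by `Y` in mass: masses of `χ • Y` and `(1 - χ) • Y`
add up. -/
theorem lintegral_norm_smul_add {χ : 𝔼[n + 1] → ℝ} (hχ : Continuous χ)
    (h01 : ∀ p, χ p ∈ Icc (0 : ℝ) 1) (hY : Continuous Y) (μ : Measure 𝔼[n + 1]) :
    ∫⁻ p, ENNReal.ofReal ‖χ p • Y p‖ ∂μ + ∫⁻ p, ENNReal.ofReal ‖(1 - χ p) • Y p‖ ∂μ =
      ∫⁻ p, ENNReal.ofReal ‖Y p‖ ∂μ := by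
  have hm : Measurable fun p => ENNReal.ofReal ‖χ p • Y p‖ :=
    (ENNReal.continuous_ofReal.comp (hχ.smul hY).norm).measurable
  rw [← lintegral_add_left hm]
  refine lintegral_congr fun p => ?_
  rw [← ENNReal.ofReal_add (norm_nonneg _) (norm_nonneg _), norm_smul, norm_smul,
    Real.norm_of_nonneg (h01 p).1, Real.norm_of_nonneg (sub_nonneg.2 (h01 p).2)]
  congr 1; ring

theorem ofReal_abs_add_le (a b : ℝ) :
    ENNReal.ofReal |a + b| ≤ ENNReal.ofReal |a| + ENNReal.ofReal |b| := by
  rw [← ENNReal.ofReal_add (abs_nonneg a) (abs_nonneg b)]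
  exact ENNReal.ofReal_le_ofReal (abs_add_le a b)

/-- A bound of the flux by the mass on `W` holds for all fields if it holds locally. -/
theorem IsFilling.flux_le_of_locally (hF : IsFilling C u M W R F) (h : IsCompetitor C u M W)
    {c : ENNReal} (hY : ContDiff ℝ 1 Y) (hYc : HasCompactSupport Y)
    (hloc : ∀ q ∈ tsupport Y, ∃ U ∈ 𝓝 q, ∀ Z : 𝔼[n + 1] → 𝔼[n + 1], ContDiff ℝ 1 Z →
      HasCompactSupport Z → tsupport Z ⊆ U → ENNReal.ofReal |flux F C u Z| ≤
        c * ∫⁻ p in W, ENNReal.ofReal ‖Z p‖ ∂(Measure.euclideanHausdorffMeasure n)) :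
    ENNReal.ofReal |flux F C u Y| ≤
      c * ∫⁻ p in W, ENNReal.ofReal ‖Y p‖ ∂(Measure.euclideanHausdorffMeasure n) := by
  suffices hs : ∃ O, IsOpen O ∧ tsupport Y ⊆ O ∧ ∀ Z : 𝔼[n + 1] → 𝔼[n + 1], ContDiff ℝ 1 Z →
      HasCompactSupport Z → tsupport Z ⊆ O → ENNReal.ofReal |flux F C u Z| ≤
        c * ∫⁻ p in W, ENNReal.ofReal ‖Z p‖ ∂(Measure.euclideanHausdorffMeasure n) by
    obtain ⟨O, -, hYO, hO⟩ := hs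
    exact hO Y hY hYc hYO
  -- The bound passes to unions: fields split by a cutoff, and the masses of the parts add up.
  refine IsCompact.induction_on (p := fun s => ∃ O, IsOpen O ∧ s ⊆ O ∧
    ∀ Z : 𝔼[n + 1] → 𝔼[n + 1], ContDiff ℝ 1 Z → HasCompactSupport Z → tsupport Z ⊆ O →
      ENNReal.ofReal |flux F C u Z| ≤
        c * ∫⁻ p in W, ENNReal.ofReal ‖Z p‖ ∂(Measure.euclideanHausdorffMeasure n))
    hYc ?_ ?_ ?_ ?_
  · refine ⟨∅, isOpen_empty, subset_rfl, fun Z _ _ hZ => ?_⟩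
    have h0 : Z = 0 := by
      rw [← tsupport_eq_empty_iff]; exact subset_empty_iff.1 hZ
    have h2 : ∀ p, divergence Z p = 0 := fun p => divergence_eq_zero fun hp => hZ hp
    have h1 : flux F C u Z = 0 := by
      unfold flux
      simp only [h2, mul_zero, integral_zero]
      simp [h0]
    simp [h1]
  · rintro s t hst ⟨O, hO, htO, hOb⟩
    exact ⟨O, hO, hst.trans htO, hOb⟩
  · rintro s t ⟨O₁, hO₁, hs₁, hb₁⟩ ⟨O₂, hO₂, hs₂, hb₂⟩
    refine ⟨O₁ ∪ O₂, hO₁.union hO₂, union_subset_union hs₁ hs₂, fun Z hZ hZc hZO => ?_⟩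
    obtain ⟨χ, hχ, hχ1, hχs, hχ01⟩ := exists_contDiff_cutoff
      ((isClosed_tsupport Z).inter hO₂.isClosed_compl) hO₁
      (fun p hp => (hZO hp.1).resolve_right hp.2)
    have hχ' : ContDiff ℝ 1 fun p => 1 - χ p := contDiff_const.sub hχ
    have k1 := hb₁ (fun p => χ p • Z p) (contDiff_fun_smul hχ hZ)
      (hasCompactSupport_fun_smul χ hZc) ((tsupport_fun_smul_subset_left χ Z).trans hχs)
    have k2 := hb₂ (fun p => (1 - χ p) • Z p) (contDiff_fun_smul hχ' hZ)
      (hasCompactSupport_fun_smul (fun p => 1 - χ p) hZc) (fun p hp => by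
      by_contra hp2
      have hpZ : p ∈ tsupport Z := tsupport_fun_smul_subset_right (fun p => 1 - χ p) Z hp
      refine (notMem_tsupport_iff_eventuallyEq.2 ?_) hp
      filter_upwards [(eventually_nhdsSet_iff_forall.1 hχ1) p ⟨hpZ, hp2⟩] with y hy
      simp [hy])
    rw [hF.flux_eq_smul_add h hZc (contDiff_fun_smul hχ hZ) (contDiff_fun_smul hχ' hZ),
      ← lintegral_norm_smul_add hχ.continuous hχ01 hZ.continuous, mul_add]
    exact (ofReal_abs_add_le _ _).trans (add_le_add k1 k2)
  · intro q hq
    obtain ⟨U, hU, hUb⟩ := hloc q hq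
    refine ⟨interior U, mem_nhdsWithin_of_mem_nhds (interior_mem_nhds.2 hU), interior U,
      isOpen_interior, subset_rfl, fun Z hZ hZc hZU => hUb Z hZ hZc (hZU.trans interior_subset)⟩

/-- The flux bound near a boundary point follows from the one for fields supported away from the
boundary, since the boundary has codimension two. -/
theorem IsFilling.exists_flux_le_boundary (hF : IsFilling C u M W R F) (h : IsCompetitor C u M W)
    {c : ENNReal} (hc : ∀ Z : 𝔼[n + 1] → 𝔼[n + 1], ContDiff ℝ 1 Z → HasCompactSupport Z →
      (∀ p ∈ tsupport Z, p ∉ hypersurfaceBoundary M) → ENNReal.ofReal |flux F C u Z| ≤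
        c * ∫⁻ p in W, ENNReal.ofReal ‖Z p‖ ∂(Measure.euclideanHausdorffMeasure n))
    {q : 𝔼[n + 1]} (hq : q ∈ hypersurfaceBoundary M) :
    ∃ U ∈ 𝓝 q, ∀ Z : 𝔼[n + 1] → 𝔼[n + 1], ContDiff ℝ 1 Z → HasCompactSupport Z →
      tsupport Z ⊆ U → ENNReal.ofReal |flux F C u Z| ≤
        c * ∫⁻ p in W, ENNReal.ofReal ‖Z p‖ ∂(Measure.euclideanHausdorffMeasure n) := by
  obtain ⟨Φ, hΦ, hqs, hS⟩ := h.exists_chart_boundary h.one_le hq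
  obtain ⟨hq0, hql⟩ := (hS q hqs).1 hq
  obtain ⟨U, hU, hUs, hcut⟩ := exists_cutoff_codim_two h.one_le hΦ hqs hq0 hql
  refine ⟨U, hU, fun Z hZ hZc hZU => ?_⟩
  obtain ⟨η, hη01, hηc, hη0, hη1, hlim⟩ := hcut Z hZ hZc hZU
  have hηc' : ∀ k, ContDiff ℝ 1 fun p => (1 - η k p) • Z p := fun k => by
    have : (fun p => (1 - η k p) • Z p) = fun p => Z p - η k p • Z p := by
      ext1 p; rw [sub_smul, one_smul]
    rw [this]; exact hZ.sub (hηc k)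
  have hcs : ∀ χ : 𝔼[n + 1] → ℝ, HasCompactSupport fun p => χ p • Z p := fun χ =>
    hasCompactSupport_fun_smul χ hZc
  have hsplit : ∀ k, flux F C u Z =
      flux F C u (fun p => η k p • Z p) + flux F C u (fun p => (1 - η k p) • Z p) := fun k =>
    hF.flux_eq_smul_add h hZc (hηc k) (hηc' k)
  have hbound : ∀ k, ENNReal.ofReal |flux F C u (fun p => η k p • Z p)| ≤
      c * ∫⁻ p in W, ENNReal.ofReal ‖Z p‖ ∂(Measure.euclideanHausdorffMeasure n) := fun k => by
    refine (hc _ (hηc k) (hcs _) fun p hp hpS => ?_).trans (mul_le_mul_right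
      (lintegral_mono fun p => ENNReal.ofReal_le_ofReal ?_) _)
    · have hps := hUs (hZU (tsupport_fun_smul_subset_right (η k) Z hp))
      have h1 := (hS p hps).1 hpS
      refine (notMem_tsupport_iff_eventuallyEq.2 ?_) hp
      filter_upwards [hη0 k p hps h1.1 h1.2] with y hy
      simp [hy]
    · rw [norm_smul, Real.norm_of_nonneg (hη01 k p).1]
      exact mul_le_of_le_one_left (norm_nonneg _) (hη01 k p).2
  -- the remaining flux tends to zero
  have hA : Filter.Tendsto (fun k => ∫ p, F p * divergence (fun p => (1 - η k p) • Z p) p)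
      Filter.atTop (𝓝 0) := by
    refine squeeze_zero_norm (fun k => ?_) hlim
    refine (norm_integral_le_integral_norm _).trans (integral_mono_of_nonneg
      (ae_of_all _ fun p => norm_nonneg _)
      (integrable_divergence (hηc' k) (hcs _)).norm (ae_of_all _ fun p => ?_))
    simp only [norm_mul]
    exact mul_le_of_le_one_left (norm_nonneg _) (by rw [Real.norm_eq_abs]; exact hF.abs_le_one p)
  have hB : Filter.Tendsto (fun k => ∫ x in interior C,
      (height ((1 - η k (graphMap u x)) • Z (graphMap u x)) -
        fderiv ℝ u x (base ((1 - η k (graphMap u x)) • Z (graphMap u x)))))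
      Filter.atTop (𝓝 0) := by
    have hI := h.integrableOn_graph_flux hZ.continuous hZc
    have e0 : (0 : ℝ) = ∫ x in interior C, (0 : ℝ) := by simp
    rw [e0]
    refine tendsto_integral_of_dominated_convergence _ (fun k =>
      (h.integrableOn_graph_flux (hηc' k).continuous (hcs _)).aestronglyMeasurable)
      hI.norm (fun k => ae_of_all _ fun x => ?_)
      ((ae_restrict_mem isOpen_interior.measurableSet).mono fun x hx => ?_)
    · rw [map_smul, map_smul, map_smul, smul_eq_mul, smul_eq_mul, ← mul_sub, norm_mul,
        Real.norm_of_nonneg (sub_nonneg.2 (hη01 k _).2)]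
      exact mul_le_of_le_one_left (norm_nonneg _) (by linarith [(hη01 k (graphMap u x)).1])
    · by_cases hxs : graphMap u x ∈ Φ.source
      · have hnot : graphMap u x ∉ hypersurfaceBoundary M := fun hb => by
          have h1 := ((h.mem_boundary_iff h.one_le).1 hb).2
          rw [graphMap_eq_lift, base_lift] at h1
          exact h1 hx
        rw [hS _ hxs] at hnot
        refine tendsto_const_nhds.congr' ?_
        filter_upwards [hη1 _ hnot] with k hk
        simp [hk]
      · have h0 : Z (graphMap u x) = 0 := by
          by_contra hne
          exact hxs (hUs (hZU (subset_tsupport _ hne)))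
        simp [h0]
  have hlimflux : Filter.Tendsto (fun k => flux F C u fun p => η k p • Z p) Filter.atTop
      (𝓝 (flux F C u Z)) := by
    have h1 := (tendsto_const_nhds (x := flux F C u Z)).sub (hA.add hB)
    rw [add_zero, sub_zero] at h1
    refine h1.congr fun k => ?_
    rw [hsplit k]
    exact add_sub_cancel_right _ _
  exact le_of_tendsto (ENNReal.tendsto_ofReal hlimflux.abs) (Filter.Eventually.of_forall hbound)

/-- The flux of a field is at most its mass on the competitor. -/
theorem IsFilling.flux_le (hF : IsFilling C u M W R F) (h : IsCompetitor C u M W)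
    (hY : ContDiff ℝ 1 Y) (hYc : HasCompactSupport Y) : ENNReal.ofReal |flux F C u Y| ≤
      ∫⁻ p in W, ENNReal.ofReal ‖Y p‖ ∂(Measure.euclideanHausdorffMeasure n) := by
  have key : ∀ ε : ℝ, 0 < ε → ENNReal.ofReal |flux F C u Y| ≤ ENNReal.ofReal (1 + ε) *
      ∫⁻ p in W, ENNReal.ofReal ‖Y p‖ ∂(Measure.euclideanHausdorffMeasure n) := fun ε hε => by
    refine hF.flux_le_of_locally h hY hYc fun q _ => ?_
    by_cases hq : q ∈ hypersurfaceBoundary M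
    · exact hF.exists_flux_le_boundary h (fun Z hZ hZc hZS => hF.flux_le_of_locally h hZ hZc
        fun q hq => hF.exists_flux_le h (hZS q hq) hε) hq
    · exact hF.exists_flux_le h hq hε
  rcases eq_or_ne (∫⁻ p in W, ENNReal.ofReal ‖Y p‖ ∂(Measure.euclideanHausdorffMeasure n)) ⊤
    with htop | htop
  · rw [htop]; exact le_top
  have hcont : Filter.Tendsto (fun ε : ℝ => ENNReal.ofReal (1 + ε) *
      ∫⁻ p in W, ENNReal.ofReal ‖Y p‖ ∂(Measure.euclideanHausdorffMeasure n)) (𝓝[>] 0)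
      (𝓝 (ENNReal.ofReal (1 + 0) *
        ∫⁻ p in W, ENNReal.ofReal ‖Y p‖ ∂(Measure.euclideanHausdorffMeasure n))) := by
    refine ENNReal.Tendsto.mul_const (ENNReal.tendsto_ofReal ?_) (Or.inr htop)
    exact ((continuous_const.add continuous_id).tendsto 0).mono_left nhdsWithin_le_nhds
  rw [add_zero, ENNReal.ofReal_one, one_mul] at hcont
  exact ge_of_tendsto hcont (by
    filter_upwards [self_mem_nhdsWithin] with ε hε using key ε hε)

/-- The flux bound improves near a point of the competitor at which the field is not normal. -/
theorem IsFilling.exists_flux_le_add (hF : IsFilling C u M W R F) (h : IsCompetitor C u M W)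
    {q : 𝔼[n + 1]} (hq : q ∉ hypersurfaceBoundary M) (hqW : q ∈ W) :
    ∃ (Φ : OpenPartialHomeomorph 𝔼[n + 1] 𝔼[n + 1]) (ν : 𝔼[n + 1]), IsC1Diffeo Φ ∧
      q ∈ Φ.source ∧ (∀ y ∈ Φ.source, y ∈ W ↔ Φ y (Fin.last n) = 0) ∧ ‖ν‖ = 1 ∧
      (∀ v, fderiv ℝ (fun y => Φ y (Fin.last n)) q v = 0 ↔ inner ℝ ν v = 0) ∧
      ∀ ε > 0, ∃ U ∈ 𝓝 q, ∀ χ : 𝔼[n + 1] → ℝ, ContDiff ℝ 1 χ → tsupport χ ⊆ U →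
        (∀ p, χ p ∈ Icc (0 : ℝ) 1) → ∀ Y : 𝔼[n + 1] → 𝔼[n + 1], ContDiff ℝ 1 Y →
        HasCompactSupport Y → ENNReal.ofReal |flux F C u Y| ≤
          ∫⁻ p in W, ENNReal.ofReal
            (χ p * (|inner ℝ ν (Y p)| + ε * ‖Y p‖) + (1 - χ p) * ‖Y p‖)
            ∂(Measure.euclideanHausdorffMeasure n) := by
  obtain ⟨Φ, ν, h1, h2, h3, h4, h5, h6⟩ := hF.exists_flux_le_normal h hq hqW
  refine ⟨Φ, ν, h1, h2, h3, h4, h5, fun ε hε => ?_⟩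
  obtain ⟨U, hU, hUb⟩ := h6 ε hε
  refine ⟨U, hU, fun χ hχ hχU hχ01 Y hY hYc => ?_⟩
  have hχ' : ContDiff ℝ 1 fun p => 1 - χ p := contDiff_const.sub hχ
  have k1 := hUb (fun p => χ p • Y p) (contDiff_fun_smul hχ hY)
    (hasCompactSupport_fun_smul χ hYc) ((tsupport_fun_smul_subset_left χ Y).trans hχU)
  have k2 := hF.flux_le h (contDiff_fun_smul hχ' hY)
    (hasCompactSupport_fun_smul (fun p => 1 - χ p) hYc)
  rw [hF.flux_eq_smul_add h hYc (contDiff_fun_smul hχ hY) (contDiff_fun_smul hχ' hY)]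
  refine (ofReal_abs_add_le _ _).trans ((add_le_add k1 k2).trans (le_of_eq ?_))
  have hχc := hχ.continuous
  have hYcont := hY.continuous
  have hm : Measurable fun p =>
      ENNReal.ofReal (|inner ℝ ν (χ p • Y p)| + ε * ‖χ p • Y p‖) :=
    (ENNReal.continuous_ofReal.comp (by fun_prop)).measurable
  rw [← lintegral_add_left hm]
  refine lintegral_congr fun p => ?_
  rw [← ENNReal.ofReal_add (by positivity) (norm_nonneg _), norm_smul, norm_smul,
    Real.norm_of_nonneg (hχ01 p).1, Real.norm_of_nonneg (sub_nonneg.2 (hχ01 p).2),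
    inner_smul_right, abs_mul, abs_of_nonneg (hχ01 p).1]
  congr 1; ring

end FluxBound

/-! ### Approximation of the calibrating field -/

/-- The divergence, with respect to the base variables, of a vector field that is independent of the
height. -/
def baseDivergence {n : ℕ} (w : 𝔼[n] → 𝔼[n + 1]) (x : 𝔼[n]) : ℝ :=
  ∑ i : Fin n, fderiv ℝ w x (EuclideanSpace.single i 1) i.castSucc

/-- The field `v` is a unit field on `C`, normal to the graph of `u`, and the field `e^z v(x)` is
divergence free over the interior of `C`. -/
structure IsCalibration {n : ℕ} (C : Set 𝔼[n]) (u : 𝔼[n] → ℝ) (v : 𝔼[n] → 𝔼[n + 1]) : Prop where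
  continuousOn : ContinuousOn v C
  norm_eq_one : ∀ x ∈ C, ‖v x‖ = 1
  contDiffOn : ContDiffOn ℝ 1 v (interior C)
  height_pos : ∀ x ∈ C, 0 < height (v x)
  inner_eq : ∀ x ∈ interior C, ∀ e,
    inner ℝ (v x) e = height (v x) * (height e - fderiv ℝ u x (base e))
  flux_eq : ∀ x ∈ interior C, height (v x) - fderiv ℝ u x (base (v x)) =
    Real.sqrt (1 + ‖fderiv ℝ u x‖ ^ 2)
  baseDivergence_eq : ∀ x ∈ interior C, baseDivergence v x = -height (v x)

section Approximation

variable {n : ℕ} {C : Set 𝔼[n]} {u : 𝔼[n] → ℝ} {M : Set 𝔼[n + 1]} {v : 𝔼[n] → 𝔼[n + 1]}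

theorem baseDivergence_congr {w w' : 𝔼[n] → 𝔼[n + 1]} {x : 𝔼[n]} (h : w =ᶠ[𝓝 x] w') :
    baseDivergence w x = baseDivergence w' x := by
  unfold baseDivergence
  rw [h.fderiv_eq]

theorem baseDivergence_add {w w' : 𝔼[n] → 𝔼[n + 1]} {x : 𝔼[n]} (h : DifferentiableAt ℝ w x)
    (h' : DifferentiableAt ℝ w' x) :
    baseDivergence (fun y => w y + w' y) x = baseDivergence w x + baseDivergence w' x := by
  unfold baseDivergence
  rw [← Finset.sum_add_distrib]
  refine Finset.sum_congr rfl fun i _ => ?_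
  rw [fderiv_fun_add h h']
  rfl

theorem baseDivergence_smul {ψ : 𝔼[n] → ℝ} {w : 𝔼[n] → 𝔼[n + 1]} {x : 𝔼[n]}
    (hψ : DifferentiableAt ℝ ψ x) (hw : DifferentiableAt ℝ w x) :
    baseDivergence (fun y => ψ y • w y) x =
      fderiv ℝ ψ x (base (w x)) + ψ x * baseDivergence w x := by
  have h1 : fderiv ℝ (fun y => ψ y • w y) x = _ := (hψ.hasFDerivAt.smul hw.hasFDerivAt).fderiv
  unfold baseDivergence
  conv_rhs => rw [← sum_smul_single (base (w x)), map_sum, Finset.mul_sum]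
  rw [← Finset.sum_add_distrib]
  refine Finset.sum_congr rfl fun i _ => ?_
  rw [h1]
  simp [base_apply]
  ring

theorem baseDivergence_comp_add {w : 𝔼[n] → 𝔼[n + 1]} {x : 𝔼[n]} (e : 𝔼[n]) :
    baseDivergence (fun y => w (y + e)) x = baseDivergence w (x + e) := by
  unfold baseDivergence
  rw [fderiv_comp_add_right]

/-- `ψ • v` can be approximated on `C` by `C¹` fields together with its base divergence. -/
def IsApproximable (C : Set 𝔼[n]) (v : 𝔼[n] → 𝔼[n + 1]) (ψ : 𝔼[n] → ℝ) : Prop :=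
  ∀ ε > 0, ∃ w : 𝔼[n] → 𝔼[n + 1], ContDiff ℝ 1 w ∧ ∀ x ∈ C, ‖w x - ψ x • v x‖ ≤ ε ∧
    |baseDivergence w x - (fderiv ℝ ψ x (base (v x)) - ψ x * height (v x))| ≤ ε

theorem IsApproximable.add {ψ ψ' : 𝔼[n] → ℝ} (h : IsApproximable C v ψ)
    (h' : IsApproximable C v ψ') (hψ : ContDiff ℝ 1 ψ) (hψ' : ContDiff ℝ 1 ψ') :
    IsApproximable C v fun x => ψ x + ψ' x := by
  intro ε hε
  obtain ⟨w, hw, hwx⟩ := h (ε / 2) (half_pos hε)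
  obtain ⟨w', hw', hwx'⟩ := h' (ε / 2) (half_pos hε)
  refine ⟨fun x => w x + w' x, hw.add hw', fun x hx => ⟨?_, ?_⟩⟩
  · have e : w x + w' x - (ψ x + ψ' x) • v x = (w x - ψ x • v x) + (w' x - ψ' x • v x) := by
      rw [add_smul]; abel
    rw [e]
    exact (norm_add_le _ _).trans (by linarith [(hwx x hx).1, (hwx' x hx).1])
  · rw [baseDivergence_add (hw.differentiable one_ne_zero x) (hw'.differentiable one_ne_zero x),
      fderiv_fun_add (hψ.differentiable one_ne_zero x) (hψ'.differentiable one_ne_zero x),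
      add_apply]
    have h1 := abs_le.1 (hwx x hx).2
    have h2 := abs_le.1 (hwx' x hx).2
    rw [abs_le]
    constructor <;> nlinarith [h1.1, h1.2, h2.1, h2.2]

/-- Where a fixed direction points into the interior of `C`, translation in this direction makes
the field differentiable. -/
theorem IsCalibration.isApproximable_of_inward (hv : IsCalibration C u v) (hC : IsCompact C)
    {e : 𝔼[n]} {B : Set 𝔼[n]} {τ₀ : ℝ} (hτ₀ : 0 < τ₀)
    (he : ∀ x ∈ C ∩ B, ∀ τ ∈ Ioo 0 τ₀, x + τ • e ∈ interior C) {ψ : 𝔼[n] → ℝ}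
    (hψ : ContDiff ℝ 1 ψ) (hψB : tsupport ψ ⊆ B) : IsApproximable C v ψ := by
  intro ε hε
  obtain ⟨b₀, hb₀⟩ := hC.exists_bound_of_continuousOn hψ.continuous.continuousOn
  obtain ⟨b₁, hb₁⟩ := hC.exists_bound_of_continuousOn
    (hψ.continuous_fderiv one_ne_zero).continuousOn
  obtain ⟨δ, hδ, hδv⟩ := Metric.uniformContinuousOn_iff.1
    (hC.uniformContinuousOn_of_continuous hv.continuousOn) (ε / (|b₀| + |b₁| + 1)) (by positivity)
  -- a small translation
  obtain ⟨τ, hτ, hτδ⟩ : ∃ τ ∈ Ioo 0 τ₀, ‖τ • e‖ < δ := by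
    refine ⟨min (τ₀ / 2) (δ / (2 * (‖e‖ + 1))), ⟨by positivity, ?_⟩, ?_⟩
    · exact (min_le_left _ _).trans_lt (by linarith)
    · rw [norm_smul, Real.norm_of_nonneg (by positivity)]
      calc min (τ₀ / 2) (δ / (2 * (‖e‖ + 1))) * ‖e‖
          ≤ δ / (2 * (‖e‖ + 1)) * (‖e‖ + 1) := by
            gcongr
            · exact min_le_right _ _
            · linarith
        _ = δ / 2 := by field_simp
        _ < δ := by linarith
  have hO : IsOpen {x | x + τ • e ∈ interior C} :=
    isOpen_interior.preimage (continuous_id.add continuous_const)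
  obtain ⟨κ, hκ, hκ1, hκs, -⟩ := exists_contDiff_cutoff
    (hC.isClosed.inter (isClosed_tsupport ψ)) hO (fun x hx => he x ⟨hx.1, hψB hx.2⟩ τ hτ)
  have hvτ : ContDiffOn ℝ 1 (fun x => v (x + τ • e)) {x | x + τ • e ∈ interior C} :=
    hv.contDiffOn.comp (contDiff_id.add contDiff_const).contDiffOn fun x hx => hx
  -- The factor `κ` only makes the field globally defined: it is `1` near `C ∩ tsupport ψ`.
  refine ⟨fun x => ψ x • κ x • v (x + τ • e),
    hψ.smul (contDiff_smul_of_tsupport_subset hκ hO hκs hvτ), fun x hx => ?_⟩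
  by_cases hxψ : x ∈ tsupport ψ
  swap
  · have hψ0 : ψ =ᶠ[𝓝 x] 0 := notMem_tsupport_iff_eventuallyEq.1 hxψ
    have h0 : ψ x = 0 := hψ0.self_of_nhds
    have h1 : fderiv ℝ ψ x = 0 := by rw [hψ0.fderiv_eq]; simp
    have h2 : baseDivergence (fun x => ψ x • κ x • v (x + τ • e)) x = 0 := by
      rw [baseDivergence_congr (w' := fun _ => 0) (by
        filter_upwards [hψ0] with y hy; rw [hy]; simp)]
      simp [baseDivergence]
    rw [h1, h2]
    simp only [h0, zero_smul, sub_self, norm_zero, zero_apply, zero_mul, abs_zero]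
    exact ⟨hε.le, hε.le⟩
  have hxi : x + τ • e ∈ interior C := he x ⟨hx, hψB hxψ⟩ τ hτ
  have hdist : ‖v (x + τ • e) - v x‖ ≤ ε / (|b₀| + |b₁| + 1) := by
    rw [← dist_eq_norm]
    refine (hδv _ (interior_subset hxi) x hx ?_).le
    rwa [dist_eq_norm, add_sub_cancel_left]
  have hdv : DifferentiableAt ℝ v (x + τ • e) :=
    (hv.contDiffOn.contDiffAt (isOpen_interior.mem_nhds hxi)).differentiableAt one_ne_zero
  have hκx : (fun x => ψ x • κ x • v (x + τ • e)) =ᶠ[𝓝 x] fun x => ψ x • v (x + τ • e) := by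
    filter_upwards [eventually_nhdsSet_iff_forall.1 hκ1 x ⟨hx, hxψ⟩] with y hy
    rw [hy, one_smul]
  have h0 := (hb₀ x hx).trans (le_abs_self b₀)
  have h1 := (hb₁ x hx).trans (le_abs_self b₁)
  have hε' : ε / (|b₀| + |b₁| + 1) * (|b₀| + |b₁|) ≤ ε := by
    rw [div_mul_eq_mul_div, div_le_iff₀ (by positivity)]
    nlinarith
  constructor
  · rw [hκx.self_of_nhds, ← smul_sub, norm_smul]
    calc ‖ψ x‖ * ‖v (x + τ • e) - v x‖ ≤ |b₀| * (ε / (|b₀| + |b₁| + 1)) := by gcongr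
      _ ≤ ε / (|b₀| + |b₁| + 1) * (|b₀| + |b₁|) := by
        rw [mul_comm]; gcongr; linarith [abs_nonneg b₁]
      _ ≤ ε := hε'
  · have hdv' : DifferentiableAt ℝ (fun y => v (y + τ • e)) x := by
      have := (differentiableAt_comp_add_right (𝕜 := ℝ) (f := v) (x := x) (τ • e)).2 hdv
      exact this
    rw [baseDivergence_congr hκx, baseDivergence_smul (hψ.differentiable one_ne_zero x) hdv',
      baseDivergence_comp_add, hv.baseDivergence_eq _ hxi]
    have e1 : fderiv ℝ ψ x (base (v (x + τ • e))) + ψ x * -height (v (x + τ • e)) -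
        (fderiv ℝ ψ x (base (v x)) - ψ x * height (v x)) =
        fderiv ℝ ψ x (base (v (x + τ • e) - v x)) - ψ x * height (v (x + τ • e) - v x) := by
      rw [map_sub, map_sub, map_sub]; ring
    rw [e1]
    refine (abs_sub _ _).trans ?_
    have k1 : |fderiv ℝ ψ x (base (v (x + τ • e) - v x))| ≤
        |b₁| * (ε / (|b₀| + |b₁| + 1)) := by
      rw [← Real.norm_eq_abs]
      refine (ContinuousLinearMap.le_opNorm _ _).trans ?_
      gcongr
      exact (norm_base_le _).trans hdist
    have k2 : |ψ x * height (v (x + τ • e) - v x)| ≤ |b₀| * (ε / (|b₀| + |b₁| + 1)) := by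
      rw [abs_mul]
      exact mul_le_mul h0 ((abs_height_le _).trans hdist) (abs_nonneg _) (abs_nonneg _)
    linarith

/-- A calibrating field can be approximated on `C` by `C¹` fields that are almost divergence free
after multiplication by `e^z`. -/
theorem IsCalibration.exists_approx (hv : IsCalibration C u v) (h : IsGraphHypersurface C u M)
    (hn : 1 ≤ n) {ε : ℝ} (hε : 0 < ε) : ∃ w : 𝔼[n] → 𝔼[n + 1], ContDiff ℝ 1 w ∧
      ∀ x ∈ C, ‖w x - v x‖ ≤ ε ∧ |baseDivergence w x + height (w x)| ≤ ε := by
  have hkey : ∃ O, IsOpen O ∧ C ⊆ O ∧ ∀ ψ : 𝔼[n] → ℝ, ContDiff ℝ 1 ψ → tsupport ψ ⊆ O →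
      IsApproximable C v ψ := by
    refine h.compact.induction_on (p := fun s => ∃ O, IsOpen O ∧ s ⊆ O ∧
      ∀ ψ : 𝔼[n] → ℝ, ContDiff ℝ 1 ψ → tsupport ψ ⊆ O → IsApproximable C v ψ) ?_ ?_ ?_ ?_
    · refine ⟨∅, isOpen_empty, subset_rfl, fun ψ hψ hψO => ?_⟩
      exact hv.isApproximable_of_inward h.compact (e := 0) one_pos
        (fun x hx => absurd hx.2 (notMem_empty x)) hψ hψO
    · rintro s t hst ⟨O, hO, htO, hOb⟩
      exact ⟨O, hO, hst.trans htO, hOb⟩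
    · rintro s t ⟨O₁, hO₁, hs₁, hb₁⟩ ⟨O₂, hO₂, hs₂, hb₂⟩
      refine ⟨O₁ ∪ O₂, hO₁.union hO₂, union_subset_union hs₁ hs₂, fun ψ hψ hψO => ?_⟩
      obtain ⟨χ, hχ, hχ1, hχs, -⟩ := exists_contDiff_cutoff
        ((isClosed_tsupport ψ).inter hO₂.isClosed_compl) hO₁
        (fun p hp => (hψO hp.1).resolve_right hp.2)
      have k1 := hb₁ (fun x => χ x * ψ x) (hχ.mul hψ)
        ((tsupport_mul_subset_left (f := χ) (g := ψ)).trans hχs)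
      have k2 := hb₂ (fun x => (1 - χ x) * ψ x) ((contDiff_const.sub hχ).mul hψ) (fun p hp => by
        by_contra hp2
        have hpψ : p ∈ tsupport ψ :=
          tsupport_mul_subset_right (f := fun x => 1 - χ x) (g := ψ) hp
        refine (notMem_tsupport_iff_eventuallyEq.2 ?_) hp
        filter_upwards [eventually_nhdsSet_iff_forall.1 hχ1 p ⟨hpψ, hp2⟩] with y hy
        simp [hy])
      have k3 := k1.add k2 (hχ.mul hψ) ((contDiff_const.sub hχ).mul hψ)
      have e : (fun x => χ x * ψ x + (1 - χ x) * ψ x) = ψ := by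
        ext1 x; ring
      rwa [e] at k3
    · intro x hx
      by_cases hxi : x ∈ interior C
      · refine ⟨interior C, mem_nhdsWithin_of_mem_nhds (isOpen_interior.mem_nhds hxi), interior C,
          isOpen_interior, subset_rfl, fun ψ hψ hψO =>
          hv.isApproximable_of_inward h.compact (e := 0) (B := interior C) one_pos
            (fun y hy τ _ => by simpa using hy.2) hψ hψO⟩
      · obtain ⟨e, B, hB, τ₀, hτ₀, he⟩ := h.exists_inward hn hx hxi
        exact ⟨interior B, mem_nhdsWithin_of_mem_nhds (interior_mem_nhds.2 hB), interior B,
          isOpen_interior, subset_rfl, fun ψ hψ hψO =>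
          hv.isApproximable_of_inward h.compact hτ₀ he hψ (hψO.trans interior_subset)⟩
  obtain ⟨O, hO, hCO, happ⟩ := hkey
  obtain ⟨ψ, hψ, hψ1, hψO, -⟩ := exists_contDiff_cutoff h.compact.isClosed hO hCO
  obtain ⟨w, hw, hwx⟩ := happ ψ hψ hψO (ε / 2) (half_pos hε)
  refine ⟨w, hw, fun x hx => ?_⟩
  have h1 := eventually_nhdsSet_iff_forall.1 hψ1 x hx
  have h2 : ψ x = 1 := h1.self_of_nhds
  have h3 : fderiv ℝ ψ x = 0 := by
    have : ψ =ᶠ[𝓝 x] fun _ => 1 := h1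
    rw [this.fderiv_eq]; simp
  obtain ⟨k1, k2⟩ := hwx x hx
  rw [h2, one_smul] at k1
  rw [h2, h3, zero_apply, zero_sub, one_mul, sub_neg_eq_add] at k2
  refine ⟨by linarith, ?_⟩
  have k3 : |height (w x) - height (v x)| ≤ ε / 2 := by
    rw [← map_sub]; exact (abs_height_le _).trans k1
  have k4 := abs_le.1 k2
  have k5 := abs_le.1 k3
  rw [abs_le]
  constructor <;> linarith [k4.1, k4.2, k5.1, k5.2]

end Approximation

/-! ### The calibration inequality -/

section Comparison

variable {n : ℕ} {C : Set 𝔼[n]} {u : 𝔼[n] → ℝ} {M W : Set 𝔼[n + 1]} {R : ℝ} {F : 𝔼[n + 1] → ℝ}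
  {v : 𝔼[n] → 𝔼[n + 1]}

/-- The weighted area of the graph of `u` over the interior of `C`, as an integral over the base. -/
def graphArea (C : Set 𝔼[n]) (u : 𝔼[n] → ℝ) : ℝ :=
  ∫ x in interior C, Real.exp (u x) * Real.sqrt (1 + ‖fderiv ℝ u x‖ ^ 2)

theorem divergence_exp_smul {w : 𝔼[n] → 𝔼[n + 1]} (hw : ContDiff ℝ 1 w) (p : 𝔼[n + 1]) :
    divergence (fun p => Real.exp (height p) • w (base p)) p =
      Real.exp (height p) * (baseDivergence w (base p) + height (w (base p))) := by
  have h1 : HasFDerivAt (fun p : 𝔼[n + 1] => Real.exp (height p))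
      (Real.exp (height p) • height) p :=
    (Real.hasDerivAt_exp (height p)).comp_hasFDerivAt p height.hasFDerivAt
  have h2 : HasFDerivAt (fun p : 𝔼[n + 1] => w (base p))
      ((fderiv ℝ w (base p)).comp base) p :=
    HasFDerivAt.comp (g := w) p (hw.differentiable one_ne_zero _).hasFDerivAt base.hasFDerivAt
  have h3 : fderiv ℝ (fun p : 𝔼[n + 1] => Real.exp (height p) • w (base p)) p = _ :=
    (h1.smul h2).fderiv
  have hb : ∀ i : Fin n, base (EuclideanSpace.single i.castSucc (1 : ℝ)) =
      EuclideanSpace.single i 1 := fun i => by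
    ext j; simp [base_apply]
  have hh : ∀ i : Fin n, height (EuclideanSpace.single i.castSucc (1 : ℝ)) = 0 := fun i => by
    simp [height_apply, Fin.castSucc_ne_last]
  have hb' : base (EuclideanSpace.single (Fin.last n) (1 : ℝ)) = 0 := by
    ext j; simp [base_apply, Fin.castSucc_ne_last]
  have hh' : height (EuclideanSpace.single (Fin.last n) (1 : ℝ)) = 1 := by
    simp [height_apply]
  unfold divergence baseDivergence
  rw [h3, Fin.sum_univ_castSucc, mul_add, Finset.mul_sum]
  congr 1
  · refine Finset.sum_congr rfl fun i _ => ?_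
    simp [hb, hh]
  · simp [hb', hh', height_apply]

theorem IsCompetitor.integrableOn_graphArea (h : IsCompetitor C u M W) : IntegrableOn
    (fun x => Real.exp (u x) * Real.sqrt (1 + ‖fderiv ℝ u x‖ ^ 2)) (interior C) := by
  obtain ⟨L, hL⟩ := h.fderiv_le
  obtain ⟨B, hB⟩ := h.compact.exists_bound_of_continuousOn
    (Real.continuous_exp.comp_continuousOn h.continuousOn)
  have hfin : volume (interior C) < ⊤ :=
    (measure_mono interior_subset).trans_lt h.compact.measure_lt_top
  have : IsFiniteMeasure (volume.restrict (interior C)) := ⟨by simpa using hfin⟩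
  have hD := h.contDiffOn.continuousOn_fderiv_of_isOpen isOpen_interior le_rfl
  have hcont : ContinuousOn (fun x => Real.exp (u x) * Real.sqrt (1 + ‖fderiv ℝ u x‖ ^ 2))
      (interior C) :=
    (Real.continuous_exp.comp_continuousOn (h.continuousOn.mono interior_subset)).mul
      (Real.continuous_sqrt.comp_continuousOn (continuousOn_const.add (hD.norm.pow 2)))
  refine Integrable.of_bound (hcont.aestronglyMeasurable isOpen_interior.measurableSet)
    (B * Real.sqrt (1 + L ^ 2))
    ((ae_restrict_mem isOpen_interior.measurableSet).mono fun x hx => ?_)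
  rw [norm_mul, Real.norm_of_nonneg (Real.sqrt_nonneg _)]
  have h1 := hB x (interior_subset hx)
  have h2 := hL x hx
  refine mul_le_mul h1 (Real.sqrt_le_sqrt ?_) (Real.sqrt_nonneg _) ((norm_nonneg _).trans h1)
  gcongr

/-- Admissible fields close to the calibrating field, whose flux is almost the area of the graph:
the filling term is small because the divergence is small where the filling does not vanish. -/
theorem IsCalibration.exists_field (hv : IsCalibration C u v) (h : IsCompetitor C u M W)
    (hF : IsFilling C u M W R F) (hRM : ∀ p ∈ M, |height p| < R) (hR : ∀ p ∈ W, |height p| < R) :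
    ∃ c : ℝ, ∀ ε > 0, ∃ Y : 𝔼[n + 1] → 𝔼[n + 1], ContDiff ℝ 1 Y ∧ HasCompactSupport Y ∧
      (∀ p ∈ W, ‖Y p - Real.exp (height p) • v (base p)‖ ≤ ε * Real.exp (height p)) ∧
      graphArea C u - c * ε ≤ flux F C u Y := by
  obtain ⟨L, hL⟩ := h.fderiv_le
  set K : Set 𝔼[n + 1] := {p | base p ∈ C ∧ |height p| ≤ R} with hK
  have hKc : IsCompact K := by
    have h1 : K = (fun y : 𝔼[n] × ℝ => lift y.1 y.2) '' (C ×ˢ Icc (-R) R) := by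
      ext p
      constructor
      · exact fun hp => ⟨(base p, height p), ⟨hp.1, abs_le.1 hp.2⟩, lift_base_height p⟩
      · rintro ⟨y, hy, rfl⟩
        exact ⟨by rw [base_lift]; exact hy.1, by rw [height_lift]; exact abs_le.2 hy.2⟩
    rw [h1]
    exact (h.compact.prod isCompact_Icc).image continuous_lift
  obtain ⟨r, hr⟩ := hKc.isBounded.subset_ball 0
  obtain ⟨κ, hκ, hκ1, hκs, -⟩ := exists_contDiff_cutoff hKc.isClosed Metric.isOpen_ball hr
  have hκc : HasCompactSupport κ := (isCompact_closedBall (0 : 𝔼[n + 1]) r).of_isClosed_subset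
    (isClosed_tsupport κ) (hκs.trans Metric.ball_subset_closedBall)
  have hu : ∀ x ∈ C, |u x| < R := fun x hx => by
    have := hRM (lift x (u x)) (h.mem_iff.2 (by simpa using hx))
    rwa [height_lift] at this
  refine ⟨Real.exp R * volume.real K + (1 + |L|) * Real.exp R * volume.real (interior C),
    fun ε hε => ?_⟩
  obtain ⟨w, hw, hwx⟩ := hv.exists_approx h.toIsGraphHypersurface h.one_le hε
  have hZ : ContDiff ℝ 1 fun p : 𝔼[n + 1] => Real.exp (height p) • w (base p) :=
    (Real.contDiff_exp.comp height.contDiff).smul (hw.comp base.contDiff)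
  set Y : 𝔼[n + 1] → 𝔼[n + 1] := fun p => κ p • (Real.exp (height p) • w (base p)) with hY
  have hYK : ∀ p ∈ K, Y =ᶠ[𝓝 p] fun p => Real.exp (height p) • w (base p) := fun p hp => by
    filter_upwards [eventually_nhdsSet_iff_forall.1 hκ1 p hp] with y hy
    simp only [hY, hy, one_smul]
  have hY1 : ContDiff ℝ 1 Y := contDiff_fun_smul hκ hZ
  have hYc : HasCompactSupport Y := by
    refine hκc.mono fun p hp => ?_
    exact (support_fun_smul_subset κ _ hp).1
  refine ⟨Y, hY1, hYc, fun p hp => ?_, ?_⟩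
  · have hpK : p ∈ K := ⟨h.base_mem p hp, (hR p hp).le⟩
    rw [(hYK p hpK).self_of_nhds, ← smul_sub, norm_smul, Real.norm_of_nonneg (Real.exp_pos _).le,
      mul_comm]
    exact mul_le_mul_of_nonneg_right (hwx _ hpK.1).1 (Real.exp_pos _).le
  have e1 : |∫ p, F p * divergence Y p| ≤ Real.exp R * volume.real K * ε := by
    rw [← setIntegral_eq_integral_of_forall_compl_eq_zero (s := K) (fun p hp => by
      have : F p = 0 := by
        by_cases hpC : base p ∈ C
        · exact hF.eq_zero_of_height p (not_le.1 fun hle => hp ⟨hpC, hle⟩)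
        · exact hF.eq_zero_of_base p hpC
      rw [this, zero_mul])]
    have h1 := norm_setIntegral_le_of_norm_le_const (μ := volume) (s := K)
      (f := fun p => F p * divergence Y p) (C := Real.exp R * ε) hKc.measure_lt_top
      (fun p hp => by
        have h2 : divergence Y p = divergence (fun p => Real.exp (height p) • w (base p)) p := by
          unfold divergence
          rw [(hYK p hp).fderiv_eq]
        rw [h2, divergence_exp_smul hw, norm_mul, norm_mul,
          Real.norm_of_nonneg (Real.exp_pos _).le]
        have h3 : Real.exp (height p) ≤ Real.exp R := Real.exp_le_exp.2 (abs_le.1 hp.2).2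
        have h4 := (hwx _ hp.1).2
        calc ‖F p‖ * (Real.exp (height p) *
              ‖baseDivergence w (base p) + height (w (base p))‖)
            ≤ 1 * (Real.exp R * ε) := by
              gcongr
              · exact hF.abs_le_one p
              · exact h4
          _ = Real.exp R * ε := one_mul _)
    rw [Real.norm_eq_abs] at h1
    calc _ ≤ _ := h1
      _ = _ := by ring
  have e2 : graphArea C u ≤ (∫ x in interior C, (height (Y (graphMap u x)) -
      fderiv ℝ u x (base (Y (graphMap u x))))) +
      (1 + |L|) * Real.exp R * volume.real (interior C) * ε := by
    have hI := h.integrableOn_graph_flux hY1.continuous hYc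
    have hfin : volume (interior C) ≠ ⊤ :=
      ((measure_mono interior_subset).trans_lt h.compact.measure_lt_top).ne
    have e3 : (1 + |L|) * Real.exp R * volume.real (interior C) * ε =
        ∫ x in interior C, ((1 + |L|) * Real.exp R * ε) := by
      rw [setIntegral_const, smul_eq_mul]; ring
    rw [e3, ← integral_add hI (integrableOn_const hfin)]
    refine setIntegral_mono_on h.integrableOn_graphArea (hI.add (integrableOn_const hfin))
      isOpen_interior.measurableSet fun x hx => ?_
    have hxC := interior_subset hx
    have hgK : graphMap u x ∈ K := by
      rw [graphMap_eq_lift]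
      exact ⟨by rwa [base_lift], by rw [height_lift]; exact (hu x hxC).le⟩
    rw [(hYK _ hgK).self_of_nhds, ← hv.flux_eq x hx]
    simp only [graphMap_eq_lift, base_lift, height_lift, map_smul, smul_eq_mul]
    have h5 := (hwx x hxC).1
    have h6 : |height (w x - v x)| ≤ ε := (abs_height_le _).trans h5
    have h7 : |fderiv ℝ u x (base (w x - v x))| ≤ |L| * ε := by
      rw [← Real.norm_eq_abs]
      refine (ContinuousLinearMap.le_opNorm _ _).trans (mul_le_mul ((hL x hx).trans (le_abs_self L))
        ((norm_base_le _).trans h5) (norm_nonneg _) (abs_nonneg _))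
    rw [map_sub] at h6
    rw [map_sub, map_sub] at h7
    have h8 : Real.exp (u x) ≤ Real.exp R := Real.exp_le_exp.2 (abs_lt.1 (hu x hxC)).2.le
    have h9 : height (v x) - fderiv ℝ u x (base (v x)) -
        (height (w x) - fderiv ℝ u x (base (w x))) ≤ (1 + |L|) * ε := by
      linarith [(abs_le.1 h6).1, (abs_le.1 h7).2]
    have h10 : Real.exp (u x) * ((1 + |L|) * ε) ≤ Real.exp R * ((1 + |L|) * ε) := by gcongr
    nlinarith [mul_le_mul_of_nonneg_left h9 (Real.exp_pos (u x)).le]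
  have e4 := (abs_le.1 e1).1
  unfold flux
  linarith

theorem ofReal_le_of_forall_sub_mul_le {I c : ℝ} {J K : ENNReal} (hK : K ≠ ⊤)
    (h : ∀ ε > 0, ENNReal.ofReal (I - c * ε) ≤ J + ENNReal.ofReal ε * K) :
    ENNReal.ofReal I ≤ J := by
  have h1 : Filter.Tendsto (fun ε : ℝ => ENNReal.ofReal (I - c * ε)) (𝓝[>] 0)
      (𝓝 (ENNReal.ofReal (I - c * 0))) := by
    refine ENNReal.tendsto_ofReal ?_
    have : Continuous fun ε : ℝ => I - c * ε := by fun_prop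
    exact (this.tendsto 0).mono_left nhdsWithin_le_nhds
  have h2 : Filter.Tendsto (fun ε : ℝ => J + ENNReal.ofReal ε * K) (𝓝[>] 0)
      (𝓝 (J + ENNReal.ofReal 0 * K)) := by
    refine Filter.Tendsto.const_add J (ENNReal.Tendsto.mul_const
      (ENNReal.tendsto_ofReal ?_) (Or.inr hK))
    exact (continuous_id.tendsto 0).mono_left nhdsWithin_le_nhds
  have h3 := le_of_tendsto_of_tendsto h1 h2 (by
    filter_upwards [self_mem_nhdsWithin] with ε hε using h ε hε)
  simpa using h3

theorem weightedArea_eq (A : Set 𝔼[n + 1]) : weightedArea A =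
    ∫⁻ p in A, ENNReal.ofReal (Real.exp (height p)) ∂(Measure.euclideanHausdorffMeasure n) := rfl

theorem measurable_ofReal_exp_height :
    Measurable fun p : 𝔼[n + 1] => ENNReal.ofReal (Real.exp (height p)) :=
  (ENNReal.continuous_ofReal.comp (Real.continuous_exp.comp height.continuous)).measurable

theorem IsCompetitor.exists_height_lt (h : IsCompetitor C u M W) :
    ∃ R, (∀ p ∈ W, |height p| < R) ∧ ∀ p ∈ M, |height p| < R := by
  obtain ⟨R₁, hR₁⟩ := h.compact_competitor.exists_bound_of_continuousOn
    (height (n := n)).continuous.continuousOn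
  obtain ⟨R₂, hR₂⟩ := h.isCompact.exists_bound_of_continuousOn
    (height (n := n)).continuous.continuousOn
  refine ⟨max R₁ R₂ + 1, fun p hp => ?_, fun p hp => ?_⟩
  · exact ((hR₁ p hp).trans (le_max_left _ _)).trans_lt (lt_add_one _)
  · exact ((hR₂ p hp).trans (le_max_right _ _)).trans_lt (lt_add_one _)

/-- The area of the graph is the limit of the fluxes of fields whose mass on the competitor tends to
the area of the competitor. -/
theorem IsCalibration.graphArea_le (hv : IsCalibration C u v) (h : IsCompetitor C u M W) :
    ENNReal.ofReal (graphArea C u) ≤ weightedArea W := by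
  obtain ⟨R, hR, hRM⟩ := h.exists_height_lt
  obtain ⟨F, hF⟩ := h.exists_filling hR hRM
  obtain ⟨c, hc⟩ := hv.exists_field h hF hRM hR
  rcases eq_or_ne (weightedArea W) ⊤ with htop | htop
  · rw [htop]; exact le_top
  refine ofReal_le_of_forall_sub_mul_le (c := c) htop fun ε hε => ?_
  obtain ⟨Y, hY, hYc, hYW, hYf⟩ := hc ε hε
  refine (ENNReal.ofReal_le_ofReal (hYf.trans (le_abs_self _))).trans ((hF.flux_le h hY hYc).trans ?_)
  rw [weightedArea_eq, ← lintegral_const_mul _ measurable_ofReal_exp_height,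
    ← lintegral_add_left measurable_ofReal_exp_height]
  refine setLIntegral_mono_ae' h.isClosed_competitor.measurableSet (ae_of_all _ fun p hp => ?_)
  rw [← ENNReal.ofReal_mul hε.le, ← ENNReal.ofReal_add (Real.exp_pos _).le (by positivity)]
  refine ENNReal.ofReal_le_ofReal ?_
  have h1 := norm_le_insert' (Y p) (Real.exp (height p) • v (base p))
  have h2 : ‖Real.exp (height p) • v (base p)‖ = Real.exp (height p) := by
    rw [norm_smul, Real.norm_of_nonneg (Real.exp_pos _).le, hv.norm_eq_one _ (h.base_mem p hp),
      mul_one]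
  linarith [hYW p hp]

/-- A hypersurface has positive area near each of its interior points. -/
theorem euclideanHausdorffMeasure_inter_ne_zero {Φ : OpenPartialHomeomorph 𝔼[n + 1] 𝔼[n + 1]}
    (hΦ : IsC1Diffeo Φ) {q : 𝔼[n + 1]} (hq : q ∈ Φ.source)
    (hW : ∀ y ∈ Φ.source, y ∈ W ↔ Φ y (Fin.last n) = 0) (hqW : q ∈ W) {U : Set 𝔼[n + 1]}
    (hU : U ∈ 𝓝 q) : (Measure.euclideanHausdorffMeasure n : Measure 𝔼[n + 1]) (W ∩ U) ≠ 0 := by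
  intro h0
  obtain ⟨K, t, ht, hK⟩ := (hΦ.contDiffAt hq).exists_lipschitzOnWith
  obtain ⟨r, hr, hrt, hrs⟩ := eventually_exists_ball_symm hq (Filter.inter_mem hU ht)
  have h1 : (Measure.euclideanHausdorffMeasure n : Measure 𝔼[n]) (base '' (Φ '' (W ∩ U ∩ t))) = 0 := by
    have hb : LipschitzWith 1 (base : 𝔼[n + 1] → 𝔼[n]) :=
      LipschitzWith.of_dist_le_mul fun x y => by
        rw [NNReal.coe_one, one_mul, dist_eq_norm, dist_eq_norm, ← map_sub]
        exact norm_base_le _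
    refine le_antisymm ((hb.lipschitzOnWith.euclideanHausdorffMeasure_image_le n).trans
      ((mul_le_mul_right ((hK.mono (s := W ∩ U ∩ t)
        inter_subset_right).euclideanHausdorffMeasure_image_le n) _).trans ?_)) zero_le
    rw [measure_mono_null inter_subset_left h0, mul_zero, mul_zero]
  have h2 : Metric.ball (base (Φ q)) r ⊆ base '' (Φ '' (W ∩ U ∩ t)) := by
    intro x hx
    have hq0 : height (Φ q) = 0 := (hW q hq).1 hqW
    have hmem : lift x 0 ∈ Metric.ball (Φ q) r := by
      rw [mem_ball_iff_norm] at hx ⊢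
      have h3 := norm_sq_eq_base_height (lift x 0 - Φ q)
      rw [map_sub, map_sub, base_lift, height_lift, hq0, sub_zero] at h3
      have h4 : ‖lift x 0 - Φ q‖ ^ 2 = ‖x - base (Φ q)‖ ^ 2 := by rw [h3]; ring
      rw [pow_left_inj₀ (norm_nonneg _) (norm_nonneg _) two_ne_zero] at h4
      rwa [h4]
    have hr' := Φ.right_inv (hrt hmem)
    refine ⟨_, ⟨Φ.symm (lift x 0), ⟨⟨?_, (hrs _ hmem).1⟩, (hrs _ hmem).2⟩, rfl⟩, ?_⟩
    · rw [hW _ (Φ.map_target (hrt hmem)), hr', ← height_apply, height_lift]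
    · rw [hr', base_lift]
  rw [EuclideanSpace.euclideanHausdorffMeasure_eq_volume] at h1
  exact (Metric.measure_ball_pos volume (base (Φ q)) hr).ne' (measure_mono_null h2 h1)

/-- If the competitor does not have more area than the graph, then its normal at each point off the
boundary is the calibrating field. -/
theorem IsCalibration.exists_chart_of_le (hv : IsCalibration C u v) (h : IsCompetitor C u M W)
    (hA : weightedArea W ≤ ENNReal.ofReal (graphArea C u)) {q : 𝔼[n + 1]} (hqW : q ∈ W)
    (hq : q ∉ hypersurfaceBoundary M) :
    ∃ Φ : OpenPartialHomeomorph 𝔼[n + 1] 𝔼[n + 1], IsC1Diffeo Φ ∧ q ∈ Φ.source ∧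
      (∀ y ∈ Φ.source, y ∈ W ↔ Φ y (Fin.last n) = 0) ∧
      ∀ e, fderiv ℝ (fun y => Φ y (Fin.last n)) q e = 0 ↔ inner ℝ (v (base q)) e = 0 := by
  obtain ⟨R, hR, hRM⟩ := h.exists_height_lt
  obtain ⟨F, hF⟩ := h.exists_filling hR hRM
  obtain ⟨c, hc⟩ := hv.exists_field h hF hRM hR
  obtain ⟨Φ, ν, hΦ, hqs, hΦW, hν, hker, hflux⟩ := hF.exists_flux_le_add h hq hqW
  have hv1 := hv.norm_eq_one _ (h.base_mem q hqW)
  refine ⟨Φ, hΦ, hqs, hΦW, fun e => ?_⟩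
  rw [hker]
  suffices hs : 1 ≤ |inner ℝ ν (v (base q))| by
    have h1 : |inner ℝ ν (v (base q))| = 1 := le_antisymm (by
      simpa [hν, hv1] using abs_real_inner_le_norm ν (v (base q))) hs
    rcases abs_eq zero_le_one |>.1 h1 with h2 | h2
    · rw [(inner_eq_one_iff_of_norm_eq_one hν hv1).1 h2]
    · have h3 : inner ℝ ν (-v (base q)) = 1 := by rw [inner_neg_right, h2, neg_neg]
      rw [(inner_eq_one_iff_of_norm_eq_one hν (by rwa [norm_neg])).1 h3, inner_neg_left, neg_eq_zero]
  by_contra! hlt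
  -- If the field is not normal at `q`, its flux through `W` near `q` loses a fixed fraction of the
  -- area: one `δ` is lost to the error of the flux bound and one to the variation of `v`.
  set δ : ℝ := (1 - |inner ℝ ν (v (base q))|) / 3 with hδ
  have hδ0 : 0 < δ := by rw [hδ]; linarith
  have hδ1 : δ ≤ 1 := by rw [hδ]; linarith [abs_nonneg (inner ℝ ν (v (base q)))]
  obtain ⟨U, hU, hUb⟩ := hflux δ hδ0
  have hcont : ∀ᶠ p in 𝓝 q, base p ∈ C → |inner ℝ ν (v (base p))| < 1 - 2 * δ := by
    have h1 : ContinuousWithinAt (fun p => |inner ℝ ν (v (base p))|) (base ⁻¹' C) q := by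
      have h2 : ContinuousWithinAt (fun p => v (base p)) (base ⁻¹' C) q :=
        (hv.continuousOn _ (h.base_mem q hqW)).comp base.continuous.continuousWithinAt
          fun y hy => hy
      exact ((innerSL ℝ ν).continuous.continuousAt.comp_continuousWithinAt h2).abs
    have h3 : |inner ℝ ν (v (base q))| < 1 - 2 * δ := by rw [hδ]; linarith
    exact eventually_nhdsWithin_iff.1 (h1.eventually (gt_mem_nhds h3))
  obtain ⟨O, hO, hOo, hqO⟩ := eventually_nhds_iff.1 (hcont.and hU)
  obtain ⟨χ, hχ, hχ1, hχs, hχ01⟩ := exists_contDiff_cutoff (isClosed_singleton (x := q)) hOo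
    (singleton_subset_iff.2 hqO)
  have hχm := hχ.continuous
  have hχq : χ q = 1 := (eventually_nhdsSet_iff_forall.1 hχ1 q rfl).self_of_nhds
  have hm1 : Measurable fun p : 𝔼[n + 1] =>
      ENNReal.ofReal (Real.exp (height p) * (1 - δ * χ p)) :=
    (ENNReal.continuous_ofReal.comp (by fun_prop)).measurable
  have hm2 : Measurable fun p : 𝔼[n + 1] => ENNReal.ofReal (Real.exp (height p) * (δ * χ p)) :=
    (ENNReal.continuous_ofReal.comp (by fun_prop)).measurable
  have hAtop : weightedArea W ≠ ⊤ := (hA.trans_lt ENNReal.ofReal_lt_top).ne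
  set J := ∫⁻ p in W, ENNReal.ofReal (Real.exp (height p) * (1 - δ * χ p))
    ∂(Measure.euclideanHausdorffMeasure n) with hJ
  -- the area of the graph is at most the weighted area of `W` reduced near `q`
  have hIJ : ENNReal.ofReal (graphArea C u) ≤ J := by
    refine ofReal_le_of_forall_sub_mul_le (c := c) (K := ENNReal.ofReal 2 * weightedArea W)
      (ENNReal.mul_ne_top ENNReal.ofReal_ne_top hAtop) fun ε hε => ?_
    obtain ⟨Y, hY, hYc, hYW, hYf⟩ := hc ε hε
    refine (ENNReal.ofReal_le_ofReal (hYf.trans (le_abs_self _))).trans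
      ((hUb χ hχ (fun p hp => (hO p (hχs hp)).2) hχ01 Y hY hYc).trans ?_)
    rw [weightedArea_eq, ← mul_assoc, ← ENNReal.ofReal_mul hε.le,
      ← lintegral_const_mul _ measurable_ofReal_exp_height, hJ, ← lintegral_add_left hm1]
    refine setLIntegral_mono_ae' h.isClosed_competitor.measurableSet (ae_of_all _ fun p hp => ?_)
    have hχp := hχ01 p
    have hE := Real.exp_pos (height p)
    have h3 : 0 ≤ 1 - δ * χ p := by nlinarith [hχp.1, hχp.2]
    rw [← ENNReal.ofReal_mul (by positivity), ← ENNReal.ofReal_add (by positivity) (by positivity)]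
    refine ENNReal.ofReal_le_ofReal ?_
    have h1 := norm_le_insert' (Y p) (Real.exp (height p) • v (base p))
    have h2 : ‖Real.exp (height p) • v (base p)‖ = Real.exp (height p) := by
      rw [norm_smul, Real.norm_of_nonneg hE.le, hv.norm_eq_one _ (h.base_mem p hp), mul_one]
    have hYp := hYW p hp
    have hn : ‖Y p‖ ≤ Real.exp (height p) * (1 + ε) := by linarith
    have hk2 : (1 - χ p) * ‖Y p‖ ≤ (1 - χ p) * (Real.exp (height p) * (1 + ε)) :=
      mul_le_mul_of_nonneg_left hn (by linarith [hχp.2])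
    by_cases hp0 : χ p = 0
    · rw [hp0] at hk2 ⊢
      nlinarith [mul_pos hE hε]
    · have hpO := (hO p (hχs (subset_tsupport _ hp0))).1 (h.base_mem p hp)
      have h4 : |inner ℝ ν (Y p)| ≤ Real.exp (height p) * (1 - 2 * δ + ε) := by
        have e1 : inner ℝ ν (Y p) = inner ℝ ν (Y p - Real.exp (height p) • v (base p)) +
            Real.exp (height p) * inner ℝ ν (v (base p)) := by
          rw [inner_sub_right, inner_smul_right]; ring
        have e2 := abs_real_inner_le_norm ν (Y p - Real.exp (height p) • v (base p))
        rw [hν, one_mul] at e2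
        rw [e1]
        refine (abs_add_le _ _).trans ?_
        rw [abs_mul, abs_of_pos hE]
        nlinarith [mul_le_mul_of_nonneg_left hpO.le hE.le]
      have hk1 : χ p * (|inner ℝ ν (Y p)| + δ * ‖Y p‖) ≤
          χ p * (Real.exp (height p) * (1 - 2 * δ + ε) +
            δ * (Real.exp (height p) * (1 + ε))) := by
        refine mul_le_mul_of_nonneg_left ?_ hχp.1
        nlinarith [mul_le_mul_of_nonneg_left hn hδ0.le]
      have hk3 : χ p * (1 - 2 * δ + ε + δ * (1 + ε)) + (1 - χ p) * (1 + ε) ≤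
          (1 - δ * χ p) + ε * 2 := by
        have : χ p * δ ≤ 1 := by nlinarith [hχp.1, hχp.2]
        nlinarith [mul_le_mul_of_nonneg_right this hε.le]
      nlinarith [mul_le_mul_of_nonneg_left hk3 hE.le]
  have hsum : J + ∫⁻ p in W, ENNReal.ofReal (Real.exp (height p) * (δ * χ p))
      ∂(Measure.euclideanHausdorffMeasure n) = weightedArea W := by
    rw [hJ, ← lintegral_add_left hm1, weightedArea_eq]
    refine lintegral_congr fun p => ?_
    have hχp := hχ01 p
    have h3 : 0 ≤ 1 - δ * χ p := by nlinarith [hχp.1, hχp.2]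
    rw [← ENNReal.ofReal_add (mul_nonneg (Real.exp_pos _).le h3)
      (mul_nonneg (Real.exp_pos _).le (mul_nonneg hδ0.le hχp.1))]
    congr 1; ring
  have hJtop : J ≠ ⊤ := fun htop => by
    rw [htop, top_add] at hsum
    exact hAtop hsum.symm
  have hzero : ∫⁻ p in W, ENNReal.ofReal (Real.exp (height p) * (δ * χ p))
      ∂(Measure.euclideanHausdorffMeasure n) = 0 := by
    have h1 : J + ∫⁻ p in W, ENNReal.ofReal (Real.exp (height p) * (δ * χ p))
        ∂(Measure.euclideanHausdorffMeasure n) ≤ J + 0 := by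
      rw [hsum, add_zero]; exact hA.trans hIJ
    exact le_antisymm ((ENNReal.add_le_add_iff_left hJtop).1 h1) zero_le
  have hVo : IsOpen {p | 0 < χ p} := isOpen_lt continuous_const hχm
  refine euclideanHausdorffMeasure_inter_ne_zero hΦ hqs hΦW hqW
    (hVo.mem_nhds (show 0 < χ q by rw [hχq]; exact one_pos)) ?_
  rw [inter_comm, ← Measure.restrict_apply hVo.measurableSet]
  rw [lintegral_eq_zero_iff hm2] at hzero
  refine measure_mono_null (fun p hp => ?_) (ae_iff.1 hzero)
  have hp' : 0 < χ p := hp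
  have : 0 < Real.exp (height p) * (δ * χ p) := by positivity
  simpa using this

end Comparison

/-! ### The case of equality -/

section Equality

variable {n : ℕ} {C : Set 𝔼[n]} {u : 𝔼[n] → ℝ} {M W : Set 𝔼[n + 1]} {v : 𝔼[n] → 𝔼[n + 1]}

theorem IsCompetitor.euclideanHausdorffMeasure_boundary (h : IsCompetitor C u M W) :
    (Measure.euclideanHausdorffMeasure n : Measure 𝔼[n + 1]) (hypersurfaceBoundary M) = 0 :=
  euclideanHausdorffMeasure_eq_zero_of_codim_two h.one_le fun p hp => by
    obtain ⟨Φ, hΦ, hps, hS⟩ := h.exists_chart_boundary h.one_le hp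
    exact ⟨Φ, hΦ, hps, fun q hq hqS => (hS q hq).1 hqS⟩

theorem IsCompetitor.weightedArea_graph_le (h : IsCompetitor C u M W) :
    weightedArea M ≤ ENNReal.ofReal (graphArea C u) := by
  have hsub : M ⊆ graphMap u '' interior C ∪ hypersurfaceBoundary M := fun p hp => by
    by_cases hpi : base p ∈ interior C
    · refine Or.inl ⟨base p, hpi, ?_⟩
      rw [graphMap_eq_lift, ← (h.mem_iff.1 hp).2, lift_base_height]
    · exact Or.inr ((h.mem_boundary_iff h.one_le).2 ⟨hp, hpi⟩)
  rw [weightedArea_eq]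
  refine (lintegral_mono_set hsub).trans ((lintegral_union_le _ _ _).trans ?_)
  rw [setLIntegral_measure_zero _ _ h.euclideanHausdorffMeasure_boundary, add_zero]
  refine (lintegral_graph_le isOpen_interior h.contDiffOn
    (ENNReal.continuous_ofReal.comp (Real.continuous_exp.comp height.continuous))).trans
    (le_of_eq ?_)
  unfold graphArea
  rw [ofReal_integral_eq_lintegral_ofReal h.integrableOn_graphArea
    (ae_of_all _ fun x => by positivity)]
  refine lintegral_congr fun x => ?_
  rw [ENNReal.ofReal_mul (Real.exp_pos _).le, graphMap_eq_lift, Function.comp_apply,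
    Function.comp_apply, height_lift]

theorem IsCompetitor.graphArea_pos (h : IsCompetitor C u M W) (hC : (interior C).Nonempty) :
    0 < graphArea C u := by
  have hpos : ∀ x, 0 < Real.exp (u x) * Real.sqrt (1 + ‖fderiv ℝ u x‖ ^ 2) := fun x => by
    positivity
  unfold graphArea
  rw [setIntegral_pos_iff_support_of_nonneg_ae (ae_of_all _ fun x => (hpos x).le)
    h.integrableOn_graphArea]
  have : (Function.support fun x => Real.exp (u x) * Real.sqrt (1 + ‖fderiv ℝ u x‖ ^ 2)) =
      univ := eq_univ_of_forall fun x => (hpos x).ne'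
  rw [this, univ_inter]
  exact isOpen_interior.measure_pos volume hC

namespace IsCalibration

/-- If the competitor does not have more area than the graph, then its points off the boundary lie
over the interior of `C`, and each of its relatively open subsets has an open projection there. -/
theorem image_base_mem_nhds_of_le (hv : IsCalibration C u v) (h : IsCompetitor C u M W)
    (hA : weightedArea W ≤ ENNReal.ofReal (graphArea C u)) {q : 𝔼[n + 1]} (hqW : q ∈ W)
    (hq : q ∉ hypersurfaceBoundary M) {A : Set 𝔼[n + 1]} (hAW : ∀ᶠ y in 𝓝 q, y ∈ W → y ∈ A) :
    base '' A ∈ 𝓝 (base q) := by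
  obtain ⟨Φ, hΦ, hqs, hΦW, hker⟩ := hv.exists_chart_of_le h hA hqW hq
  refine image_base_mem_nhds ((EuclideanSpace.proj (𝕜 := ℝ) (Fin.last n)).contDiff.contDiffAt.comp q
    (hΦ.contDiffAt hqs)) ((hΦW q hqs).1 hqW) (fun h0 => ?_) ?_
  · have h1 := (hker (vertical n)).1 h0
    rw [vertical_eq_lift, inner_eq_base_height, base_lift, height_lift, inner_zero_right, zero_add,
      mul_one] at h1
    exact (hv.height_pos _ (h.base_mem q hqW)).ne' h1
  · filter_upwards [hAW, Φ.open_source.mem_nhds hqs] with y h1 h2 h3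
    exact h1 ((hΦW y h2).2 h3)

theorem base_mem_interior_of_le (hv : IsCalibration C u v) (h : IsCompetitor C u M W)
    (hA : weightedArea W ≤ ENNReal.ofReal (graphArea C u)) {q : 𝔼[n + 1]} (hqW : q ∈ W)
    (hq : q ∉ hypersurfaceBoundary M) : base q ∈ interior C := by
  rw [mem_interior_iff_mem_nhds]
  refine Filter.mem_of_superset (hv.image_base_mem_nhds_of_le h hA hqW hq
    (Filter.Eventually.of_forall fun y hy => hy)) ?_
  rintro _ ⟨p, hp, rfl⟩
  exact h.base_mem p hp

/-- If the competitor does not have more area than the graph, then it is tangent to the vertical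
translates of the graph. -/
theorem hasFDerivAt_height_sub (hv : IsCalibration C u v) (h : IsCompetitor C u M W)
    (hA : weightedArea W ≤ ENNReal.ofReal (graphArea C u)) {γ : 𝔼[n] → 𝔼[n + 1]}
    {γ' : 𝔼[n] →L[ℝ] 𝔼[n + 1]} {y : 𝔼[n]} (hγ : HasFDerivAt γ γ' y)
    (hγW : ∀ᶠ z in 𝓝 y, γ z ∈ W) (hγS : γ y ∉ hypersurfaceBoundary M) :
    HasFDerivAt (fun z => height (γ z) - u (base (γ z))) (0 : 𝔼[n] →L[ℝ] ℝ) y := by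
  have hyW : γ y ∈ W := hγW.self_of_nhds
  obtain ⟨Φ, hΦ, hqs, hΦW, hker⟩ := hv.exists_chart_of_le h hA hyW hγS
  have hyi := hv.base_mem_interior_of_le h hA hyW hγS
  have h1 : HasFDerivAt (fun z => Φ (γ z) (Fin.last n))
      ((fderiv ℝ (fun p => Φ p (Fin.last n)) (γ y)).comp γ') y := by
    refine HasFDerivAt.comp (g := fun p => Φ p (Fin.last n)) y ?_ hγ
    have hc : ContDiffAt ℝ 1 (fun p => Φ p (Fin.last n)) (γ y) :=
      (EuclideanSpace.proj (𝕜 := ℝ) (Fin.last n)).contDiff.contDiffAt.comp (γ y) (hΦ.contDiffAt hqs)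
    exact (hc.differentiableAt one_ne_zero).hasFDerivAt
  have h2 : HasFDerivAt (fun z => Φ (γ z) (Fin.last n)) (0 : 𝔼[n] →L[ℝ] ℝ) y := by
    refine (hasFDerivAt_const (0 : ℝ) y).congr_of_eventuallyEq ?_
    filter_upwards [hγW, hγ.continuousAt.eventually (Φ.open_source.mem_nhds hqs)] with z hz hzs
    exact (hΦW _ hzs).1 hz
  have h3 := h1.unique h2
  have hud : HasFDerivAt u (fderiv ℝ u (base (γ y))) (base (γ y)) :=
    ((h.contDiffOn.contDiffAt (isOpen_interior.mem_nhds hyi)).differentiableAt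
      one_ne_zero).hasFDerivAt
  have h4 : HasFDerivAt (fun z => u (base (γ z)))
      ((fderiv ℝ u (base (γ y))).comp (base.comp γ')) y :=
    HasFDerivAt.comp (g := u) (f := fun z => base (γ z)) y hud
      (base.hasFDerivAt.comp y hγ)
  have h5 : HasFDerivAt (fun z => height (γ z)) (height.comp γ') y :=
    height.hasFDerivAt.comp y hγ
  have h6 : height.comp γ' - (fderiv ℝ u (base (γ y))).comp (base.comp γ') = 0 := by
    ext e
    have h7 : fderiv ℝ (fun p => Φ p (Fin.last n)) (γ y) (γ' e) = 0 :=
      congrArg (fun L : 𝔼[n] →L[ℝ] ℝ => L e) h3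
    rw [hker, hv.inner_eq _ hyi] at h7
    exact (mul_eq_zero.1 h7).resolve_left (hv.height_pos _ (interior_subset hyi)).ne'
  rw [← h6]
  exact h5.sub h4

/-- On a competitor with no more area than the graph, `height - u ∘ base` is locally constant off
the boundary. -/
theorem eventually_height_sub_eq (hv : IsCalibration C u v) (h : IsCompetitor C u M W)
    (hA : weightedArea W ≤ ENNReal.ofReal (graphArea C u)) {q : 𝔼[n + 1]} (hqW : q ∈ W)
    (hq : q ∉ hypersurfaceBoundary M) :
    ∀ᶠ y in 𝓝 q, y ∈ W → height y - u (base y) = height q - u (base q) := by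
  obtain ⟨Φ, hΦ, hqs, hΦW, -⟩ := hv.exists_chart_of_le h hA hqW hq
  obtain ⟨r, hr, hrt, hrS⟩ := eventually_exists_ball_symm hqs
    ((h.isClosed_boundary h.one_le).isOpen_compl.mem_nhds hq :
      ∀ᶠ y in 𝓝 q, y ∈ (hypersurfaceBoundary M)ᶜ)
  have hq0 : height (Φ q) = 0 := (hΦW q hqs).1 hqW
  have hlift : ∀ x ∈ Metric.ball (base (Φ q)) r, lift x 0 ∈ Metric.ball (Φ q) r := by
    intro x hx
    rw [mem_ball_iff_norm] at hx ⊢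
    have h3 := norm_sq_eq_base_height (lift x 0 - Φ q)
    rw [map_sub, map_sub, base_lift, height_lift, hq0, sub_zero] at h3
    have h4 : ‖lift x 0 - Φ q‖ ^ 2 = ‖x - base (Φ q)‖ ^ 2 := by rw [h3]; ring
    rw [pow_left_inj₀ (norm_nonneg _) (norm_nonneg _) two_ne_zero] at h4
    rwa [h4]
  have hmemW : ∀ x ∈ Metric.ball (base (Φ q)) r, Φ.symm (lift x 0) ∈ W := fun x hx => by
    have hx' := hlift x hx
    rw [hΦW _ (Φ.map_target (hrt hx')), Φ.right_inv (hrt hx'), ← height_apply, height_lift]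
  set f : 𝔼[n] → ℝ := fun x =>
    height (Φ.symm (lift x 0)) - u (base (Φ.symm (lift x 0))) with hf
  have hfd : ∀ x ∈ Metric.ball (base (Φ q)) r, HasFDerivAt f (0 : 𝔼[n] →L[ℝ] ℝ) x := by
    intro x hx
    have hx' := hrt (hlift x hx)
    have hsd : DifferentiableAt ℝ (fun x => Φ.symm (lift x 0)) x := by
      have h1 := (hΦ.contDiffAt_symm (Φ.map_target hx')).differentiableAt one_ne_zero
      rw [Φ.right_inv hx'] at h1
      have h2 : ContDiff ℝ 1 fun x : 𝔼[n] => lift x 0 :=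
        (contDiff_lift (n := n) (k := 1)).comp (contDiff_id.prodMk contDiff_const)
      exact DifferentiableAt.comp x h1 (h2.differentiable one_ne_zero x)
    refine hv.hasFDerivAt_height_sub h hA (γ := fun x => Φ.symm (lift x 0)) hsd.hasFDerivAt ?_
      (hrS _ (hlift x hx))
    filter_upwards [Metric.isOpen_ball.mem_nhds hx] with z hz using hmemW z hz
  have hconst : ∀ x ∈ Metric.ball (base (Φ q)) r, f x = f (base (Φ q)) := fun x hx =>
    (convex_ball _ _).is_const_of_fderivWithin_eq_zero (𝕜 := ℝ)
      (fun z hz => (hfd z hz).differentiableAt.differentiableWithinAt)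
      (fun z hz => by
        rw [fderivWithin_of_isOpen Metric.isOpen_ball hz, (hfd z hz).fderiv])
      hx (Metric.mem_ball_self hr)
  have hval : ∀ y ∈ Φ.source, y ∈ W → f (base (Φ y)) = height y - u (base y) := by
    intro y hys hyW
    have h1 : lift (base (Φ y)) 0 = Φ y := by
      have h2 : height (Φ y) = 0 := (hΦW y hys).1 hyW
      conv_rhs => rw [← lift_base_height (Φ y), h2]
    simp only [hf]
    rw [h1, Φ.left_inv hys]
  have hc : ContinuousAt (fun y => base (Φ y)) q :=
    base.continuous.continuousAt.comp (Φ.continuousAt hqs)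
  filter_upwards [Φ.open_source.mem_nhds hqs, hc.eventually (Metric.ball_mem_nhds _ hr)]
    with y hys hyb hyW
  rw [← hval y hys hyW, hconst _ hyb, hval q hqs hqW]

/-- A nonzero value of `height - u ∘ base` on the competitor would be attained on a compact set off
the boundary, and the projection of this set to `ℝ^n` would be open and compact. -/
theorem height_sub_eq_zero (hv : IsCalibration C u v) (h : IsCompetitor C u M W)
    (hA : weightedArea W ≤ ENNReal.ofReal (graphArea C u)) {q : 𝔼[n + 1]} (hqW : q ∈ W) :
    height q - u (base q) = 0 := by
  by_contra hne
  set c := height q - u (base q) with hc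
  set K : Set 𝔼[n + 1] := {p | p ∈ W ∧ height p - u (base p) = c} with hK
  have hcont : ContinuousOn (fun p => height p - u (base p)) W :=
    height.continuous.continuousOn.sub
      (h.continuousOn.comp base.continuous.continuousOn fun p hp => h.base_mem p hp)
  have hKc : IsCompact K := by
    have h1 : IsClosed K := hcont.preimage_isClosed_of_isClosed h.isClosed_competitor
      (isClosed_singleton (x := c))
    exact h.compact_competitor.of_isClosed_subset h1 fun p hp => hp.1
  have hKS : ∀ p ∈ K, p ∉ hypersurfaceBoundary M := fun p hp hpS => by
    have h1 := (h.mem_iff.1 hpS.1).2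
    have h2 := hp.2
    rw [h1, sub_self] at h2
    exact hne h2.symm
  have hopen : IsOpen (base '' K) := by
    rw [isOpen_iff_mem_nhds]
    rintro _ ⟨p, hp, rfl⟩
    refine hv.image_base_mem_nhds_of_le h hA hp.1 (hKS p hp) ?_
    filter_upwards [hv.eventually_height_sub_eq h hA hp.1 (hKS p hp)] with y hy hyW
    exact ⟨hyW, (hy hyW).trans hp.2⟩
  have hcomp : IsCompact (base '' K) := hKc.image base.continuous
  have : Nontrivial 𝔼[n] := by
    have : Nonempty (Fin n) := ⟨⟨0, h.one_le⟩⟩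
    infer_instance
  have huniv : base '' K = univ :=
    IsClopen.eq_univ ⟨hcomp.isClosed, hopen⟩ ⟨_, mem_image_of_mem base ⟨hqW, rfl⟩⟩
  exact noncompact_univ 𝔼[n] (huniv ▸ hcomp)

/-- A competitor with no more area than the graph lies on the graph, and the part of the base it
covers is open and closed in the interior of `C`. -/
theorem eq_of_le (hv : IsCalibration C u v) (h : IsCompetitor C u M W)
    (hA : weightedArea W ≤ ENNReal.ofReal (graphArea C u)) : W = M := by
  have hWM : W ⊆ M := fun q hq => h.mem_iff.2
    ⟨h.base_mem q hq, sub_eq_zero.1 (hv.height_sub_eq_zero h hA hq)⟩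
  refine Subset.antisymm hWM fun p hp => ?_
  by_cases hpi : base p ∈ interior C
  swap
  · have h1 := (h.mem_boundary_iff h.one_le).2 ⟨hp, hpi⟩
    rw [h.boundary_eq] at h1
    exact h1.1
  -- otherwise `W` would be contained in the boundary, hence have no area
  have hne : (interior C ∩ base '' W).Nonempty := by
    by_contra hemp
    have h1 : W ⊆ hypersurfaceBoundary M := fun q hq => (h.mem_boundary_iff h.one_le).2
      ⟨hWM hq, fun hi => hemp ⟨base q, hi, q, hq, rfl⟩⟩
    have h2 := hv.graphArea_le h
    rw [weightedArea_eq, setLIntegral_measure_zero _ _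
      (measure_mono_null h1 h.euclideanHausdorffMeasure_boundary)] at h2
    exact (ENNReal.ofReal_pos.2 (h.graphArea_pos ⟨_, hpi⟩)).not_ge h2
  have hopen : IsOpen (interior C ∩ base '' W) := by
    rw [isOpen_iff_mem_nhds]
    rintro _ ⟨hi, q, hq, rfl⟩
    refine Filter.inter_mem (isOpen_interior.mem_nhds hi) (hv.image_base_mem_nhds_of_le h hA hq
      (fun hqS => ((h.mem_boundary_iff h.one_le).1 hqS).2 hi)
      (Filter.Eventually.of_forall fun y hy => hy))
  have hsub : interior C ⊆ interior C ∩ base '' W := by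
    refine h.isPreconnected.subset_left_of_subset_union hopen
      (h.compact_competitor.image base.continuous).isClosed.isOpen_compl ?_ ?_ ?_
    · exact disjoint_left.2 fun x hx hx' => hx' hx.2
    · intro x hx
      by_cases hxW : x ∈ base '' W
      · exact Or.inl ⟨hx, hxW⟩
      · exact Or.inr hxW
    · exact hne.mono fun x hx => ⟨hx.1, hx⟩
  obtain ⟨q, hq, hqp⟩ := (hsub hpi).2
  have h1 : q = p := by
    refine ext_base_height hqp ?_
    rw [(h.mem_iff.1 (hWM hq)).2, (h.mem_iff.1 hp).2, hqp]
  rwa [← h1]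

/-- The graph of a function with a calibration has the least area among its competitors, and it is
the only competitor with this area. -/
theorem weightedArea_le_and_eq_iff (hv : IsCalibration C u v) (h : IsCompetitor C u M W) :
    weightedArea M ≤ weightedArea W ∧ (weightedArea M = weightedArea W ↔ W = M) := by
  refine ⟨h.weightedArea_graph_le.trans (hv.graphArea_le h), fun he => ?_, fun he => by rw [he]⟩
  exact hv.eq_of_le h (he ▸ h.weightedArea_graph_le)

end IsCalibration

end Equality

/-! ### The calibration given by a translating graph -/

section Translator

variable {n : ℕ} {u : 𝔼[n] → ℝ} {x : 𝔼[n]}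

theorem fderiv_graphMap (hu : ContDiffAt ℝ 2 u x) :
    fderiv ℝ (graphMap u) x = graphLinear (fderiv ℝ u x) :=
  (hasStrictFDerivAt_graphMap (hu.hasStrictFDerivAt two_ne_zero)).hasFDerivAt.fderiv

theorem fderiv_fderiv_graphMap_apply (hu : ContDiffAt ℝ 2 u x) (e f : 𝔼[n]) :
    fderiv ℝ (fderiv ℝ (graphMap u)) x e f = fderiv ℝ (fderiv ℝ u) x e f • vertical n := by
  have hF : ContDiffAt ℝ 2 (graphMap u) x :=
    (contDiff_lift (n := n) (k := 2)).contDiffAt.comp x (contDiffAt_id.prodMk hu)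
  have h1 : ∀ {G : Type} [NormedAddCommGroup G] [NormedSpace ℝ G] {g : 𝔼[n] → G},
      ContDiffAt ℝ 2 g x → HasFDerivAt (fun y => fderiv ℝ g y f)
        ((fderiv ℝ (fderiv ℝ g) x).flip f) x := fun hg => by
    have h2 := ((hg.fderiv_right (m := 1) le_rfl).differentiableAt one_ne_zero).hasFDerivAt
    have h3 := h2.clm_apply (hasFDerivAt_const f x)
    refine h3.congr_fderiv ?_
    ext e; simp
  have h2 : (fun y => fderiv ℝ (graphMap u) y f) =ᶠ[𝓝 x] fun y => lift f (fderiv ℝ u y f) := by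
    filter_upwards [hu.eventually (by simp)] with y hy
    rw [fderiv_graphMap hy, graphLinear_apply]
  have h3 : HasFDerivAt (fun y => lift f (fderiv ℝ u y f))
      (((splitEquiv n).symm : 𝔼[n] × ℝ →L[ℝ] 𝔼[n + 1]).comp
        ((0 : 𝔼[n] →L[ℝ] 𝔼[n]).prod ((fderiv ℝ (fderiv ℝ u) x).flip f))) x :=
    ((splitEquiv n).symm.hasFDerivAt).comp x ((hasFDerivAt_const f x).prodMk (h1 hu))
  have h4 := (h1 hF).unique (h3.congr_of_eventuallyEq h2)
  have h5 := congrArg (fun L : 𝔼[n] →L[ℝ] 𝔼[n + 1] => L e) h4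
  have h6 : fderiv ℝ (fderiv ℝ (graphMap u)) x e f = lift 0 (fderiv ℝ (fderiv ℝ u) x e f) := h5
  rw [h6]
  apply ext_base_height <;> simp [vertical_eq_lift]

theorem normalPart_vertical_ne_zero (hu : ContDiffAt ℝ 2 u x) :
    normalPart (graphMap u) x (vertical n) ≠ 0 := by
  intro h
  unfold normalPart at h
  rw [Submodule.starProjection_apply_eq_zero_iff, Submodule.orthogonal_orthogonal] at h
  obtain ⟨e, he⟩ := h
  have he' : lift e (fderiv ℝ u x e) = lift 0 1 := by
    rw [← vertical_eq_lift, ← he, fderiv_graphMap hu]; rfl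
  have h1 := congrArg base he'
  have h2 := congrArg height he'
  rw [base_lift, base_lift] at h1
  rw [height_lift, height_lift, h1, map_zero] at h2
  exact zero_ne_one h2

theorem inducedMetric_inv (hu : ContDiffAt ℝ 2 u x) (i j : Fin n) :
    (inducedMetric (graphMap u) x)⁻¹ i j = (1 : Matrix (Fin n) (Fin n) ℝ) i j -
      fderiv ℝ u x (EuclideanSpace.single i 1) * fderiv ℝ u x (EuclideanSpace.single j 1) /
        (1 + ‖fderiv ℝ u x‖ ^ 2) := by
  let p : Fin n → ℝ := fun i => fderiv ℝ u x (EuclideanSpace.single i 1)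
  have hQ : (1 : ℝ) + ‖fderiv ℝ u x‖ ^ 2 ≠ 0 := by positivity
  have hpp : p ⬝ᵥ p = ‖fderiv ℝ u x‖ ^ 2 := by
    rw [← sum_apply_single_sq]; simp [dotProduct, p, sq]
  have hg : inducedMetric (graphMap u) x = 1 + Matrix.vecMulVec p p := by
    ext i j
    rw [inducedMetric, Matrix.of_apply, fderiv_graphMap hu, inner_eq_base_height]
    simp only [graphLinear_apply, base_lift, height_lift, inner_single_single, Matrix.add_apply,
      Matrix.vecMulVec_apply, p]
  have hinv : (inducedMetric (graphMap u) x)⁻¹ =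
      1 - (1 + ‖fderiv ℝ u x‖ ^ 2)⁻¹ • Matrix.vecMulVec p p := by
    refine Matrix.inv_eq_right_inv ?_
    rw [hg, add_mul, mul_sub, mul_sub, one_mul, one_mul, mul_one, Matrix.mul_smul,
      Matrix.vecMulVec_mul_vecMulVec, hpp, Matrix.vecMulVec_smul]
    have : Matrix.vecMulVec p p = (1 + ‖fderiv ℝ u x‖ ^ 2)⁻¹ • Matrix.vecMulVec p p +
        (1 + ‖fderiv ℝ u x‖ ^ 2)⁻¹ • ‖fderiv ℝ u x‖ ^ 2 • Matrix.vecMulVec p p := by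
      rw [← smul_add, ← one_smul ℝ (Matrix.vecMulVec p p), smul_smul, ← add_smul, smul_smul,
        mul_one, inv_mul_cancel₀ hQ]
    nth_rewrite 2 [this]
    abel
  rw [hinv, Matrix.sub_apply, Matrix.smul_apply, Matrix.vecMulVec_apply, smul_eq_mul,
    inv_mul_eq_div]

/-- The scalar form of the translator equation: the trace of the Hessian of `u` with respect to the
induced metric is one. -/
theorem translator_equation (hu : ContDiffAt ℝ 2 u x)
    (h : meanCurvatureVector (graphMap u) x = normalPart (graphMap u) x (vertical n)) :
    (∑ i, fderiv ℝ (fderiv ℝ u) x (EuclideanSpace.single i 1) (EuclideanSpace.single i 1)) -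
      (∑ i, ∑ j, fderiv ℝ u x (EuclideanSpace.single i 1) *
        fderiv ℝ u x (EuclideanSpace.single j 1) *
        fderiv ℝ (fderiv ℝ u) x (EuclideanSpace.single i 1) (EuclideanSpace.single j 1)) /
        (1 + ‖fderiv ℝ u x‖ ^ 2) = 1 := by
  have h1 : ∀ i j, secondFundamentalForm (graphMap u) x i j =
      fderiv ℝ (fderiv ℝ u) x (EuclideanSpace.single i 1) (EuclideanSpace.single j 1) •
        normalPart (graphMap u) x (vertical n) := fun i j => by
    rw [secondFundamentalForm, fderiv_fderiv_graphMap_apply hu, normalPart, map_smul]; rfl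
  unfold meanCurvatureVector at h
  simp only [h1, smul_smul, ← Finset.sum_smul] at h
  have h2 := sub_eq_zero.2 h
  nth_rewrite 2 [← one_smul ℝ (normalPart (graphMap u) x (vertical n))] at h2
  rw [← sub_smul, smul_eq_zero, or_iff_left (normalPart_vertical_ne_zero hu), sub_eq_zero] at h2
  refine Eq.trans ?_ h2
  rw [Finset.sum_div, ← Finset.sum_sub_distrib]
  refine Finset.sum_congr rfl fun i _ => ?_
  simp only [inducedMetric_inv hu, sub_mul, Finset.sum_sub_distrib, Finset.sum_div]
  congr 1
  · simp [Matrix.one_apply]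
  · refine Finset.sum_congr rfl fun j _ => ?_
    ring

/-- The upward unit normal of a graph with gradient `p`. -/
def graphNormal (p : 𝔼[n] →L[ℝ] ℝ) : 𝔼[n + 1] :=
  (Real.sqrt (1 + ‖p‖ ^ 2))⁻¹ • lift (-(InnerProductSpace.toDual ℝ 𝔼[n]).symm p) 1

theorem base_graphNormal (p : 𝔼[n] →L[ℝ] ℝ) : base (graphNormal p) =
    (Real.sqrt (1 + ‖p‖ ^ 2))⁻¹ • -(InnerProductSpace.toDual ℝ 𝔼[n]).symm p := by
  rw [graphNormal, map_smul, base_lift]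

theorem height_graphNormal (p : 𝔼[n] →L[ℝ] ℝ) :
    height (graphNormal p) = (Real.sqrt (1 + ‖p‖ ^ 2))⁻¹ := by
  rw [graphNormal, map_smul, height_lift, smul_eq_mul, mul_one]

theorem inner_graphNormal (p : 𝔼[n] →L[ℝ] ℝ) (e : 𝔼[n + 1]) :
    inner ℝ (graphNormal p) e = height (graphNormal p) * (height e - p (base e)) := by
  rw [inner_eq_base_height, base_graphNormal, height_graphNormal, real_inner_smul_left,
    inner_neg_left, InnerProductSpace.toDual_symm_apply]
  ring

theorem apply_base_graphNormal (p : 𝔼[n] →L[ℝ] ℝ) :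
    p (base (graphNormal p)) = -((Real.sqrt (1 + ‖p‖ ^ 2))⁻¹ * ‖p‖ ^ 2) := by
  rw [base_graphNormal, map_smul, map_neg, ← InnerProductSpace.toDual_symm_apply,
    real_inner_self_eq_norm_sq, LinearIsometryEquiv.norm_map, smul_eq_mul, mul_neg]

theorem graphNormal_flux (p : 𝔼[n] →L[ℝ] ℝ) :
    height (graphNormal p) - p (base (graphNormal p)) = Real.sqrt (1 + ‖p‖ ^ 2) := by
  have h : Real.sqrt (1 + ‖p‖ ^ 2) ≠ 0 := by positivity
  rw [height_graphNormal, apply_base_graphNormal, sub_neg_eq_add, ← mul_one_add, inv_mul_eq_div,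
    div_eq_iff h, Real.mul_self_sqrt (by positivity)]

theorem norm_graphNormal (p : 𝔼[n] →L[ℝ] ℝ) : ‖graphNormal p‖ = 1 := by
  have h : Real.sqrt (1 + ‖p‖ ^ 2) ≠ 0 := by positivity
  have h1 := inner_graphNormal p (graphNormal p)
  rw [graphNormal_flux, height_graphNormal, inv_mul_cancel₀ h, real_inner_self_eq_norm_sq] at h1
  exact (pow_eq_one_iff_of_nonneg (norm_nonneg _) two_ne_zero).1 h1

theorem contDiff_graphNormal {k : WithTop ℕ∞} : ContDiff ℝ k (graphNormal (n := n)) := by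
  have h1 : ContDiff ℝ k fun p : 𝔼[n] →L[ℝ] ℝ => ‖p‖ ^ 2 := by
    have : (fun p : 𝔼[n] →L[ℝ] ℝ => ‖p‖ ^ 2) =
        fun p => ‖(InnerProductSpace.toDual ℝ 𝔼[n]).symm p‖ ^ 2 := by
      ext p; rw [LinearIsometryEquiv.norm_map]
    rw [this]
    exact (contDiff_norm_sq ℝ).comp (InnerProductSpace.toDual ℝ 𝔼[n]).symm.contDiff
  have h2 : ContDiff ℝ k fun p : 𝔼[n] →L[ℝ] ℝ => (Real.sqrt (1 + ‖p‖ ^ 2))⁻¹ :=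
    ((contDiff_const.add h1).sqrt fun p => by positivity).inv fun p => by positivity
  have h3 : ContDiff ℝ k fun p : 𝔼[n] →L[ℝ] ℝ =>
      lift (-(InnerProductSpace.toDual ℝ 𝔼[n]).symm p) (1 : ℝ) :=
    contDiff_lift.comp ((InnerProductSpace.toDual ℝ 𝔼[n]).symm.contDiff.neg.prodMk contDiff_const)
  exact h2.smul h3

/-- The translator equation in divergence form. -/
theorem baseDivergence_graphNormal (hu : ContDiffAt ℝ 2 u x)
    (h : meanCurvatureVector (graphMap u) x = normalPart (graphMap u) x (vertical n)) :
    baseDivergence (fun y => graphNormal (fderiv ℝ u y)) x =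
      -height (graphNormal (fderiv ℝ u x)) := by
  set A := fderiv ℝ (fderiv ℝ u) x with hA
  set p : Fin n → ℝ := fun i => fderiv ℝ u x (EuclideanSpace.single i 1) with hp
  set Q : ℝ := 1 + ‖fderiv ℝ u x‖ ^ 2 with hQ
  have hQ0 : 0 < Q := by positivity
  have hs0 : Real.sqrt Q ≠ 0 := by positivity
  have hD : HasFDerivAt (fderiv ℝ u) A x :=
    ((hu.fderiv_right (m := 1) le_rfl).differentiableAt one_ne_zero).hasFDerivAt
  have hDi : ∀ i : Fin n, HasFDerivAt (fun y => fderiv ℝ u y (EuclideanSpace.single i 1))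
      (A.flip (EuclideanSpace.single i 1)) x := fun i => by
    refine (hD.clm_apply (hasFDerivAt_const (EuclideanSpace.single i (1 : ℝ)) x)).congr_fderiv ?_
    ext e; simp
  have hQd : HasFDerivAt (fun y => 1 + ‖fderiv ℝ u y‖ ^ 2)
      (∑ j, (2 * p j) • A.flip (EuclideanSpace.single j 1)) x := by
    have h1 : HasFDerivAt (fun y => ∑ j, fderiv ℝ u y (EuclideanSpace.single j 1) ^ 2)
        (∑ j, (2 * p j) • A.flip (EuclideanSpace.single j 1)) x := by
      refine HasFDerivAt.fun_sum fun j _ => ?_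
      have h2 := (hDi j).pow 2
      simpa using h2
    simp only [sum_apply_single_sq] at h1
    exact h1.const_add 1
  have hφ : HasDerivAt (fun t => (Real.sqrt t)⁻¹) (-(1 / (2 * Real.sqrt Q)) / Real.sqrt Q ^ 2) Q :=
    (Real.hasDerivAt_sqrt hQ0.ne').inv hs0
  have hφd : HasFDerivAt (fun y => (Real.sqrt (1 + ‖fderiv ℝ u y‖ ^ 2))⁻¹)
      ((-(1 / (2 * Real.sqrt Q)) / Real.sqrt Q ^ 2) •
        ∑ j, (2 * p j) • A.flip (EuclideanSpace.single j 1)) x :=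
    HasDerivAt.comp_hasFDerivAt (h₂ := fun t => (Real.sqrt t)⁻¹)
      (f := fun y => 1 + ‖fderiv ℝ u y‖ ^ 2) x hφ hQd
  have hcoord : ∀ i : Fin n, (fun y => graphNormal (fderiv ℝ u y) i.castSucc) = fun y =>
      -((Real.sqrt (1 + ‖fderiv ℝ u y‖ ^ 2))⁻¹ * fderiv ℝ u y (EuclideanSpace.single i 1)) := by
    intro i
    ext1 y
    rw [← base_apply, base_graphNormal, PiLp.smul_apply, PiLp.neg_apply, smul_eq_mul, mul_neg]
    congr 2
    have := InnerProductSpace.toDual_symm_apply (𝕜 := ℝ) (x := EuclideanSpace.single i (1 : ℝ))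
      (y := fderiv ℝ u y)
    rw [← this, EuclideanSpace.inner_single_right]
    simp
  have hdiff : DifferentiableAt ℝ (fun y => graphNormal (fderiv ℝ u y)) x :=
    ((contDiff_graphNormal (k := 1)).differentiable one_ne_zero _).comp x hD.differentiableAt
  have hi : ∀ i : Fin n, fderiv ℝ (fun y => graphNormal (fderiv ℝ u y)) x
      (EuclideanSpace.single i 1) i.castSucc = (Real.sqrt Q)⁻¹ *
      ((∑ j, p i * p j * A (EuclideanSpace.single i 1) (EuclideanSpace.single j 1)) / Q -
        A (EuclideanSpace.single i 1) (EuclideanSpace.single i 1)) := by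
    intro i
    rw [← fderiv_coord hdiff, hcoord i]
    have h1 : fderiv ℝ (fun y => -((Real.sqrt (1 + ‖fderiv ℝ u y‖ ^ 2))⁻¹ *
      fderiv ℝ u y (EuclideanSpace.single i 1))) x = _ := ((hφd.mul (hDi i)).neg).fderiv
    rw [h1]
    have h2 : Real.sqrt Q ^ 2 = Q := Real.sq_sqrt hQ0.le
    simp only [neg_apply, add_apply, smul_apply, ContinuousLinearMap.flip_apply, sum_apply,
      smul_eq_mul]
    rw [h2, Finset.sum_div, ← hQ]
    have h3 : ∑ j, 2 * p j * A (EuclideanSpace.single i 1) (EuclideanSpace.single j 1) =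
        2 * ∑ j, p j * A (EuclideanSpace.single i 1) (EuclideanSpace.single j 1) := by
      rw [Finset.mul_sum]; exact Finset.sum_congr rfl fun j _ => by ring
    have h4 : ∑ j, p i * p j * A (EuclideanSpace.single i 1) (EuclideanSpace.single j 1) / Q =
        p i * (∑ j, p j * A (EuclideanSpace.single i 1) (EuclideanSpace.single j 1)) / Q := by
      rw [Finset.mul_sum, Finset.sum_div]; exact Finset.sum_congr rfl fun j _ => by ring
    rw [h3, h4]
    change -((Real.sqrt Q)⁻¹ * _ + p i * _) = _
    field_simp
    ring
  have ht := translator_equation hu h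
  unfold baseDivergence
  rw [Finset.sum_congr rfl fun i _ => hi i, ← Finset.mul_sum, height_graphNormal, ← hQ,
    Finset.sum_sub_distrib, ← Finset.sum_div]
  rw [← hQ, ← hA] at ht
  have h5 : (∑ i, ∑ j, p i * p j * A (EuclideanSpace.single i 1) (EuclideanSpace.single j 1)) / Q -
      ∑ i, A (EuclideanSpace.single i 1) (EuclideanSpace.single i 1) = -1 := by
    linarith
  rw [h5, mul_neg, mul_one]

end Translator

section Extension

variable {n : ℕ} {C : Set 𝔼[n]} {u : 𝔼[n] → ℝ}

/-- The gradient of a function that is `C²` up to the boundary has a limit at each point. -/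
theorem ContDiffOn.exists_tendsto_fderiv (hu : ContDiffOn ℝ 2 u C) {x : 𝔼[n]} (hx : x ∈ C) :
    ∃ p, Filter.Tendsto (fderiv ℝ u) (𝓝[interior C] x) (𝓝 p) := by
  have h1 : ContDiffWithinAt ℝ (1 + 1) u C x := by
    rw [one_add_one_eq_two]; exact hu x hx
  obtain ⟨s, hs, -, -, f', hf', hf'c⟩ :=
    (contDiffWithinAt_succ_iff_hasFDerivWithinAt' (by simp)).1 h1
  rw [insert_eq_of_mem hx] at hs
  refine ⟨f' x, ((hf'c.continuousWithinAt.mono interior_subset).tendsto).congr' ?_⟩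
  filter_upwards [nhdsWithin_mono x interior_subset hs, self_mem_nhdsWithin] with z hz hzC
  exact ((hf' z hz).hasFDerivAt (mem_interior_iff_mem_nhds.1 hzC)).fderiv.symm

theorem ContDiffOn.continuousOn_extendFrom_fderiv (hu : ContDiffOn ℝ 2 u C)
    (hC : C ⊆ closure (interior C)) :
    ContinuousOn (extendFrom (interior C) (fderiv ℝ u)) C :=
  continuousOn_extendFrom hC fun _ hx => hu.exists_tendsto_fderiv hx

theorem ContDiffOn.extendFrom_fderiv_eq (hu : ContDiffOn ℝ 2 u C) {x : 𝔼[n]}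
    (hx : x ∈ interior C) : extendFrom (interior C) (fderiv ℝ u) x = fderiv ℝ u x := by
  have h : ContinuousAt (fderiv ℝ u) x :=
    (((hu.contDiffAt (mem_interior_iff_mem_nhds.1 hx)).fderiv_right (m := 1)
      le_rfl).continuousAt)
  exact extendFrom_eq (subset_closure hx) (h.tendsto.mono_left nhdsWithin_le_nhds)

/-- The upward unit normal of a translating graph, extended continuously to the boundary, is a
calibration. The divergence identity passes from `Ω` to the interior of its closure by density. -/
theorem IsGraphicTranslator.isCalibration {Ω : Set 𝔼[n]} (hΩ : IsOpen Ω)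
    (hu : IsGraphicTranslator Ω u) :
    IsCalibration (closure Ω) u
      fun x => graphNormal (extendFrom (interior (closure Ω)) (fderiv ℝ u) x) := by
  have hsub : Ω ⊆ interior (closure Ω) := hΩ.subset_interior_closure
  have hG := hu.contDiffOn.continuousOn_extendFrom_fderiv (closure_mono hsub)
  have hGeq : ∀ x ∈ interior (closure Ω), extendFrom (interior (closure Ω)) (fderiv ℝ u) x =
      fderiv ℝ u x := fun x hx => hu.contDiffOn.extendFrom_fderiv_eq hx
  have hev : ∀ x ∈ interior (closure Ω),
      (fun x => graphNormal (extendFrom (interior (closure Ω)) (fderiv ℝ u) x)) =ᶠ[𝓝 x]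
        fun x => graphNormal (fderiv ℝ u x) := fun x hx => by
    filter_upwards [isOpen_interior.mem_nhds hx] with y hy
    rw [hGeq y hy]
  have huC : ∀ x ∈ interior (closure Ω), ContDiffAt ℝ 2 u x := fun x hx =>
    hu.contDiffOn.contDiffAt (mem_interior_iff_mem_nhds.1 hx)
  have hv1 : ContDiffOn ℝ 1
      (fun x => graphNormal (extendFrom (interior (closure Ω)) (fderiv ℝ u) x))
      (interior (closure Ω)) := fun x hx =>
    ((contDiff_graphNormal.contDiffAt.comp x
      ((huC x hx).fderiv_right (m := 1) le_rfl)).congr_of_eventuallyEq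
        (hev x hx)).contDiffWithinAt
  have hv0 : ContinuousOn
      (fun x => graphNormal (extendFrom (interior (closure Ω)) (fderiv ℝ u) x)) (closure Ω) :=
    (contDiff_graphNormal (k := 0)).continuous.comp_continuousOn hG
  refine ⟨hv0, fun x _ => norm_graphNormal _, hv1, fun x _ => ?_, fun x hx e => ?_, fun x hx => ?_,
    fun x hx => ?_⟩
  · rw [height_graphNormal]; positivity
  · simp only [hGeq x hx]; exact inner_graphNormal _ e
  · simp only [hGeq x hx]; exact graphNormal_flux _
  · have hcl : x ∈ closure Ω := interior_subset hx
    have hc1 : ContinuousOn (fun y => baseDivergence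
        (fun x => graphNormal (extendFrom (interior (closure Ω)) (fderiv ℝ u) x)) y +
        height (graphNormal (extendFrom (interior (closure Ω)) (fderiv ℝ u) y)))
        (interior (closure Ω)) := by
      refine ContinuousOn.add ?_ (height.continuous.comp_continuousOn (hv0.mono interior_subset))
      unfold baseDivergence
      refine continuousOn_finsetSum _ fun i _ => ?_
      have h1 := (hv1.continuousOn_fderiv_of_isOpen isOpen_interior le_rfl).clm_apply
        (continuousOn_const (c := EuclideanSpace.single i (1 : ℝ)))
      exact (EuclideanSpace.proj (𝕜 := ℝ) i.castSucc).continuous.comp_continuousOn h1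
    have hΩ0 : ∀ y ∈ Ω, baseDivergence
        (fun x => graphNormal (extendFrom (interior (closure Ω)) (fderiv ℝ u) x)) y +
        height (graphNormal (extendFrom (interior (closure Ω)) (fderiv ℝ u) y)) = 0 := by
      intro y hy
      rw [baseDivergence_congr (hev y (hsub hy)), hGeq y (hsub hy),
        baseDivergence_graphNormal (huC y (hsub hy)) (hu.translator y hy), neg_add_cancel]
    have h2 := ((hc1.continuousAt (isOpen_interior.mem_nhds hx)).continuousWithinAt
      (s := Ω)).tendsto
    have : (𝓝[Ω] x).NeBot := mem_closure_iff_nhdsWithin_neBot.1 hcl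
    have h3 := tendsto_nhds_unique h2 (tendsto_const_nhds.congr'
      (Filter.eventually_of_mem self_mem_nhdsWithin fun y hy => (hΩ0 y hy).symm))
    linarith

/-- The data of a translating graph and a competitor, over the closure of a bounded domain. -/
theorem IsGraphicTranslator.isCompetitor {Ω : Set 𝔼[n]} {M W : Set 𝔼[n + 1]} (hn : 1 ≤ n)
    (hΩ : IsOpen Ω) (hconn : IsConnected Ω) (hbdd : Bornology.IsBounded Ω)
    (hu : IsGraphicTranslator Ω u) (hM_graph : M = graphMap u '' closure Ω)
    (hM : IsHypersurface M) (hW_compact : IsCompact W) (hW : IsHypersurface W)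
    (hW_cyl : W ⊆ verticalCylinder (closure Ω))
    (hW_bdry : hypersurfaceBoundary M = hypersurfaceBoundary W) :
    IsCompetitor (closure Ω) u M W where
  eq_image := hM_graph
  compact := hbdd.isCompact_closure
  continuousOn := hu.contDiffOn.continuousOn
  isBigO x hx := (hu.contDiffOn.differentiableOn two_ne_zero x hx).hasFDerivWithinAt.isBigO_sub
  contDiffOn := (hu.contDiffOn.mono interior_subset).of_le one_le_two
  hypersurface := hM
  one_le := hn
  nonempty := hconn.nonempty.closure
  isPreconnected := hconn.isPreconnected.subset_closure hΩ.subset_interior_closure interior_subset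
  fderiv_le := by
    have hG := hu.contDiffOn.continuousOn_extendFrom_fderiv
      (closure_mono hΩ.subset_interior_closure)
    obtain ⟨L, hL⟩ := hbdd.isCompact_closure.exists_bound_of_continuousOn hG
    refine ⟨L, fun x hx => ?_⟩
    rw [← hu.contDiffOn.extendFrom_fderiv_eq hx]
    exact hL x (interior_subset hx)
  compact_competitor := hW_compact
  hypersurface_competitor := hW
  base_mem p hp := hW_cyl hp
  boundary_eq := hW_bdry

end Extension

end

theorem mainTheorem7 (n : ℕ) (hn : 1 ≤ n)
    (Ω : Set (EuclideanSpace ℝ (Fin n))) (hΩ_open : IsOpen Ω) (hΩ_conn : IsConnected Ω)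
    (hΩ_bdd : Bornology.IsBounded Ω)
    (u : EuclideanSpace ℝ (Fin n) → ℝ) (hu : IsGraphicTranslator Ω u)
    (M : Set (EuclideanSpace ℝ (Fin (n + 1)))) (hM_graph : M = graphMap u '' closure Ω)
    (hM : IsHypersurface M)
    (W : Set (EuclideanSpace ℝ (Fin (n + 1)))) (hW_compact : IsCompact W)
    (hW : IsHypersurface W) (hW_cyl : W ⊆ verticalCylinder (closure Ω))
    (hW_bdry : hypersurfaceBoundary M = hypersurfaceBoundary W) :
    weightedArea M ≤ weightedArea W ∧ (weightedArea M = weightedArea W ↔ W = M) :=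
  (hu.isCalibration hΩ_open).weightedArea_le_and_eq_iff
    (hu.isCompetitor hn hΩ_open hΩ_conn hΩ_bdd hM_graph hM hW_compact hW hW_cyl hW_bdry)
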